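/- Let $n\ge 1$, $\ell>0$ and $\rho\in \mathrm{SO}(2n)$. Let $\mathbb H^{2n+1}=\{(x,u,v)\in\mathbb R^{2n}\times\mathbb R\times\mathbb R : |x|^2-uv=-1,\ u>0\}$ be the hyperboloid model of hyperbolic space, with the metric induced by the Lorentz form $|x|^2-uv$. Let $C_{\ell,\rho}=\mathbb H^{2n+1}/\langle g_0\rangle$ be the quotient by the cyclic group generated by the isometry $g_0=\mathrm{diag}(\rho,e^{\ell},e^{-\ell})$, and let $\gamma\subset C_{\ell,\rho}$ be its core geodesic, the closed geodesic of length $\ell$ that is the image of the axis $t\mapsto(0,e^t,e^{-t})$ of $g_0$. Neighborhoods of $\gamma$ are taken with respect to the hyperbolic distance. Let $R>37$. Then there are $C^\infty$ functions $\sigma,\tau:\mathbb R\to\mathbb R$ with $\sigma,\tau\ge 0$, $\sigma'\ge 1$, $\tau'\ge 0$ and $\sigma'',\tau''\ge 0$ on $[0,\infty)$, such that $\sigma(r)=r$ and $\tau(r)=1$ for $r\le 1/R$, and $\sigma(r)=\sinh r$ and $\tau(r)=\cosh r$ for $r\ge R$, and there is a smooth Riemannian metric $g$ on $C_{\ell,\rho}$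 with the following properties: (0) in the generalized cylindrical coordinates $(r,\theta,z)\in[0,\infty)\times S^{2n-1}\times\mathbb R$ around $\gamma$, in which $(r,\theta,z)$ stands for the image of $(\sinh r\,\theta,\cosh r\,e^{z},\cosh r\,e^{-z})$, one has $$g=dr^2+\sigma(r)^2\,d\theta_{S^{2n-1}}^2+\tau(r)^2\,dz^2;$$ (1) outside the $R$-neighborhood of $\gamma$, $g$ coincides with the hyperbolic metric; (2) inside the $(1/R)$-neighborhood of $\gamma$, $g$ is flat; (3) the sectional curvature of $g$ on every tangent $2$-plane is nonpositive; (4) $\gamma$ is a closed unit-speed geodesic of $g$, and its holonomy is given by the matrix $\rho$: for some orthonormal basis of the normal space of $\gamma$ at its base point, the parallel transport of $g$ once around $\gamma$ has matrix $\rho$ on the normal space. (Here $\gamma$ is run through from time $\ell$ to time $0$; in the opposite direction one gets $\rho^{-1}=\rho^{T}$ in the same basis, and this matrix is conjugate to $\rho$ in $\mathrm{O}(2n)$.) -/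

import Mathlib

open scoped Manifold ContDiff Topology

noncomputable section

/-! ## Riemannian geometry in charts

`M` is a smooth manifold without boundary, modelled on the finite-dimensional vector space `E`.
Recall that in Mathlib the tangent space at `x` is a copy of `E`, identified with the actual tangent
space through the preferred chart `extChartAt 𝓘(ℝ, E) x`. -/

namespace RiemGeom

variable {E : Type*} [NormedAddCommGroup E] [NormedSpace ℝ E]
  {M : Type*} [TopologicalSpace M] [ChartedSpace E M] [IsManifold 𝓘(ℝ, E) ∞ M]

/-- Smooth Riemannian metrics on `M`. -/
abbrev SmoothMetric (E : Type*) [NormedAddCommGroup E] [NormedSpace ℝ E]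
    (M : Type*) [TopologicalSpace M] [ChartedSpace E M] [IsManifold 𝓘(ℝ, E) ∞ M] :=
  Bundle.ContMDiffRiemannianMetric 𝓘(ℝ, E) ∞ E (fun x : M => TangentSpace 𝓘(ℝ, E) x)

/-- The coefficients of the metric `g` in the preferred chart at `x`, at the point with
coordinates `y`: the value of the metric on the coordinate vectors `v` and `w`. -/
def coeff (g : SmoothMetric E M) (x : M) (y v w : E) : ℝ :=
  g.inner ((extChartAt 𝓘(ℝ, E) x).symm y)
    (mfderiv 𝓘(ℝ, E) 𝓘(ℝ, E) (extChartAt 𝓘(ℝ, E) x).symm y v)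
    (mfderiv 𝓘(ℝ, E) 𝓘(ℝ, E) (extChartAt 𝓘(ℝ, E) x).symm y w)

/-- The Christoffel symbol `Γ_y(v, w)` of the Levi-Civita connection of `g` in the preferred chart
at `x`: the vector determined by
`2 ⟨Γ(v, w), u⟩ = ∂_v ⟨w, u⟩ + ∂_w ⟨v, u⟩ - ∂_u ⟨v, w⟩` for all constant vectors `u`.
(If `E` is finite dimensional and `y` is in the range of the chart, such a vector exists and is
unique, because the coefficients of `g` at `y` form a positive definite bilinear form.) -/
def christoffel (g : SmoothMetric E M) (x : M) (y v w : E) : E :=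
  Classical.epsilon fun c : E => ∀ u : E,
    2 * coeff g x y c u =
      fderiv ℝ (fun y' => coeff g x y' w u) y v + fderiv ℝ (fun y' => coeff g x y' v u) y w
        - fderiv ℝ (fun y' => coeff g x y' v w) y u

/-- The curvature tensor `R(u, v) w = ∇_u ∇_v w - ∇_v ∇_u w - ∇_[u,v] w` of `g` at the point `x`,
computed in the preferred chart at `x` with the constant extensions of `u`, `v`, `w`. -/
def curvature (g : SmoothMetric E M) (x : M) (u v w : TangentSpace 𝓘(ℝ, E) x) :
    TangentSpace 𝓘(ℝ, E) x :=
  let y : E := extChartAt 𝓘(ℝ, E) x x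
  let Γ : E → E → E → E := christoffel g x
  (fderiv ℝ (fun y' => Γ y' v w) y u - fderiv ℝ (fun y' => Γ y' u w) y v
    + Γ y u (Γ y v w) - Γ y v (Γ y u w) : E)

/-- The sectional curvature of the plane spanned by the linearly independent vectors `u`, `v`. -/
def sectionalCurvature (g : SmoothMetric E M) (x : M) (u v : TangentSpace 𝓘(ℝ, E) x) : ℝ :=
  g.inner x (curvature g x u v v) u /
    (g.inner x u u * g.inner x v v - g.inner x u v ^ 2)

/-- All sectional curvatures of `g` are nonpositive. -/
def NonposCurved (g : SmoothMetric E M) : Prop :=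
  ∀ (x : M) (u v : TangentSpace 𝓘(ℝ, E) x), LinearIndependent ℝ ![u, v] →
    sectionalCurvature g x u v ≤ 0

/-- The metric `g` is flat on the set `U`: its curvature tensor vanishes there. -/
def FlatOn (g : SmoothMetric E M) (U : Set M) : Prop :=
  ∀ x ∈ U, ∀ u v w : TangentSpace 𝓘(ℝ, E) x, curvature g x u v w = 0

/-- The velocity of the curve `c` at time `t`. -/
def velocity (c : ℝ → M) (t : ℝ) : TangentSpace 𝓘(ℝ, E) (c t) :=
  mfderiv 𝓘(ℝ, ℝ) 𝓘(ℝ, E) c t (1 : ℝ)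

/-- The vector field `V` along the smooth curve `c` is parallel for the Levi-Civita connection
of `g`: at each time `t₀`, its expression in the preferred chart at `c t₀` satisfies
`V' + Γ(c', V) = 0`. -/
def IsParallel (g : SmoothMetric E M) (c : ℝ → M) (V : ∀ t, TangentSpace 𝓘(ℝ, E) (c t)) : Prop :=
  ContMDiff 𝓘(ℝ, ℝ) 𝓘(ℝ, E) ∞ c ∧
  ∀ t₀ : ℝ, HasDerivAt
    (fun t => (mfderiv 𝓘(ℝ, E) 𝓘(ℝ, E) (extChartAt 𝓘(ℝ, E) (c t₀)) (c t) (V t) : E))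
    (-christoffel g (c t₀) (extChartAt 𝓘(ℝ, E) (c t₀) (c t₀)) (velocity (E := E) c t₀) (V t₀)) t₀

/-- The curve `c` is a geodesic of `g`, parametrized by arc length. -/
def IsUnitSpeedGeodesic (g : SmoothMetric E M) (c : ℝ → M) : Prop :=
  IsParallel g c (velocity (E := E) c) ∧
  ∀ t, g.inner (c t) (velocity c t) (velocity c t) = 1

/-- Parallel transport for `g` along `c`, from time `a` to time `b`, takes `v` to `w`. -/
def Transports (g : SmoothMetric E M) (c : ℝ → M) (a b : ℝ)
    (v : TangentSpace 𝓘(ℝ, E) (c a)) (w : TangentSpace 𝓘(ℝ, E) (c b)) : Prop :=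
  ∃ V : ∀ t, TangentSpace 𝓘(ℝ, E) (c t), IsParallel g c V ∧ V a = v ∧ V b = w

/-- The holonomy of `g` around the closed curve `c`, run through from time `a` to time `b`, is given
by the matrix `A` in an orthonormal basis `e` of the normal space of the curve at `c a = c b`:
the parallel transport of `e j` around the curve is `∑ i, A i j • e i`. -/
def HasNormalHolonomy (g : SmoothMetric E M) (c : ℝ → M) (a b : ℝ) {m : ℕ}
    (A : Matrix (Fin m) (Fin m) ℝ) : Prop :=
  c a = c b ∧ m + 1 = Module.finrank ℝ E ∧
  ∃ e : Fin m → E,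
    (∀ i j, g.inner (c a) (e i) (e j) = if i = j then 1 else 0) ∧
    (∀ i, g.inner (c a) (e i) (velocity (E := E) c a) = 0) ∧
    ∀ j, Transports g c a b (e j) (∑ i, A i j • e i : E)

end RiemGeom

/-! ## Hyperbolic space and the tubes -/

namespace HypTube

variable {n : ℕ}

/-- The vector space `ℝ^(2n) × ℝ × ℝ`, with points `(x, u, v)`. -/
abbrev Mink (n : ℕ) := EuclideanSpace ℝ (Fin (2 * n)) × ℝ × ℝ

/-- The Lorentz form with quadratic form `|x|² - u v`, of signature `(2n+1, 1)`. -/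
def lorentz (p q : Mink n) : ℝ :=
  inner ℝ p.1 q.1 - (p.2.1 * q.2.2 + p.2.2 * q.2.1) / 2

/-- The hyperboloid model of hyperbolic space of dimension `2n+1`. -/
def Hyp (n : ℕ) := {p : Mink n // lorentz p p = -1 ∧ 0 < p.2.1}

instance : TopologicalSpace (Hyp n) := inferInstanceAs (TopologicalSpace (Subtype _))

/-- The inclusion of the hyperboloid in the ambient vector space. -/
def Hyp.val (p : Hyp n) : Mink n := Subtype.val p

/-- The space of the global coordinates `(x, z)`. -/
abbrev Coord (n : ℕ) := EuclideanSpace ℝ (Fin (2 * n)) × ℝ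

lemma Hyp.prod_eq (p : Hyp n) : p.val.2.1 * p.val.2.2 = 1 + ‖p.val.1‖ ^ 2 := by
  have h := p.2.1
  simp only [lorentz, real_inner_self_eq_norm_sq] at h
  change ‖p.val.1‖ ^ 2 - (p.val.2.1 * p.val.2.2 + p.val.2.2 * p.val.2.1) / 2 = -1 at h
  linarith

lemma Hyp.u_pos (p : Hyp n) : 0 < p.val.2.1 := p.2.2

lemma Hyp.v_pos (p : Hyp n) : 0 < p.val.2.2 := by
  have h := p.prod_eq
  have := p.u_pos
  by_contra hv
  nlinarith [sq_nonneg ‖p.val.1‖, mul_nonneg this.le (not_lt.mp hv |> neg_nonneg.mpr)]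

/-- The point of the hyperboloid with coordinates `(x, z)`. -/
def Hyp.mk (q : Coord n) : Hyp n :=
  ⟨(q.1, √(1 + ‖q.1‖ ^ 2) * Real.exp q.2, √(1 + ‖q.1‖ ^ 2) * Real.exp (-q.2)), by
    have h : 0 < 1 + ‖q.1‖ ^ 2 := by positivity
    have h1 : √(1 + ‖q.1‖ ^ 2) ^ 2 = 1 + ‖q.1‖ ^ 2 := Real.sq_sqrt h.le
    have h2 : Real.exp q.2 * Real.exp (-q.2) = 1 := by rw [← Real.exp_add]; simp
    refine ⟨?_, by positivity⟩
    simp only [lorentz, real_inner_self_eq_norm_sq]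
    linear_combination (-Real.exp q.2 * Real.exp (-q.2)) * h1 - (1 + ‖q.1‖ ^ 2) * h2⟩

/-- Global coordinates `(x, z)` on the hyperboloid. Their inverse `Hyp.mk` is a smooth embedding
in the ambient vector space, so they define the usual smooth structure. -/
def Hyp.coord : Hyp n ≃ₜ Coord n where
  toFun p := (p.val.1, (Real.log p.val.2.1 - Real.log p.val.2.2) / 2)
  invFun := Hyp.mk
  left_inv p := by
    have hu := p.u_pos
    have hv := p.v_pos
    have h := p.prod_eq
    apply Subtype.ext
    change (p.val.1, _, _) = p.val
    have e1 : Real.exp ((Real.log p.val.2.1 - Real.log p.val.2.2) / 2)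
        = √(p.val.2.1 / p.val.2.2) := by
      rw [← Real.log_div hu.ne' hv.ne', Real.sqrt_eq_rpow, Real.rpow_def_of_pos (by positivity)]
      ring_nf
    have e2 : Real.exp (-((Real.log p.val.2.1 - Real.log p.val.2.2) / 2))
        = √(p.val.2.2 / p.val.2.1) := by
      rw [Real.exp_neg, e1, ← Real.sqrt_inv, inv_div]
    refine Prod.ext rfl (Prod.ext ?_ ?_)
    · change √(1 + ‖p.val.1‖ ^ 2) * Real.exp ((Real.log p.val.2.1 - Real.log p.val.2.2) / 2) = _
      rw [e1, ← h, ← Real.sqrt_mul (by positivity), Real.sqrt_eq_iff_mul_self_eq (by positivity) hu.le]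
      field_simp
    · change √(1 + ‖p.val.1‖ ^ 2) * Real.exp (-((Real.log p.val.2.1 - Real.log p.val.2.2) / 2)) = _
      rw [e2, ← h, ← Real.sqrt_mul (by positivity), Real.sqrt_eq_iff_mul_self_eq (by positivity) hv.le]
      field_simp
  right_inv q := by
    refine Prod.ext rfl ?_
    have h : 0 < √(1 + ‖q.1‖ ^ 2) := by positivity
    change (Real.log (√(1 + ‖q.1‖ ^ 2) * Real.exp q.2)
      - Real.log (√(1 + ‖q.1‖ ^ 2) * Real.exp (-q.2))) / 2 = q.2
    rw [Real.log_mul h.ne' (Real.exp_pos _).ne', Real.log_mul h.ne' (Real.exp_pos _).ne']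
    simp
  continuous_toFun := by
    have hc : Continuous (fun p : Hyp n => p.val) := continuous_subtype_val
    refine Continuous.prodMk (by fun_prop) (Continuous.div_const (Continuous.sub ?_ ?_) _)
    · exact Continuous.log (by fun_prop) fun p => p.u_pos.ne'
    · exact Continuous.log (by fun_prop) fun p => p.v_pos.ne'
  continuous_invFun := by
    refine Continuous.subtype_mk ?_ _
    fun_prop

instance : ChartedSpace (Coord n) (Hyp n) :=
  Hyp.coord.toOpenPartialHomeomorph.singletonChartedSpace (by simp)

instance : IsManifold 𝓘(ℝ, Coord n) ∞ (Hyp n) :=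
  Hyp.coord.toOpenPartialHomeomorph.isManifold_singleton (by simp)

/-- The hyperbolic metric: the restriction of the Lorentz form to the hyperboloid. -/
def hypMetric (p : Hyp n) (u v : TangentSpace 𝓘(ℝ, Coord n) p) : ℝ :=
  lorentz (mfderiv 𝓘(ℝ, Coord n) 𝓘(ℝ, Mink n) Hyp.val p u : Mink n)
    (mfderiv 𝓘(ℝ, Coord n) 𝓘(ℝ, Mink n) Hyp.val p v : Mink n)

/-- The hyperbolic distance. -/
def hypDist (p q : Hyp n) : ℝ := Real.arcosh (-lorentz p.val q.val)

/-- The rotation of `ℝ^(2n)` with matrix `ρ`. -/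
def rot (ρ : Matrix (Fin (2 * n)) (Fin (2 * n)) ℝ) (x : EuclideanSpace ℝ (Fin (2 * n))) :
    EuclideanSpace ℝ (Fin (2 * n)) :=
  Matrix.toEuclideanLin ρ x

lemma norm_rot {ρ : Matrix (Fin (2 * n)) (Fin (2 * n)) ℝ}
    (h : ρ.transpose * ρ = 1) (x : EuclideanSpace ℝ (Fin (2 * n))) : ‖rot ρ x‖ = ‖x‖ := by
  have : ‖rot ρ x‖ ^ 2 = ‖x‖ ^ 2 := by
    rw [EuclideanSpace.real_norm_sq_eq, EuclideanSpace.real_norm_sq_eq]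
    have e : ∀ y : Fin (2 * n) → ℝ, ∑ i, y i ^ 2 = y ⬝ᵥ y := fun y => by
      simp [dotProduct, sq]
    rw [e, e]
    change (ρ.mulVec x.ofLp) ⬝ᵥ (ρ.mulVec x.ofLp) = x.ofLp ⬝ᵥ x.ofLp
    rw [Matrix.dotProduct_mulVec, ← Matrix.mulVec_transpose, Matrix.mulVec_mulVec, h,
      Matrix.one_mulVec]
  nlinarith [norm_nonneg (rot ρ x), norm_nonneg x,
    (pow_left_inj₀ (norm_nonneg (rot ρ x)) (norm_nonneg x) two_ne_zero).mp this]

lemma rot_rot {ρ ρ' : Matrix (Fin (2 * n)) (Fin (2 * n)) ℝ}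
    (h : ρ * ρ' = 1) (x : EuclideanSpace ℝ (Fin (2 * n))) : rot ρ (rot ρ' x) = x := by
  apply WithLp.ofLp_injective
  change ρ.mulVec (ρ'.mulVec x.ofLp) = x.ofLp
  rw [Matrix.mulVec_mulVec, h, Matrix.one_mulVec]

lemma so_left (ρ : Matrix.specialOrthogonalGroup (Fin (2 * n)) ℝ) :
    (ρ : Matrix (Fin (2 * n)) (Fin (2 * n)) ℝ).transpose * ρ = 1 := by
  have h := (Matrix.mem_specialOrthogonalGroup_iff.mp ρ.2).1
  simpa [Matrix.star_eq_conjTranspose] using (Matrix.mem_orthogonalGroup_iff' (Fin (2 * n)) ℝ).mp h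

lemma so_right (ρ : Matrix.specialOrthogonalGroup (Fin (2 * n)) ℝ) :
    (ρ : Matrix (Fin (2 * n)) (Fin (2 * n)) ℝ) * (ρ : Matrix _ _ ℝ).transpose = 1 := by
  have h := (Matrix.mem_specialOrthogonalGroup_iff.mp ρ.2).1
  simpa [Matrix.star_eq_conjTranspose] using (Matrix.mem_orthogonalGroup_iff (Fin (2 * n)) ℝ).mp h

/-- The linear map with block matrix `diag(ρ, t, t⁻¹)` on the hyperboloid. -/
def blockMap (ρ : Matrix (Fin (2 * n)) (Fin (2 * n)) ℝ) (h : ρ.transpose * ρ = 1) (t : ℝ)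
    (ht : 0 < t) (p : Hyp n) : Hyp n :=
  ⟨(rot ρ p.val.1, t * p.val.2.1, t⁻¹ * p.val.2.2), by
    refine ⟨?_, mul_pos ht p.u_pos⟩
    have := p.prod_eq
    simp only [lorentz, real_inner_self_eq_norm_sq, norm_rot h]
    field_simp
    linarith⟩

/-- The isometry `diag(ρ, λ, λ⁻¹)` of hyperbolic space, where `λ = exp ℓ` is the larger root of
`t² - 2 cosh(ℓ) t + 1`. It translates its axis by the distance `ℓ`. -/
def deck (ℓ : ℝ) (ρ : Matrix.specialOrthogonalGroup (Fin (2 * n)) ℝ) : Equiv.Perm (Hyp n) where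
  toFun := blockMap ρ (so_left ρ) (Real.exp ℓ) (Real.exp_pos ℓ)
  invFun := blockMap (ρ : Matrix _ _ ℝ).transpose (by simpa using so_right ρ) (Real.exp ℓ)⁻¹
    (inv_pos.mpr (Real.exp_pos ℓ))
  left_inv p := by
    apply Subtype.ext
    refine Prod.ext (rot_rot (so_left ρ) _) (Prod.ext ?_ ?_)
    · exact inv_mul_cancel_left₀ (Real.exp_pos ℓ).ne' _
    · change (Real.exp ℓ)⁻¹⁻¹ * ((Real.exp ℓ)⁻¹ * p.val.2.2) = p.val.2.2
      rw [inv_inv]; exact mul_inv_cancel_left₀ (Real.exp_pos ℓ).ne' _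
  right_inv p := by
    apply Subtype.ext
    refine Prod.ext (rot_rot (so_right ρ) _) (Prod.ext ?_ ?_)
    · exact mul_inv_cancel_left₀ (Real.exp_pos ℓ).ne' _
    · change (Real.exp ℓ)⁻¹ * ((Real.exp ℓ)⁻¹⁻¹ * p.val.2.2) = p.val.2.2
      rw [inv_inv]; exact inv_mul_cancel_left₀ (Real.exp_pos ℓ).ne' _

/-- The tube: the quotient of hyperbolic space by the cyclic group generated by the isometry
`deck ℓ ρ`. -/
def Tube (ℓ : ℝ) (ρ : Matrix.specialOrthogonalGroup (Fin (2 * n)) ℝ) :=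
  MulAction.orbitRel.Quotient (Subgroup.zpowers (deck ℓ ρ)) (Hyp n)

variable {ℓ : ℝ} {ρ : Matrix.specialOrthogonalGroup (Fin (2 * n)) ℝ}

instance : TopologicalSpace (Tube ℓ ρ) :=
  inferInstanceAs (TopologicalSpace (Quotient (MulAction.orbitRel _ _)))

/-- The projection from hyperbolic space to the tube. -/
def proj (ℓ : ℝ) (ρ : Matrix.specialOrthogonalGroup (Fin (2 * n)) ℝ) (p : Hyp n) : Tube ℓ ρ :=
  Quotient.mk (MulAction.orbitRel (Subgroup.zpowers (deck ℓ ρ)) (Hyp n)) p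

/-! ### The smooth structure of the tube -/

lemma proj_surjective : Function.Surjective (proj (n := n) ℓ ρ) := Quotient.mk_surjective

lemma proj_eq_iff {p q : Hyp n} : proj ℓ ρ p = proj ℓ ρ q ↔ ∃ k : ℤ, (deck ℓ ρ ^ k) q = p := by
  refine (Quotient.eq (r := MulAction.orbitRel (Subgroup.zpowers (deck ℓ ρ)) (Hyp n))).trans ?_
  rw [MulAction.orbitRel_apply, MulAction.mem_orbit_iff]
  constructor
  · rintro ⟨⟨_, k, rfl⟩, h⟩
    exact ⟨k, h⟩
  · rintro ⟨k, h⟩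
    exact ⟨⟨_, k, rfl⟩, h⟩

lemma rot_contDiff (ρ : Matrix (Fin (2 * n)) (Fin (2 * n)) ℝ) : ContDiff ℝ ∞ (rot ρ) :=
  (LinearMap.toContinuousLinearMap (Matrix.toEuclideanLin ρ)).contDiff

lemma coord_blockMap (ρ : Matrix (Fin (2 * n)) (Fin (2 * n)) ℝ) (h : ρ.transpose * ρ = 1) (t : ℝ)
    (ht : 0 < t) (p : Hyp n) : (blockMap ρ h t ht p).coord =
      (rot ρ p.coord.1, p.coord.2 + Real.log t) := by
  refine Prod.ext rfl ?_
  change (Real.log (t * p.val.2.1) - Real.log (t⁻¹ * p.val.2.2)) / 2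
    = (Real.log p.val.2.1 - Real.log p.val.2.2) / 2 + Real.log t
  rw [Real.log_mul ht.ne' p.u_pos.ne', Real.log_mul (inv_ne_zero ht.ne') p.v_pos.ne', Real.log_inv]
  ring

lemma coord_deck (p : Hyp n) : (deck ℓ ρ p).coord = (rot ρ p.coord.1, p.coord.2 + ℓ) := by
  have h := coord_blockMap ρ (so_left ρ) (Real.exp ℓ) (Real.exp_pos ℓ) p
  rw [Real.log_exp] at h
  exact h

lemma coord_deck_inv (p : Hyp n) : ((deck ℓ ρ)⁻¹ p).coord =
    (rot (ρ : Matrix _ _ ℝ).transpose p.coord.1, p.coord.2 - ℓ) := by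
  have h := coord_blockMap (ρ : Matrix _ _ ℝ).transpose (by simpa using so_right ρ) (Real.exp ℓ)⁻¹
    (inv_pos.mpr (Real.exp_pos ℓ)) p
  rw [Real.log_inv, Real.log_exp, ← sub_eq_add_neg] at h
  exact h

lemma coord_deck_zpow_snd (k : ℤ) (p : Hyp n) :
    ((deck ℓ ρ ^ k) p).coord.2 = p.coord.2 + k * ℓ := by
  induction k using Int.induction_on generalizing p with
  | zero => simp
  | succ k ih =>
    rw [zpow_add, Equiv.Perm.mul_apply, ih, zpow_one, coord_deck]
    push_cast; ring
  | pred k ih =>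
    rw [zpow_sub, Equiv.Perm.mul_apply, ih, zpow_one, coord_deck_inv]
    push_cast; ring

lemma deck_zpow_contDiff (k : ℤ) :
    ContDiff ℝ ∞ (fun q : Coord n => ((deck ℓ ρ ^ k) (Hyp.coord.symm q)).coord) := by
  induction k using Int.induction_on with
  | zero =>
    simp only [zpow_zero, Equiv.Perm.one_apply, Homeomorph.apply_symm_apply]
    exact contDiff_id
  | succ k ih =>
    have h : ContDiff ℝ ∞ (fun q : Coord n => (rot ρ q.1, q.2 + ℓ)) :=
      ((rot_contDiff _).comp contDiff_fst).prodMk (contDiff_snd.add contDiff_const)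
    convert ih.comp h using 2 with q
    rw [zpow_add, zpow_one, Equiv.Perm.mul_apply, Function.comp]
    congr 2
    exact Hyp.coord.injective (by simp [coord_deck])
  | pred k ih =>
    have h : ContDiff ℝ ∞ (fun q : Coord n => (rot (ρ : Matrix _ _ ℝ).transpose q.1, q.2 - ℓ)) :=
      ((rot_contDiff _).comp contDiff_fst).prodMk (contDiff_snd.sub contDiff_const)
    convert ih.comp h using 2 with q
    rw [zpow_sub, zpow_one, Equiv.Perm.mul_apply, Function.comp]
    congr 2
    exact Hyp.coord.injective (by rw [coord_deck_inv]; simp)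

lemma deck_zpow_continuous (k : ℤ) : Continuous (deck (n := n) ℓ ρ ^ k) := by
  have h := Hyp.coord.symm.continuous.comp
    ((deck_zpow_contDiff (n := n) (ℓ := ℓ) (ρ := ρ) k).continuous.comp Hyp.coord.continuous)
  convert h using 1
  ext p
  simp

lemma proj_continuous : Continuous (proj (n := n) ℓ ρ) := continuous_quotient_mk'

lemma proj_isOpenMap : IsOpenMap (proj (n := n) ℓ ρ) := by
  intro U hU
  have h : IsOpen (proj ℓ ρ ⁻¹' (proj ℓ ρ '' U)) := by
    have : proj ℓ ρ ⁻¹' (proj ℓ ρ '' U) = ⋃ k : ℤ, (deck ℓ ρ ^ k) ⁻¹' U := by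
      ext p
      simp only [Set.mem_preimage, Set.mem_image, Set.mem_iUnion, proj_eq_iff]
      constructor
      · rintro ⟨q, hq, k, rfl⟩
        exact ⟨k, hq⟩
      · rintro ⟨k, hk⟩
        exact ⟨_, hk, k, rfl⟩
    rw [this]
    exact isOpen_iUnion fun k => hU.preimage (deck_zpow_continuous k)
  exact isOpen_coinduced.mpr h

/-- The slab `|z - s| < ℓ/2` of hyperbolic space, on which the projection is injective. -/
def slab (n : ℕ) (ℓ s : ℝ) : Set (Hyp n) := {p | |p.coord.2 - s| < ℓ / 2}

lemma slab_isOpen (s : ℝ) : IsOpen (slab n ℓ s) := by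
  have : Continuous fun p : Hyp n => |p.coord.2 - s| :=
    ((continuous_snd.comp Hyp.coord.continuous).sub continuous_const).abs
  exact isOpen_lt this continuous_const

lemma zpow_eq_zero_of_slab [hℓ : Fact (0 < ℓ)] {s : ℝ} {p : Hyp n} {k : ℤ} (hp : p ∈ slab n ℓ s)
    (hq : (deck ℓ ρ ^ k) p ∈ slab n ℓ s) : k = 0 := by
  have h0 := hℓ.out
  simp only [slab, Set.mem_ofPred_eq, coord_deck_zpow_snd, abs_lt] at hp hq
  by_contra hk
  rcases Int.lt_or_gt_of_ne hk with h | h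
  · have : (k : ℝ) ≤ -1 := by exact_mod_cast Int.le_sub_one_of_lt h
    nlinarith
  · have : (1 : ℝ) ≤ k := by exact_mod_cast h
    nlinarith

lemma proj_injOn [Fact (0 < ℓ)] (s : ℝ) : Set.InjOn (proj ℓ ρ) (slab n ℓ s) := by
  intro p hp q hq h
  obtain ⟨k, rfl⟩ := proj_eq_iff.mp h
  simp [zpow_eq_zero_of_slab hq hp]

instance : Nonempty (Hyp n) := ⟨Hyp.mk 0⟩

/-- The restriction of the projection to a slab. -/
def slabHomeo [Fact (0 < ℓ)] (ρ : Matrix.specialOrthogonalGroup (Fin (2 * n)) ℝ) (s : ℝ) :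
    OpenPartialHomeomorph (Hyp n) (Tube ℓ ρ) :=
  OpenPartialHomeomorph.ofContinuousOpen ((proj_injOn (ρ := ρ) s).toPartialEquiv)
    proj_continuous.continuousOn proj_isOpenMap (slab_isOpen s)

/-- The chart of the tube on the image of a slab: lift to the slab and take the coordinates
`(x, z)`. -/
def tubeChart [Fact (0 < ℓ)] (ρ : Matrix.specialOrthogonalGroup (Fin (2 * n)) ℝ) (s : ℝ) :
    OpenPartialHomeomorph (Tube ℓ ρ) (Coord n) :=
  (slabHomeo ρ s).symm.trans Hyp.coord.toOpenPartialHomeomorph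

instance [hℓ : Fact (0 < ℓ)] : ChartedSpace (Coord n) (Tube ℓ ρ) where
  atlas := Set.range (tubeChart ρ)
  chartAt c := tubeChart ρ (Function.surjInv proj_surjective c).coord.2
  mem_chart_source c := by
    have h := Function.surjInv_eq proj_surjective c
    have : c ∈ proj ℓ ρ '' slab n ℓ (Function.surjInv proj_surjective c).coord.2 :=
      ⟨_, by simpa [slab] using hℓ.out, h⟩
    simpa [tubeChart, slabHomeo] using this
  chart_mem_atlas c := Set.mem_range_self _

lemma slabHomeo_apply [Fact (0 < ℓ)] (s : ℝ) (p : Hyp n) : slabHomeo ρ s p = proj ℓ ρ p := rfl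

lemma slabHomeo_source [Fact (0 < ℓ)] (s : ℝ) :
    (slabHomeo (ℓ := ℓ) ρ s).source = slab n ℓ s := rfl

instance [Fact (0 < ℓ)] : IsManifold 𝓘(ℝ, Coord n) ∞ (Tube ℓ ρ) := by
  apply isManifold_of_contDiffOn
  rintro _ _ ⟨s, rfl⟩ ⟨t, rfl⟩
  simp only [modelWithCornersSelf_coe, modelWithCornersSelf_coe_symm, Function.id_comp,
    Function.comp_id, Set.preimage_id, Set.range_id, Set.inter_univ]
  intro q hq
  set p : Hyp n := Hyp.coord.symm q with hp
  have hq' : p ∈ slab n ℓ s ∧ proj ℓ ρ p ∈ (slabHomeo (ℓ := ℓ) ρ t).target := by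
    simpa [tubeChart, OpenPartialHomeomorph.trans_source, slabHomeo_apply,
      slabHomeo_source, hp] using hq
  obtain ⟨hs, ht⟩ := hq'
  set r := (slabHomeo (ℓ := ℓ) ρ t).symm (proj ℓ ρ p) with hr
  have hr1 : r ∈ slab n ℓ t := (slabHomeo (ℓ := ℓ) ρ t).map_target ht
  have hr2 : proj ℓ ρ r = proj ℓ ρ p := (slabHomeo (ℓ := ℓ) ρ t).right_inv ht
  obtain ⟨k, hk⟩ := proj_eq_iff.mp hr2
  refine ContDiffAt.contDiffWithinAt ?_
  refine (deck_zpow_contDiff (n := n) (ℓ := ℓ) (ρ := ρ) k).contDiffAt.congr_of_eventuallyEq ?_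
  have hopen : IsOpen ((fun q : Coord n => (deck ℓ ρ ^ k) (Hyp.coord.symm q)) ⁻¹' slab n ℓ t) :=
    (slab_isOpen t).preimage ((deck_zpow_continuous k).comp Hyp.coord.symm.continuous)
  filter_upwards [hopen.mem_nhds (by simpa [← hp, hk] using hr1)] with q' hq'
  change Hyp.coord ((slabHomeo (ℓ := ℓ) ρ t).symm (proj ℓ ρ (Hyp.coord.symm q'))) = _
  congr 1
  have : proj ℓ ρ (Hyp.coord.symm q') = slabHomeo ρ t ((deck ℓ ρ ^ k) (Hyp.coord.symm q')) :=
    (proj_eq_iff.mpr ⟨k, rfl⟩).symm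
  rw [this]
  exact (slabHomeo (ℓ := ℓ) ρ t).left_inv hq'

/-! ### The core geodesic, its neighborhoods, and doubly warped products -/

/-- The axis of `deck ℓ ρ`, parametrized by arc length: `t ↦ (0, exp t, exp (-t))`. -/
def axis (n : ℕ) (t : ℝ) : Hyp n :=
  ⟨(0, Real.exp t, Real.exp (-t)), by simp [lorentz, ← Real.exp_add], Real.exp_pos t⟩

/-- The core geodesic of the tube: the image of the axis, a closed geodesic of length `ℓ`. -/
def core (ℓ : ℝ) (ρ : Matrix.specialOrthogonalGroup (Fin (2 * n)) ℝ) (t : ℝ) : Tube ℓ ρ :=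
  proj ℓ ρ (axis n t)

/-- The open neighborhood of radius `r` of the core geodesic for the hyperbolic distance: the image
of the set of points at distance less than `r` from the axis. -/
def coreNhd (ℓ : ℝ) (ρ : Matrix.specialOrthogonalGroup (Fin (2 * n)) ℝ) (r : ℝ) :
    Set (Tube ℓ ρ) :=
  proj ℓ ρ '' {p | ∃ t, hypDist p (axis n t) < r}

variable [Fact (0 < ℓ)]

/-- The metric `g` on the tube coincides at the point `c` with the hyperbolic metric of the tube,
that is the metric for which the projection from hyperbolic space is a local isometry. -/
def IsHyperbolicAt (g : RiemGeom.SmoothMetric (Coord n) (Tube ℓ ρ)) (c : Tube ℓ ρ) : Prop :=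
  ∀ p : Hyp n, proj ℓ ρ p = c → ∀ u v : TangentSpace 𝓘(ℝ, Coord n) p,
    g.inner (proj ℓ ρ p) (mfderiv 𝓘(ℝ, Coord n) 𝓘(ℝ, Coord n) (proj ℓ ρ) p u)
      (mfderiv 𝓘(ℝ, Coord n) 𝓘(ℝ, Coord n) (proj ℓ ρ) p v) = hypMetric p u v

/-- Generalized cylindrical coordinates around the axis: for a unit vector `θ` of `ℝ^(2n)` and
`0 ≤ r`, the point of the tube below the point
`(sinh r θ, cosh r exp z, cosh r exp (-z))` of the hyperboloid, which is at distance `r` from the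
axis, in the direction `θ`, over the point of the axis with parameter `z`. -/
def cyl (ℓ : ℝ) (ρ : Matrix.specialOrthogonalGroup (Fin (2 * n)) ℝ)
    (q : ℝ × EuclideanSpace ℝ (Fin (2 * n)) × ℝ) : Tube ℓ ρ :=
  proj ℓ ρ (Hyp.mk (Real.sinh q.1 • q.2.1, q.2.2))

/-- The metric `g` is the doubly warped product `dr² + σ(r)² dθ² + τ(r)² dz²` in generalized
cylindrical coordinates, where `dθ²` is the round metric of the unit sphere of `ℝ^(2n)`: the square
of the length of the tangent vector with components `a`, `w` (orthogonal to `θ`) and `b` is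
`a² + σ(r)² |w|² + τ(r)² b²`. -/
def IsDoublyWarped (g : RiemGeom.SmoothMetric (Coord n) (Tube ℓ ρ)) (σ τ : ℝ → ℝ) : Prop :=
  ∀ (r : ℝ) (θ : EuclideanSpace ℝ (Fin (2 * n))) (z : ℝ), 0 ≤ r → ‖θ‖ = 1 →
    ∀ (a : ℝ) (w : EuclideanSpace ℝ (Fin (2 * n))) (b : ℝ), inner ℝ θ w = 0 →
      g.inner (cyl ℓ ρ (r, θ, z))
        (mfderiv 𝓘(ℝ, ℝ × EuclideanSpace ℝ (Fin (2 * n)) × ℝ) 𝓘(ℝ, Coord n) (cyl ℓ ρ) (r, θ, z)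
          (a, w, b))
        (mfderiv 𝓘(ℝ, ℝ × EuclideanSpace ℝ (Fin (2 * n)) × ℝ) 𝓘(ℝ, Coord n) (cyl ℓ ρ) (r, θ, z)
          (a, w, b))
      = a ^ 2 + σ r ^ 2 * ‖w‖ ^ 2 + τ r ^ 2 * b ^ 2

/-- The smooth convex functions that interpolate between `r` and `sinh r`, and between `1` and
`cosh r`, on the interval from `1 / R` to `R`. -/
structure IsInterpolatingPair (R : ℝ) (σ τ : ℝ → ℝ) : Prop where
  smooth_sigma : ContDiff ℝ ∞ σ
  smooth_tau : ContDiff ℝ ∞ τ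
  sigma_nonneg : ∀ r, 0 ≤ r → 0 ≤ σ r
  tau_nonneg : ∀ r, 0 ≤ r → 0 ≤ τ r
  one_le_deriv_sigma : ∀ r, 0 ≤ r → 1 ≤ deriv σ r
  deriv_tau_nonneg : ∀ r, 0 ≤ r → 0 ≤ deriv τ r
  deriv_deriv_sigma_nonneg : ∀ r, 0 ≤ r → 0 ≤ deriv (deriv σ) r
  deriv_deriv_tau_nonneg : ∀ r, 0 ≤ r → 0 ≤ deriv (deriv τ) r
  sigma_of_le : ∀ r, r ≤ 1 / R → σ r = r
  sigma_of_ge : ∀ r, R ≤ r → σ r = Real.sinh r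
  tau_of_le : ∀ r, r ≤ 1 / R → τ r = 1
  tau_of_ge : ∀ r, R ≤ r → τ r = Real.cosh r

end HypTube

end

noncomputable section

namespace HypTube

/-! ### Convex interpolation of functions of one variable -/

/-! Put x = sinh r · θ and q = |x|² = sinh² r. In the global coordinates (x, z) a doubly warped
product reads A |dx|² + B ⟨x, dx⟩² + C dz², where A = σ(r)²/q, C = τ(r)², and A + qB = 1/(1 + q),
which says that r is arc length along radial lines. As A, B, C depend on q alone, the form is
invariant under rotations of x and translations of z, hence under g₀, and descends to the tube
(`tubeMetric`). It is smooth across the axis because σ(r) = r and τ(r) = 1 there and r / sinh r is a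
smooth function of q (`exists_arsinh_quotient`, `exists_isWarpCoeff`). For σ = sinh, τ = cosh it is
the hyperbolic metric.

The curvature tensor of such a form has seven coefficient functions of q (`warpCurv_eq`).
Antisymmetry of ⟨R(u,v)w, t⟩ in w and t reduces them to four, which encode the curvatures of the
coordinate planes: (1 - σ'²)/σ², -σ''/σ, -σ'τ'/(στ) and -τ''/τ. All are nonpositive if σ and τ are
convex with σ' ≥ 1 and τ' ≥ 0. For an arbitrary plane, q times the numerator of the sectional
curvature is a combination of these four signs with nonnegative weights
(`warpForm_warpCurv_nonpos`). Near the core σ' = 1 and τ' = 0, so all coefficients vanish.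

The functions σ and τ come from `exists_convex_interpolation`, which joins sinh and cosh to their
tangent lines at 0.

The Christoffel symbols vanish on the axis x = 0, so fields with constant coordinates are parallel
along the core. The deck transformation identifies the vector (v, 0) at z = 0 with (ρ v, 0) at z =
ℓ; this is the holonomy (`hasNormalHolonomy_core`). -/

lemma exists_contDiff_primitive {h : ℝ → ℝ} (hh : ContDiff ℝ ∞ h) (a α : ℝ) :
    ∃ H : ℝ → ℝ, ContDiff ℝ ∞ H ∧ H a = α ∧ ∀ x, HasDerivAt H (h x) x := by
  have hd : ∀ x, HasDerivAt (fun x => α + ∫ t in a..x, h t) (h x) x := fun x =>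
    (intervalIntegral.integral_hasDerivAt_right (hh.continuous.intervalIntegrable _ _)
      (hh.continuous.stronglyMeasurableAtFilter _ _) hh.continuous.continuousAt).const_add α
  refine ⟨_, ?_, by simp, hd⟩
  refine contDiff_infty_iff_deriv.mpr ⟨fun x => (hd x).differentiableAt, ?_⟩
  rwa [show deriv (fun x => α + ∫ t in a..x, h t) = h from funext fun x => (hd x).deriv]

lemma exists_contDiff_second_primitive {h : ℝ → ℝ} (hh : ContDiff ℝ ∞ h) (a α β : ℝ) :
    ∃ G G' : ℝ → ℝ, ContDiff ℝ ∞ G ∧ G a = α ∧ G' a = β ∧ (∀ x, HasDerivAt G (G' x) x) ∧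
      ∀ x, HasDerivAt G' (h x) x := by
  obtain ⟨G', hG', h1, h2⟩ := exists_contDiff_primitive hh a β
  obtain ⟨G, hG, h3, h4⟩ := exists_contDiff_primitive hG' a α
  exact ⟨G, G', hG, h3, h1, h4, h2⟩

lemma monotoneOn_of_hasDerivAt {f f' : ℝ → ℝ} {s : Set ℝ} (hs : Convex ℝ s)
    (h : ∀ x, HasDerivAt f (f' x) x) (h0 : ∀ x ∈ s, 0 ≤ f' x) : MonotoneOn f s :=
  monotoneOn_of_deriv_nonneg hs (fun x _ => (h x).continuousAt.continuousWithinAt)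
    (fun x _ => (h x).differentiableAt.differentiableWithinAt)
    fun x hx => by rw [(h x).deriv]; exact h0 x (interior_subset hx)

lemma eqOn_const_of_hasDerivAt {f f' : ℝ → ℝ} {s : Set ℝ} (hs : Convex ℝ s)
    (h : ∀ x, HasDerivAt f (f' x) x) (h0 : ∀ x ∈ s, f' x = 0) {x y : ℝ} (hx : x ∈ s)
    (hy : y ∈ s) : f x = f y := by
  have h1 := monotoneOn_of_hasDerivAt hs h fun x hx => (h0 x hx).ge
  have h2 := monotoneOn_of_hasDerivAt hs (fun x => (h x).neg) fun x hx => by simp [h0 x hx]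
  rcases le_total x y with hxy | hxy
  · have := h1 hx hy hxy
    have := h2 hx hy hxy
    simp only [Pi.neg_apply] at this
    linarith
  · have := h1 hy hx hxy
    have := h2 hy hx hxy
    simp only [Pi.neg_apply] at this
    linarith

/-- A smooth convex function that interpolates between `0` and the identity. -/
lemma exists_smooth_relu : ∃ ψ ψ' ψ'' : ℝ → ℝ, ContDiff ℝ ∞ ψ ∧ (∀ x, HasDerivAt ψ (ψ' x) x) ∧
    (∀ x, HasDerivAt ψ' (ψ'' x) x) ∧ (∀ x, 0 ≤ ψ'' x) ∧ (∀ x ≤ -1 / 4, ψ x = 0) ∧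
    ∀ x, 1 / 4 ≤ x → ψ x = x := by
  -- A double primitive `g` of a bump supported in [-1/8, 1/8] vanishes to the left and is affine of
  -- slope `m` to the right; shifting and rescaling it gives ψ.
  let b : ContDiffBump (0 : ℝ) := ⟨1 / 16, 1 / 8, by norm_num, by norm_num⟩
  have hb : ∀ x, 1 / 8 ≤ |x| → b x = 0 := fun x hx =>
    b.zero_of_le_dist (by simpa [b] using hx)
  obtain ⟨g, g', hg, hg0, hg'0, hd, hd'⟩ :=
    exists_contDiff_second_primitive (h := b) b.contDiff (-1 / 8) 0 0
  have hmono : Monotone g' := monotoneOn_univ.mp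
    (monotoneOn_of_hasDerivAt convex_univ hd' fun x _ => b.nonneg)
  have hneg' : ∀ x ≤ -1 / 8, g' x = 0 := fun x hx => by
    rw [← hg'0]
    exact eqOn_const_of_hasDerivAt (convex_Iic (-1 / 8)) hd'
      (fun y hy => hb y (by rw [abs_of_nonpos] <;> linarith [Set.mem_Iic.mp hy])) hx
      (Set.mem_Iic.mpr le_rfl)
  have hneg : ∀ x ≤ -1 / 8, g x = 0 := fun x hx => by
    rw [← hg0]
    exact eqOn_const_of_hasDerivAt (convex_Iic (-1 / 8)) hd (fun y hy => hneg' y hy) hx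
      (Set.mem_Iic.mpr le_rfl)
  set m := g' (1 / 8) with hm
  have hpos' : ∀ x, 1 / 8 ≤ x → g' x = m := fun x hx =>
    eqOn_const_of_hasDerivAt (convex_Ici (1 / 8)) hd'
      (fun y hy => hb y (by rw [abs_of_nonneg] <;> linarith [Set.mem_Ici.mp hy])) hx
      (Set.mem_Ici.mpr le_rfl)
  -- If m = 0, the monotone function `g'` vanishes on [-1/8, 1/8], so its derivative at 0 is 0,
  -- whereas the bump equals 1 there.
  have hm0 : 0 < m := by
    have h0 : ∀ x, 0 ≤ g' x := fun x => by
      rcases le_total x (-1 / 8) with h | h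
      · rw [hneg' x h]
      · rw [← hg'0]; exact hmono h
    refine lt_of_le_of_ne (h0 _) fun h => ?_
    have hc : ∀ x ∈ Set.Icc (-1 / 8 : ℝ) (1 / 8), g' x = 0 := fun x hx =>
      le_antisymm ((hmono hx.2).trans h.ge) (h0 x)
    have : HasDerivAt g' 0 0 := (hasDerivAt_const (0 : ℝ) (0 : ℝ)).congr_of_eventuallyEq <| by
      filter_upwards [Icc_mem_nhds (show (-1 / 8 : ℝ) < 0 by norm_num)
        (show (0 : ℝ) < 1 / 8 by norm_num)] with x hx using hc x hx
    have h1 := this.unique (hd' 0)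
    rw [b.one_of_mem_closedBall (by simp [b])] at h1
    norm_num at h1
  -- `k` is the zero of the right-hand affine piece. The slopes lie in [0, m], so 0 ≤ g(1/8) ≤ m/4
  -- and |k| ≤ 1/8; after the shift by `k` the transition still takes place within [-1/4, 1/4].
  set k := 1 / 8 - g (1 / 8) / m with hk
  have hpos : ∀ x, 1 / 8 ≤ x → g x = m * (x - k) := fun x hx => by
    have h1 : ∀ x, HasDerivAt (fun x => g x - m * (x - k)) (g' x - m * 1) x := fun x =>
      (hd x).sub (((hasDerivAt_id x).sub_const k).const_mul m)
    have := eqOn_const_of_hasDerivAt (convex_Ici (1 / 8)) h1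
      (fun y hy => by rw [hpos' y hy]; ring) hx (Set.mem_Ici.mpr le_rfl)
    have h2 : g (1 / 8) - m * (1 / 8 - k) = 0 := by rw [hk]; field_simp; ring
    linarith
  have hk1 : k ≤ 1 / 8 := by
    have := monotoneOn_of_hasDerivAt convex_univ hd (fun x _ => by
      rcases le_total x (-1 / 8) with h | h
      · rw [hneg' x h]
      · rw [← hg'0]; exact hmono h) (Set.mem_univ (-1 / 8)) (Set.mem_univ (1 / 8)) (by norm_num)
    rw [hg0] at this
    have : 0 ≤ g (1 / 8) / m := by positivity
    linarith
  have hk2 : -1 / 8 ≤ k := by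
    have h1 : ∀ x, HasDerivAt (fun x => m * x - g x) (m * 1 - g' x) x := fun x =>
      ((hasDerivAt_id x).const_mul m).sub (hd x)
    have := monotoneOn_of_hasDerivAt (convex_Iic (1 / 8)) h1
      (fun x hx => by linarith [hmono (Set.mem_Iic.mp hx)])
      (show (-1 / 8 : ℝ) ∈ Set.Iic (1 / 8) by norm_num) (Set.mem_Iic.mpr le_rfl) (by norm_num)
    simp only [hg0] at this
    have h3 : g (1 / 8) / m ≤ 1 / 4 := by rw [div_le_iff₀ hm0]; linarith
    linarith
  refine ⟨fun x => m⁻¹ * g (x + k), fun x => m⁻¹ * g' (x + k), fun x => m⁻¹ * b (x + k),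
    contDiff_const.mul (hg.comp (contDiff_id.add contDiff_const)),
    fun x => ((hd (x + k)).comp_add_const x k).const_mul _,
    fun x => ((hd' (x + k)).comp_add_const x k).const_mul _,
    fun x => mul_nonneg (inv_nonneg.mpr hm0.le) b.nonneg, fun x hx => ?_, fun x hx => ?_⟩
  · simp only [hneg (x + k) (by linarith), mul_zero]
  · simp only [hpos (x + k) (by linarith)]
    field_simp
    ring

/-- A smooth convex function `F` can be replaced near the origin by its tangent line, without
losing the convexity and without change far from the origin. -/
lemma exists_convex_interpolation {F F' f : ℝ → ℝ} (hf : ContDiff ℝ ∞ f)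
    (hd : ∀ x, HasDerivAt F (F' x) x) (hd' : ∀ x, HasDerivAt F' (f x) x)
    (hmono : MonotoneOn f (Set.Ici 0)) (hpos : ∀ x, 0 < x → 0 < f x) (hf0 : 0 ≤ f 0) :
    ∃ G G' G'' : ℝ → ℝ, ContDiff ℝ ∞ G ∧ (∀ x, HasDerivAt G (G' x) x) ∧
      (∀ x, HasDerivAt G' (G'' x) x) ∧ (∀ x, 0 ≤ x → 0 ≤ G'' x) ∧
      (∀ x ≤ 1 / 37, G x = F 0 + F' 0 * x) ∧ ∀ x, 37 ≤ x → G x = F x := by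
  have hfnn : ∀ x, 0 ≤ x → 0 ≤ f x := fun x hx => hf0.trans (hmono Set.self_mem_Ici hx hx)
  let χ : ℝ → ℝ := fun x => Real.smoothTransition (x - 2)
  have hχ0 : ∀ x ≤ 2, χ x = 0 := fun x hx => Real.smoothTransition.zero_of_nonpos (by linarith)
  have hχ1 : ∀ x, 3 ≤ x → χ x = 1 := fun x hx => Real.smoothTransition.one_of_one_le (by linarith)
  have hχn : ∀ x, 0 ≤ χ x := fun x => Real.smoothTransition.nonneg _
  have hχl : ∀ x, χ x ≤ 1 := fun x => Real.smoothTransition.le_one _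
  have hχ : ContDiff ℝ ∞ χ := Real.smoothTransition.contDiff.comp (contDiff_id.sub contDiff_const)
  -- Cutting off the second derivative and integrating back from 3 keeps F on [3, ∞) and gives a
  -- line on (-∞, 2], in general not the tangent line of F at 0. The rest of the proof corrects this
  -- line.
  obtain ⟨g, g', hg, hg3, hg'3, hgd, hgd'⟩ :=
    exists_contDiff_second_primitive (h := fun x => χ x * f x) (hχ.mul hf) 3 (F 3) (F' 3)
  obtain ⟨ψ, ψ', ψ'', hψ, hψd, hψd', hψn, hψ0, hψ1⟩ := exists_smooth_relu
  have hge' : ∀ x, 3 ≤ x → g' x = F' x := fun x hx => by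
    have := eqOn_const_of_hasDerivAt (convex_Ici 3) (fun x => (hgd' x).sub (hd' x))
      (fun y hy => by simp [hχ1 y hy]) hx (Set.mem_Ici.mpr le_rfl)
    simp only [Pi.sub_apply, hg'3, sub_self] at this
    linarith
  have hge : ∀ x, 3 ≤ x → g x = F x := fun x hx => by
    have := eqOn_const_of_hasDerivAt (convex_Ici 3) (fun x => (hgd x).sub (hd x))
      (fun y hy => by simp [hge' y hy]) hx (Set.mem_Ici.mpr le_rfl)
    simp only [Pi.sub_apply, hg3, sub_self] at this
    linarith
  have hle' : ∀ x ≤ 2, g' x = g' 0 := fun x hx =>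
    eqOn_const_of_hasDerivAt (convex_Iic 2) hgd' (fun y hy => by simp [hχ0 y hy]) hx
      (by norm_num)
  have hle : ∀ x ≤ 2, g x = g 0 + g' 0 * x := fun x hx => by
    have := eqOn_const_of_hasDerivAt (convex_Iic 2)
      (fun x => (hgd x).sub ((hasDerivAt_id x).const_mul (g' 0)))
      (fun y hy => by simp [hle' y hy]) hx (show (0 : ℝ) ∈ Set.Iic 2 by norm_num)
    simp only [Pi.sub_apply, id_eq] at this
    linarith
  -- the difference `F - g` is convex on `[0, 3]` and vanishes to first order at `3`
  let D : ℝ → ℝ := fun x => F x - g x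
  let D' : ℝ → ℝ := fun x => F' x - g' x
  let D'' : ℝ → ℝ := fun x => f x - χ x * f x
  have hD : ∀ x, HasDerivAt D (D' x) x := fun x => (hd x).sub (hgd x)
  have hD' : ∀ x, HasDerivAt D' (D'' x) x := fun x => (hd' x).sub (hgd' x)
  have hD3 : D 3 = 0 := by simp [D, hg3]
  have hD'3 : D' 3 = 0 := by simp [D', hg'3]
  have hD''n : ∀ x, 0 ≤ x → 0 ≤ D'' x := fun x hx => by
    have : D'' x = (1 - χ x) * f x := by simp only [D'']; ring
    rw [this]
    exact mul_nonneg (by linarith [hχl x]) (hfnn x hx)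
  have hD''f : ∀ x ≤ 2, D'' x = f x := fun x hx => by simp [D'', hχ0 x hx]
  -- D t + D' t (c - t) is the height at c of the tangent line to D at t. Its derivative in t has
  -- the sign of c - t where D is convex.
  have hT : ∀ c x, HasDerivAt (fun t => D t + D' t * (c - t)) (D'' x * (c - x)) x := fun c x => by
    refine ((hD x).add ((hD' x).mul ((hasDerivAt_id x).const_sub c))).congr_deriv ?_
    simp only [id_eq]
    ring
  have hD'0 : D' 0 < 0 := by
    have h1 : D' 0 < D' 1 := by
      refine strictMonoOn_of_deriv_pos (convex_Icc 0 1)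
        (fun x _ => (hD' x).continuousAt.continuousWithinAt) (fun x hx => ?_)
        (Set.left_mem_Icc.mpr zero_le_one) (Set.right_mem_Icc.mpr zero_le_one) zero_lt_one
      rw [interior_Icc] at hx
      rw [(hD' x).deriv, hD''f x (by linarith [hx.2])]
      exact hpos x hx.1
    have h2 := monotoneOn_of_hasDerivAt (convex_Ici 0) hD' hD''n
      (show (1 : ℝ) ∈ Set.Ici 0 by norm_num) (show (3 : ℝ) ∈ Set.Ici 0 by norm_num) (by norm_num)
    linarith
  -- Tangent heights at c = 3/10. As f is increasing, on [0, 6/10] comparison with a parabola of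
  -- second derivative f(3/10), symmetric about c, shows that the height for t = 0 is at least that
  -- for t = 6/10. From there to t = 3 the height decreases to 0.
  have hlow : 0 ≤ D 0 + D' 0 * (3 / 10) := by
    have h1 : ∀ x, HasDerivAt (fun t => -(D t + D' t * (3 / 10 - t)) - f (3 / 10) / 2 *
        (3 / 10 - t) ^ 2) ((f (3 / 10) - D'' x) * (3 / 10 - x)) x := fun x => by
      refine ((hT (3 / 10) x).neg.sub ((((hasDerivAt_id x).const_sub (3 / 10)).pow 2).const_mul
        (f (3 / 10) / 2))).congr_deriv ?_
      simp only [id_eq]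
      ring
    have h2 := monotoneOn_of_hasDerivAt (convex_Icc 0 (6 / 10)) h1 (fun x hx => by
      rw [hD''f x (by linarith [hx.2])]
      rcases le_total x (3 / 10) with h | h
      · exact mul_nonneg (sub_nonneg.mpr (hmono hx.1 (show (0 : ℝ) ≤ 3 / 10 by norm_num) h))
          (sub_nonneg.mpr h)
      · exact mul_nonneg_of_nonpos_of_nonpos
          (sub_nonpos.mpr (hmono (show (0 : ℝ) ≤ 3 / 10 by norm_num) hx.1 h))
          (sub_nonpos.mpr h)) (Set.left_mem_Icc.mpr (by norm_num))
      (Set.right_mem_Icc.mpr (by norm_num)) (by norm_num)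
    have h3 := monotoneOn_of_hasDerivAt (convex_Ici (6 / 10)) (fun x => (hT (3 / 10) x).neg)
      (fun x hx => by
        have hx : (6 / 10 : ℝ) ≤ x := hx
        have := mul_nonneg (hD''n x (by linarith)) (show 0 ≤ x - 3 / 10 by linarith)
        linarith) (Set.mem_Ici.mpr le_rfl) (show (3 : ℝ) ∈ Set.Ici (6 / 10) by norm_num)
      (by norm_num)
    simp only [Pi.neg_apply, hD3, hD'3] at h2 h3
    linarith
  -- At any c ≥ 3 the tangent heights increase for t in [0, 3] and end at 0; c = 36 leaves ample
  -- room below 37.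
  have hhigh : D 0 + D' 0 * 36 ≤ 0 := by
    have := monotoneOn_of_hasDerivAt (convex_Icc 0 3) (hT 36)
      (fun x hx => mul_nonneg (hD''n x hx.1) (by linarith [hx.2]))
      (Set.left_mem_Icc.mpr (by norm_num)) (Set.right_mem_Icc.mpr (by norm_num)) (by norm_num)
    simp only [hD3, hD'3] at this
    linarith
  -- `m` is where the tangent line of F at 0 meets the extension of the line of g. The bounds 3/10 ≤
  -- m ≤ 36 keep the smoothed corner [m - 1/4, m + 1/4] inside (1/37, 37).
  obtain ⟨m, hm⟩ : ∃ m, D 0 + D' 0 * m = 0 := ⟨-D 0 / D' 0, by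
    rw [mul_div_cancel₀ _ hD'0.ne]; ring⟩
  have hm1 : 3 / 10 ≤ m := by nlinarith
  have hm2 : m ≤ 36 := by nlinarith
  -- Left of the corner the correction is D'(0)(x - m), which turns the line of g into the tangent
  -- line of F; right of it the correction is 0. It is convex because D'(0) < 0, so it may be added
  -- even where g is not affine.
  refine ⟨fun x => g x - D' 0 * (ψ (x - m) - (x - m)), fun x => g' x - D' 0 * (ψ' (x - m) - 1),
    fun x => χ x * f x - D' 0 * (ψ'' (x - m)), ?_, fun x => ?_, fun x => ?_, fun x hx => ?_,
    fun x hx => ?_, fun x hx => ?_⟩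
  · exact hg.sub (contDiff_const.mul ((hψ.comp (contDiff_id.sub contDiff_const)).sub
      (contDiff_id.sub contDiff_const)))
  · exact (hgd x).sub ((((hψd (x - m)).comp_sub_const x m).sub
      ((hasDerivAt_id x).sub_const m)).const_mul (D' 0))
  · exact (hgd' x).sub ((((hψd' (x - m)).comp_sub_const x m).sub_const 1).const_mul (D' 0))
  · have := mul_nonneg (hχn x) (hfnn x hx)
    have := mul_nonneg (neg_nonneg.mpr hD'0.le) (hψn (x - m))
    linarith
  · simp only [hle x (by linarith), hψ0 (x - m) (by linarith)]
    have e1 : D 0 = F 0 - g 0 := rfl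
    have e2 : D' 0 = F' 0 - g' 0 := rfl
    linear_combination x * e2 + e1 - hm
  · simp only [hge x (by linarith), hψ1 (x - m) (by linarith)]
    ring

/-- The tangent lines of sinh and cosh at 0 are r and 1. The bounds on σ', τ', σ and τ follow by
integrating the convexity inequalities from 0. -/
lemma exists_isInterpolatingPair {R : ℝ} (hR : 37 < R) :
    ∃ σ τ : ℝ → ℝ, IsInterpolatingPair R σ τ := by
  have hR' : 1 / R ≤ 1 / 37 := one_div_le_one_div_of_le (by norm_num) hR.le
  obtain ⟨σ, σ', σ'', hσ, hσd, hσd', hσn, hσ0, hσ1⟩ := exists_convex_interpolation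
    Real.contDiff_sinh Real.hasDerivAt_sinh Real.hasDerivAt_cosh
    (Real.sinh_strictMono.monotone.monotoneOn _) (fun x hx => Real.sinh_pos_iff.mpr hx) (by simp)
  obtain ⟨τ, τ', τ'', hτ, hτd, hτd', hτn, hτ0, hτ1⟩ := exists_convex_interpolation
    Real.contDiff_cosh Real.hasDerivAt_cosh Real.hasDerivAt_sinh
    Real.cosh_strictMonoOn.monotoneOn (fun x _ => Real.cosh_pos x) (Real.cosh_pos 0).le
  simp only [Real.sinh_zero, Real.cosh_zero, zero_add, one_mul, zero_mul, add_zero] at hσ0 hτ0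
  have eσ : deriv σ = σ' := funext fun x => (hσd x).deriv
  have eτ : deriv τ = τ' := funext fun x => (hτd x).deriv
  have eσ' : deriv σ' = σ'' := funext fun x => (hσd' x).deriv
  have eτ' : deriv τ' = τ'' := funext fun x => (hτd' x).deriv
  have hnhds : Set.Iic (1 / 37 : ℝ) ∈ 𝓝 0 := Iic_mem_nhds (by norm_num)
  have hσ'0 : σ' 0 = 1 := (hσd 0).unique <| (hasDerivAt_id 0).congr_of_eventuallyEq <| by
    filter_upwards [hnhds] with x hx using hσ0 x hx
  have hτ'0 : τ' 0 = 0 := (hτd 0).unique <| (hasDerivAt_const 0 1).congr_of_eventuallyEq <| by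
    filter_upwards [hnhds] with x hx using hτ0 x hx
  have h1 : ∀ r, 0 ≤ r → 1 ≤ σ' r := fun r hr => hσ'0.symm.le.trans
    (monotoneOn_of_hasDerivAt (convex_Ici 0) hσd' hσn Set.self_mem_Ici hr hr)
  have h2 : ∀ r, 0 ≤ r → 0 ≤ τ' r := fun r hr => hτ'0.symm.le.trans
    (monotoneOn_of_hasDerivAt (convex_Ici 0) hτd' hτn Set.self_mem_Ici hr hr)
  refine ⟨σ, τ, hσ, hτ, fun r hr => ?_, fun r hr => ?_, by rwa [eσ], by rwa [eτ],
    by rwa [eσ, eσ'], by rwa [eτ, eτ'], fun r hr => hσ0 r (hr.trans hR'),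
    fun r hr => hσ1 r (hR.le.trans hr), fun r hr => hτ0 r (hr.trans hR'),
    fun r hr => hτ1 r (hR.le.trans hr)⟩
  · have := monotoneOn_of_hasDerivAt (convex_Ici 0) hσd (fun x hx => by linarith [h1 x hx])
      Set.self_mem_Ici hr hr
    rwa [hσ0 0 (by norm_num)] at this
  · have := monotoneOn_of_hasDerivAt (convex_Ici 0) hτd h2 Set.self_mem_Ici hr hr
    rw [hτ0 0 (by norm_num)] at this
    linarith

end HypTube

namespace HypTube

/-! ### The coefficients of a doubly warped product in the coordinates `(x, z)` -/

lemma contDiffAt_deriv {f : ℝ → ℝ} {x : ℝ} (h : ContDiffAt ℝ ∞ f x) :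
    ContDiffAt ℝ ∞ (deriv f) x := by
  have h1 : ContDiffAt ℝ ∞ (fun y => fderiv ℝ f y 1) x :=
    (h.fderiv_right (m := ∞) (by simp)).clm_apply contDiffAt_const
  exact h1

/-- There is a smooth function `S` such that `sinh r = r S(r²)`. -/
lemma exists_sinh_quotient :
    ∃ S : ℝ → ℝ, ContDiff ℝ ∞ S ∧ S 0 = 1 ∧ ∀ r, Real.sinh r = r * S (r ^ 2) := by
  -- S(t) = ∑ tᵏ / (2k + 1)!, an entire series.
  let c : ℕ → ℝ := fun k => ((2 * k + 1).factorial : ℝ)⁻¹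
  have hrad : (FormalMultilinearSeries.ofScalars ℝ c).radius = ⊤ := by
    apply FormalMultilinearSeries.ofScalars_radius_eq_top_of_tendsto
    · exact Filter.Eventually.of_forall fun k => by positivity
    · refine squeeze_zero (fun k => by positivity) (fun k => ?_)
        tendsto_one_div_add_atTop_nhds_zero_nat
      have e : (2 * k.succ + 1).factorial = (2 * k + 3) * ((2 * k + 2) * (2 * k + 1).factorial) :=
        rfl
      have h : (0 : ℝ) < (2 * k + 1).factorial := by positivity
      have hk : (0 : ℝ) ≤ k := by positivity
      simp only [c, e, norm_inv, Real.norm_eq_abs, Nat.abs_cast]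
      push_cast
      rw [div_le_div_iff₀ (by positivity) (by positivity), mul_inv]
      field_simp
      nlinarith
  refine ⟨FormalMultilinearSeries.ofScalarsSum c, ?_, ?_, fun r => ?_⟩
  · have h := (FormalMultilinearSeries.ofScalars ℝ c).hasFPowerSeriesOnBall (by simp [hrad])
    rw [hrad] at h
    exact contDiff_iff_contDiffAt.mpr fun x => (h.analyticAt_of_mem (by simp)).contDiffAt
  · simp [c]
  · rw [FormalMultilinearSeries.ofScalarsSum_eq_tsum, Real.sinh_eq_tsum]
    simp only [← tsum_mul_left, c, smul_eq_mul]
    refine tsum_congr fun k => ?_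
    rw [← pow_mul, pow_succ]
    ring

/-- There is a smooth function `φ` on a neighborhood of the nonnegative half line such that
`arsinh s = s φ(s²)`. -/
lemma exists_arsinh_quotient : ∃ φ : ℝ → ℝ, (∀ q, 0 ≤ q → ContDiffAt ℝ ∞ φ q) ∧ φ 0 = 1 ∧
    ∀ q, 0 < q → φ q = Real.arsinh √q / √q := by
  obtain ⟨S, hS, hS0, hsinh⟩ := exists_sinh_quotient
  -- Since √q is not smooth at 0, the variable is p = r². Then Q(r²) = sinh² r and Q'(0) = 1, so Q
  -- has a smooth local inverse P with P(q) = arsinh(√q)². Hence arsinh(√q)/√q = r / sinh r = 1 /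
  -- S(P q), and the right side also extends φ smoothly to q < 0.
  let Q : ℝ → ℝ := fun p => p * S p ^ 2
  have hQ : ContDiff ℝ ∞ Q := contDiff_id.mul (hS.pow 2)
  have hQ0 : Q 0 = 0 := by simp [Q]
  have hQ' : HasFDerivAt Q (ContinuousLinearEquiv.refl ℝ ℝ : ℝ →L[ℝ] ℝ) 0 := by
    have h1 := (hasDerivAt_id (0 : ℝ)).mul
      ((hS.differentiable (by simp)).differentiableAt.hasDerivAt (x := 0) |>.pow 2)
    have h2 : HasDerivAt Q 1 0 := h1.congr_deriv (by simp [hS0])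
    refine h2.hasFDerivAt.congr_fderiv ?_
    ext
    simp
  let P := (hQ.contDiffAt (x := 0)).localInverse hQ' (by simp)
  have hP : ContDiffAt ℝ ∞ P 0 := by
    have := (hQ.contDiffAt (x := 0)).to_localInverse hQ' (by simp)
    rwa [hQ0] at this
  have hPQ : ∀ᶠ p in 𝓝 0, P (Q p) = p :=
    ((hQ.contDiffAt (x := 0)).hasStrictFDerivAt' hQ' (by simp)).eventually_left_inverse
  have hP0 : P 0 = 0 := by simpa [hQ0] using hPQ.self_of_nhds
  have ht : Filter.Tendsto (fun q => Real.arsinh √q ^ 2) (𝓝 0) (𝓝 0) := by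
    have : Continuous fun q => Real.arsinh √q ^ 2 :=
      (Real.continuous_arsinh.comp Real.continuous_sqrt).pow 2
    simpa using this.tendsto 0
  refine ⟨fun q => if q ≤ 0 then (S (P q))⁻¹ else Real.arsinh √q / √q, fun q hq => ?_, ?_,
    fun q hq => ?_⟩
  · rcases hq.eq_or_lt with rfl | hq
    · have h1 : ContDiffAt ℝ ∞ (fun q => (S (P q))⁻¹) 0 :=
        (hS.contDiffAt.comp 0 hP).inv (by simp [hP0, hS0])
      refine h1.congr_of_eventuallyEq ?_
      filter_upwards [ht.eventually hPQ] with q hq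
      split_ifs with h
      · rfl
      · have hq0 : 0 < √q := Real.sqrt_pos.mpr (not_le.mp h)
        have e := hsinh (Real.arsinh √q)
        rw [Real.sinh_arsinh] at e
        have e2 : Q (Real.arsinh √q ^ 2) = q := by
          simp only [Q]
          rw [← mul_pow, ← e, Real.sq_sqrt (not_le.mp h).le]
        rw [e2] at hq
        rw [hq]
        have hr : 0 < Real.arsinh √q := Real.arsinh_pos_iff.mpr hq0
        have hS1 : S (Real.arsinh √q ^ 2) ≠ 0 := fun h0 => by rw [h0] at e; simp at e; linarith
        nth_rw 2 [e]
        field_simp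
    · have h1 : ContDiffAt ℝ ∞ (fun q => Real.arsinh √q / √q) q :=
        (contDiffAt_id.sqrt hq.ne').arsinh.div (contDiffAt_id.sqrt hq.ne')
          (Real.sqrt_pos.mpr hq).ne'
      refine h1.congr_of_eventuallyEq ?_
      filter_upwards [Ioi_mem_nhds hq] with q hq
      simp [not_le.mpr (Set.mem_Ioi.mp hq)]
  · simp [hP0, hS0]
  · simp [not_le.mpr hq]

/-- The functions `A`, `B`, `C` are the coefficients of the doubly warped product with warping
functions `σ` and `τ` in the coordinates `(x, z)`, as functions of `|x|²`: the metric is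
`A |dx|² + B ⟨x, dx⟩² + C dz²`. -/
structure IsWarpCoeff (σ τ A B C : ℝ → ℝ) : Prop where
  smooth_A : ∀ q, 0 ≤ q → ContDiffAt ℝ ∞ A q
  smooth_B : ∀ q, 0 ≤ q → ContDiffAt ℝ ∞ B q
  smooth_C : ∀ q, 0 ≤ q → ContDiffAt ℝ ∞ C q
  A_zero : A 0 = 1
  radial : ∀ q, 0 ≤ q → A q + q * B q = (1 + q)⁻¹
  A_eq : ∀ q, 0 < q → A q = σ (Real.arsinh √q) ^ 2 / q
  C_eq : ∀ q, 0 ≤ q → C q = τ (Real.arsinh √q) ^ 2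

lemma exists_isWarpCoeff {R : ℝ} (hR : 0 < R) {σ τ : ℝ → ℝ} (h : IsInterpolatingPair R σ τ) :
    ∃ A B C : ℝ → ℝ, IsWarpCoeff σ τ A B C := by
  obtain ⟨φ, hφ, hφ0, hφq⟩ := exists_arsinh_quotient
  have hsmall : ∀ᶠ q in 𝓝 (0 : ℝ), Real.arsinh √q < 1 / R := by
    have : Continuous fun q => Real.arsinh √q :=
      Real.continuous_arsinh.comp Real.continuous_sqrt
    exact this.continuousAt.eventually_lt continuousAt_const (by simpa using hR)
  -- μ = σ(r)/r with r = arsinh √q. It is identically 1 near q = 0, since σ(r) = r for r ≤ 1/R.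
  let μ : ℝ → ℝ := fun q => if q ≤ 0 then 1 else σ (Real.arsinh √q) / Real.arsinh √q
  have hμ0 : ∀ᶠ q in 𝓝 (0 : ℝ), μ q = 1 := by
    filter_upwards [hsmall] with q hq
    simp only [μ]
    split_ifs with h0
    · rfl
    · rw [h.sigma_of_le _ hq.le]
      exact div_self (Real.arsinh_pos_iff.mpr (Real.sqrt_pos.mpr (not_le.mp h0))).ne'
  have har : ∀ q, 0 < q → ContDiffAt ℝ ∞ (fun q => Real.arsinh √q) q := fun q hq =>
    (contDiffAt_id.sqrt hq.ne').arsinh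
  have hμ : ∀ q, 0 ≤ q → ContDiffAt ℝ ∞ μ q := fun q hq => by
    rcases hq.eq_or_lt with rfl | hq
    · exact contDiffAt_const.congr_of_eventuallyEq hμ0
    · refine (((h.smooth_sigma.contDiffAt.comp q (har q hq)).div (har q hq)
        (Real.arsinh_pos_iff.mpr (Real.sqrt_pos.mpr hq)).ne').congr_of_eventuallyEq ?_)
      filter_upwards [Ioi_mem_nhds hq] with q hq
      simp only [μ, not_le.mpr (Set.mem_Ioi.mp hq), if_false]
      rfl
  have hφ' : ∀ q, 0 ≤ q → ContDiffAt ℝ ∞ (deriv φ) q := fun q hq => contDiffAt_deriv (hφ q hq)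
  -- A = (r/√q)² (σ/r)². Differentiating arsinh s = s φ(s²) gives φ + 2qφ' = 1/√(1 + q), so B must
  -- be ((φ + 2qφ')² - φ²μ²)/q. Expanded, the only term still divided by q is (1 - μ²)φ², which
  -- vanishes near 0.
  refine ⟨fun q => φ q ^ 2 * μ q ^ 2, fun q => 4 * φ q * deriv φ q + 4 * q * deriv φ q ^ 2 +
    (1 - μ q ^ 2) * φ q ^ 2 / q, fun q => τ (Real.arsinh √q) ^ 2, ?_⟩
  constructor
  · exact fun q hq => ((hφ q hq).pow 2).mul ((hμ q hq).pow 2)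
  · intro q hq
    refine ContDiffAt.add (ContDiffAt.add ?_ ?_) ?_
    · exact (contDiffAt_const.mul (hφ q hq)).mul (hφ' q hq)
    · exact (contDiffAt_const.mul contDiffAt_id).mul ((hφ' q hq).pow 2)
    · rcases hq.eq_or_lt with rfl | hq'
      · refine (contDiffAt_const (c := (0 : ℝ))).congr_of_eventuallyEq ?_
        filter_upwards [hμ0] with q hq
        simp [hq]
      · exact ((contDiffAt_const.sub ((hμ q hq).pow 2)).mul ((hφ q hq).pow 2)).div contDiffAt_id
          hq'.ne'
  · intro q hq
    rcases hq.eq_or_lt with rfl | hq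
    · refine (contDiffAt_const (c := (1 : ℝ))).congr_of_eventuallyEq ?_
      filter_upwards [hsmall] with q hq
      simp [h.tau_of_le _ hq.le]
    · exact (h.smooth_tau.contDiffAt.comp q (har q hq)).pow 2
  · simp [hφ0, μ]
  · intro q hq
    rcases hq.eq_or_lt with rfl | hq
    · simp [hφ0, μ]
    have hs : 0 < √q := Real.sqrt_pos.mpr hq
    have h1 : √q ^ 2 = q := Real.sq_sqrt hq.le
    have hd : HasDerivAt φ (deriv φ q) q :=
      ((hφ q hq.le).differentiableAt (by simp)).hasDerivAt
    -- Two derivatives of √q φ(q) = arsinh √q; comparing them gives φ + 2qφ' = 1/√(1 + q), whose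
    -- square is the radial identity.
    have e1 := (Real.hasDerivAt_sqrt hq.ne').mul hd
    have e2 : HasDerivAt (fun q => Real.arsinh √q) ((√(1 + √q ^ 2))⁻¹ * (1 / (2 * √q))) q :=
      (Real.hasDerivAt_arsinh √q).comp q (Real.hasDerivAt_sqrt hq.ne')
    have e3 := e1.unique (e2.congr_of_eventuallyEq (by
      filter_upwards [Ioi_mem_nhds hq] with y hy
      have : 0 < √y := Real.sqrt_pos.mpr hy
      simp only [Pi.mul_apply, hφq y hy]
      field_simp))
    rw [h1] at e3
    have h2 : 0 < √(1 + q) := Real.sqrt_pos.mpr (by linarith)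
    have h3 : √(1 + q) ^ 2 = 1 + q := Real.sq_sqrt (by linarith)
    have e4 : φ q + 2 * q * deriv φ q = (√(1 + q))⁻¹ := by
      have : 2 * √q * (1 / (2 * √q) * φ q + √q * deriv φ q) =
        2 * √q * ((√(1 + q))⁻¹ * (1 / (2 * √q))) := by rw [e3]
      field_simp at this
      rw [h1] at this
      field_simp
      linarith
    rw [← h3, ← inv_pow, ← e4]
    field_simp
    ring
  · intro q hq
    have hs : 0 < √q := Real.sqrt_pos.mpr hq
    have hr : 0 < Real.arsinh √q := Real.arsinh_pos_iff.mpr hs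
    simp only [hφq q hq, μ, not_le.mpr hq, if_false]
    rw [div_pow, div_pow, Real.sq_sqrt hq.le]
    field_simp
  · exact fun q _ => rfl

end HypTube

namespace HypTube

/-! ### Connection and curvature coefficients

The Christoffel symbols of the metric `A |dx|² + B ⟨x, dx⟩² + C dz²`, with `A`, `B`, `C` functions
of `q = |x|²`, are combinations of the following functions of `q`, and the curvature tensor
is a combination of the functions `curvCoeff₁`, …, `curvCoeff₇`. -/

variable (A B C a b c d e : ℝ → ℝ)

/-- The coefficient of `⟨x, v⟩ w + ⟨x, w⟩ v` in the Christoffel symbol. -/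
def connA (q : ℝ) : ℝ := deriv A q / A q

/-- The coefficient of `⟨v, w⟩ x` in the Christoffel symbol. -/
def connB (q : ℝ) : ℝ := (B q - deriv A q) / (A q + q * B q)

/-- The coefficient of `⟨x, v⟩ ⟨x, w⟩ x` in the Christoffel symbol. -/
def connC (q : ℝ) : ℝ := (deriv B q - 2 * B q * deriv A q / A q) / (A q + q * B q)

/-- The coefficient of `dz(v) dz(w) x` in the Christoffel symbol. -/
def connD (q : ℝ) : ℝ := -deriv C q / (A q + q * B q)

/-- The coefficient of `⟨x, v⟩ dz(w) + ⟨x, w⟩ dz(v)` in the Christoffel symbol. -/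
def connE (q : ℝ) : ℝ := deriv C q / C q

/-- The coefficient of `⟨v, w⟩ u - ⟨u, w⟩ v` in the curvature. -/
def curvCoeff₁ (q : ℝ) : ℝ := b q - a q + a q * b q * q

/-- The coefficient of `⟨x, w⟩ (⟨x, v⟩ u - ⟨x, u⟩ v)` in the curvature. -/
def curvCoeff₂ (q : ℝ) : ℝ := -2 * deriv a q + c q + a q ^ 2 + a q * q * c q

/-- The coefficient of `(⟨x, u⟩ ⟨v, w⟩ - ⟨x, v⟩ ⟨u, w⟩) x` in the curvature. -/
def curvCoeff₃ (q : ℝ) : ℝ := 2 * deriv b q - c q + b q ^ 2 + q * b q * c q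

/-- The coefficient of `dz(w) (dz(v) u - dz(u) v)` in the curvature. -/
def curvCoeff₄ (q : ℝ) : ℝ := d q * (1 + a q * q)

/-- The coefficient of `dz(w) (⟨x, u⟩ dz(v) - ⟨x, v⟩ dz(u)) x` in the curvature. -/
def curvCoeff₅ (q : ℝ) : ℝ := 2 * deriv d q + (a q + b q + c q * q) * d q - d q * e q

/-- The coefficient of `⟨x, w⟩ (⟨x, u⟩ dz(v) - ⟨x, v⟩ dz(u)) ∂z` in the curvature. -/
def curvCoeff₆ (q : ℝ) : ℝ := 2 * deriv e q + e q ^ 2 - e q * (2 * a q + q * c q)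

/-- The coefficient of `(⟨u, w⟩ dz(v) - ⟨v, w⟩ dz(u)) ∂z` in the curvature. -/
def curvCoeff₇ (q : ℝ) : ℝ := e q * (1 - q * b q)

variable {A B C}

/-- The functions `A`, `B`, `C` are smooth at `q`, and `A |dx|² + B ⟨x, dx⟩² + C dz²` is positive
definite at the points `x` with `|x|² = q`. -/
structure IsRegularAt (A B C : ℝ → ℝ) (q : ℝ) : Prop where
  smooth_A : ContDiffAt ℝ ∞ A q
  smooth_B : ContDiffAt ℝ ∞ B q
  smooth_C : ContDiffAt ℝ ∞ C q
  A_pos : 0 < A q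
  radial_pos : 0 < A q + q * B q
  C_pos : 0 < C q

namespace IsRegularAt

variable {q : ℝ}

lemma connA (h : IsRegularAt A B C q) : ContDiffAt ℝ ∞ (connA A) q :=
  (contDiffAt_deriv h.smooth_A).div h.smooth_A h.A_pos.ne'

lemma connB (h : IsRegularAt A B C q) : ContDiffAt ℝ ∞ (connB A B) q :=
  (h.smooth_B.sub (contDiffAt_deriv h.smooth_A)).div
    (h.smooth_A.add (contDiffAt_id.mul h.smooth_B)) h.radial_pos.ne'

lemma connC (h : IsRegularAt A B C q) : ContDiffAt ℝ ∞ (connC A B) q :=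
  ((contDiffAt_deriv h.smooth_B).sub (((contDiffAt_const.mul h.smooth_B).mul
    (contDiffAt_deriv h.smooth_A)).div h.smooth_A h.A_pos.ne')).div
    (h.smooth_A.add (contDiffAt_id.mul h.smooth_B)) h.radial_pos.ne'

lemma connD (h : IsRegularAt A B C q) : ContDiffAt ℝ ∞ (connD A B C) q :=
  (contDiffAt_deriv h.smooth_C).neg.div
    (h.smooth_A.add (contDiffAt_id.mul h.smooth_B)) h.radial_pos.ne'

lemma connE (h : IsRegularAt A B C q) : ContDiffAt ℝ ∞ (connE C) q :=
  (contDiffAt_deriv h.smooth_C).div h.smooth_C h.C_pos.ne'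

lemma hasDerivAt_A (h : IsRegularAt A B C q) : HasDerivAt A (deriv A q) q :=
  (h.smooth_A.differentiableAt (by simp)).hasDerivAt

lemma hasDerivAt_B (h : IsRegularAt A B C q) : HasDerivAt B (deriv B q) q :=
  (h.smooth_B.differentiableAt (by simp)).hasDerivAt

lemma hasDerivAt_C (h : IsRegularAt A B C q) : HasDerivAt C (deriv C q) q :=
  (h.smooth_C.differentiableAt (by simp)).hasDerivAt

lemma hasDerivAt_deriv_A (h : IsRegularAt A B C q) :
    HasDerivAt (deriv A) (deriv (deriv A) q) q :=
  ((contDiffAt_deriv h.smooth_A).differentiableAt (by simp)).hasDerivAt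

lemma hasDerivAt_deriv_C (h : IsRegularAt A B C q) :
    HasDerivAt (deriv C) (deriv (deriv C) q) q :=
  ((contDiffAt_deriv h.smooth_C).differentiableAt (by simp)).hasDerivAt

lemma hasDerivAt_radial (h : IsRegularAt A B C q) :
    HasDerivAt (fun q => A q + q * B q) (deriv A q + (1 * B q + q * deriv B q)) q :=
  h.hasDerivAt_A.add ((hasDerivAt_id q).mul h.hasDerivAt_B)

/-- The three identities `curvCoeff_symm₁`, `curvCoeff_symm₂`, `curvCoeff_symm₃` are the
antisymmetry of ⟨R(u,v)w, t⟩ in w and t, read off coefficient by coefficient. They determine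
`curvCoeff₃`, `curvCoeff₇` and `curvCoeff₅` from the other four. -/
lemma curvCoeff_symm₁ (h : IsRegularAt A B C q) :
    A q * curvCoeff₂ (HypTube.connA A) (HypTube.connC A B) q =
      (A q + q * B q) * curvCoeff₃ (HypTube.connB A B) (HypTube.connC A B) q +
        B q * curvCoeff₁ (HypTube.connA A) (HypTube.connB A B) q := by
  have hA := h.A_pos.ne'
  have hN := h.radial_pos.ne'
  have e1 : deriv (HypTube.connA A) q = _ :=
    (h.hasDerivAt_deriv_A.div h.hasDerivAt_A hA).deriv
  have e2 : deriv (HypTube.connB A B) q = _ :=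
    ((h.hasDerivAt_B.sub h.hasDerivAt_deriv_A).div h.hasDerivAt_radial hN).deriv
  simp only [curvCoeff₁, curvCoeff₂, curvCoeff₃, e1, e2, HypTube.connA, HypTube.connB,
    HypTube.connC, Pi.sub_apply]
  -- N names the radial coefficient A + qB, so that it is cleared as a single denominator; A is then
  -- eliminated in favour of N.
  obtain ⟨N, hN'⟩ : ∃ N, A q + q * B q = N := ⟨_, rfl⟩
  rw [hN'] at hN ⊢
  field_simp
  rw [show A q = N - q * B q by linarith]
  ring

lemma curvCoeff_symm₂ (h : IsRegularAt A B C q) :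
    A q * curvCoeff₄ (HypTube.connA A) (HypTube.connD A B C) q =
      -(C q * curvCoeff₇ (HypTube.connB A B) (HypTube.connE C) q) := by
  have hA := h.A_pos.ne'
  have hN := h.radial_pos.ne'
  have hC := h.C_pos.ne'
  simp only [curvCoeff₄, curvCoeff₇, HypTube.connA, HypTube.connB, HypTube.connD, HypTube.connE]
  field_simp
  ring

lemma curvCoeff_symm₃ (h : IsRegularAt A B C q) :
    (A q + q * B q) * curvCoeff₅ (HypTube.connA A) (HypTube.connB A B) (HypTube.connC A B)
        (HypTube.connD A B C) (HypTube.connE C) q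
      + B q * curvCoeff₄ (HypTube.connA A) (HypTube.connD A B C) q =
      -(C q * curvCoeff₆ (HypTube.connA A) (HypTube.connC A B) (HypTube.connE C) q) := by
  have hA := h.A_pos.ne'
  have hN := h.radial_pos.ne'
  have hC := h.C_pos.ne'
  have e1 : deriv (HypTube.connD A B C) q = _ :=
    (h.hasDerivAt_deriv_C.neg.div h.hasDerivAt_radial hN).deriv
  have e2 : deriv (HypTube.connE C) q = _ :=
    (h.hasDerivAt_deriv_C.div h.hasDerivAt_C hC).deriv
  simp only [curvCoeff₄, curvCoeff₅, curvCoeff₆, e1, e2, HypTube.connA, HypTube.connB,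
    HypTube.connC, HypTube.connD, HypTube.connE, Pi.neg_apply]
  obtain ⟨N, hN'⟩ : ∃ N, A q + q * B q = N := ⟨_, rfl⟩
  rw [hN'] at hN ⊢
  field_simp
  rw [show A q = N - q * B q by linarith]
  ring

end IsRegularAt

/-! ### The curvature coefficients of a doubly warped product -/

lemma IsInterpolatingPair.le_sigma {R : ℝ} {σ τ : ℝ → ℝ} (h : IsInterpolatingPair R σ τ)
    (hR : 0 < R) {r : ℝ} (hr : 0 ≤ r) : r ≤ σ r := by
  have := monotoneOn_of_hasDerivAt (convex_Ici 0) (fun x =>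
    ((h.smooth_sigma.differentiable (by simp) x).hasDerivAt.sub (hasDerivAt_id x)))
    (fun x hx => sub_nonneg.mpr (h.one_le_deriv_sigma x hx)) Set.self_mem_Ici hr hr
  simp only [Pi.sub_apply, h.sigma_of_le 0 (by positivity), id_eq] at this
  linarith

lemma IsInterpolatingPair.one_le_tau {R : ℝ} {σ τ : ℝ → ℝ} (h : IsInterpolatingPair R σ τ)
    (hR : 0 < R) {r : ℝ} (hr : 0 ≤ r) : 1 ≤ τ r := by
  have := monotoneOn_of_hasDerivAt (convex_Ici 0) (fun x =>
    (h.smooth_tau.differentiable (by simp) x).hasDerivAt) h.deriv_tau_nonneg Set.self_mem_Ici hr hr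
  rwa [h.tau_of_le 0 (by positivity)] at this

variable {σ τ : ℝ → ℝ} {R q : ℝ}

lemma IsWarpCoeff.isRegularAt (h : IsWarpCoeff σ τ A B C) (hR : 0 < R)
    (hp : IsInterpolatingPair R σ τ) (hq : 0 ≤ q) : IsRegularAt A B C q := by
  refine ⟨h.smooth_A q hq, h.smooth_B q hq, h.smooth_C q hq, ?_, ?_, ?_⟩
  · rcases hq.eq_or_lt with rfl | hq
    · simp [h.A_zero]
    · have h1 : 0 < Real.arsinh √q := Real.arsinh_pos_iff.mpr (Real.sqrt_pos.mpr hq)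
      have := h1.trans_le (hp.le_sigma hR h1.le)
      rw [h.A_eq q hq]
      positivity
  · rw [h.radial q hq]
    positivity
  · have := hp.one_le_tau hR (Real.arsinh_nonneg_iff.mpr (Real.sqrt_nonneg q))
    rw [h.C_eq q hq]
    positivity

/-- The derivative of `2 arsinh √q`. -/
def arsinhSqrtDeriv (q : ℝ) : ℝ := (√(q * (1 + q)))⁻¹

lemma arsinhSqrtDeriv_sq (hq : 0 < q) : arsinhSqrtDeriv q ^ 2 = (q * (1 + q))⁻¹ := by
  rw [arsinhSqrtDeriv, inv_pow, Real.sq_sqrt (by positivity)]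

lemma hasDerivAt_arsinh_sqrt (hq : 0 < q) :
    HasDerivAt (fun q => Real.arsinh √q) (arsinhSqrtDeriv q / 2) q := by
  refine ((Real.hasDerivAt_arsinh √q).comp q (Real.hasDerivAt_sqrt hq.ne')).congr_deriv ?_
  rw [Real.sq_sqrt hq.le, arsinhSqrtDeriv, Real.sqrt_mul hq.le]
  have : 0 < √(1 + q) := Real.sqrt_pos.mpr (by linarith)
  have : 0 < √q := Real.sqrt_pos.mpr hq
  field_simp

lemma hasDerivAt_arsinhSqrtDeriv (hq : 0 < q) : HasDerivAt arsinhSqrtDeriv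
    (-(1 + 2 * q) / (2 * (q * (1 + q))) * arsinhSqrtDeriv q) q := by
  have h0 : 0 < q * (1 + q) := by positivity
  have h1 : HasDerivAt (fun q : ℝ => q * (1 + q)) (1 * (1 + q) + q * 1) q :=
    (hasDerivAt_id q).mul ((hasDerivAt_id q).const_add 1)
  have hs : 0 < √(q * (1 + q)) := Real.sqrt_pos.mpr h0
  refine ((h1.sqrt h0.ne').inv hs.ne').congr_deriv ?_
  rw [arsinhSqrtDeriv, Real.sq_sqrt h0.le]
  field_simp
  ring

/-- The vanishing of all curvature coefficients. -/
structure IsFlatAt (A B C : ℝ → ℝ) (q : ℝ) : Prop where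
  coeff₁ : curvCoeff₁ (connA A) (connB A B) q = 0
  coeff₂ : curvCoeff₂ (connA A) (connC A B) q = 0
  coeff₃ : curvCoeff₃ (connB A B) (connC A B) q = 0
  coeff₄ : curvCoeff₄ (connA A) (connD A B C) q = 0
  coeff₅ : curvCoeff₅ (connA A) (connB A B) (connC A B) (connD A B C) (connE C) q = 0
  coeff₆ : curvCoeff₆ (connA A) (connC A B) (connE C) q = 0
  coeff₇ : curvCoeff₇ (connB A B) (connE C) q = 0

namespace IsWarpCoeff

lemma deriv_A (h : IsWarpCoeff σ τ A B C) (hσ : ContDiff ℝ ∞ σ) (hq : 0 < q) :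
    deriv A q = σ (Real.arsinh √q) * deriv σ (Real.arsinh √q) * arsinhSqrtDeriv q / q
      - σ (Real.arsinh √q) ^ 2 / q ^ 2 := by
  have h1 := (((hσ.differentiable (by simp) _).hasDerivAt.comp q
    (hasDerivAt_arsinh_sqrt hq)).pow 2).div (hasDerivAt_id q) hq.ne'
  have h2 := h1.congr_of_eventuallyEq (f₁ := A) (by
    filter_upwards [Ioi_mem_nhds hq] with y hy using h.A_eq y hy)
  rw [h2.deriv]
  simp only [Function.comp, id_eq, Pi.pow_apply]
  field_simp
  ring

lemma deriv_C (h : IsWarpCoeff σ τ A B C) (hτ : ContDiff ℝ ∞ τ) (hq : 0 < q) :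
    deriv C q = τ (Real.arsinh √q) * deriv τ (Real.arsinh √q) * arsinhSqrtDeriv q := by
  have h1 := ((hτ.differentiable (by simp) _).hasDerivAt.comp q (hasDerivAt_arsinh_sqrt hq)).pow 2
  have h2 := h1.congr_of_eventuallyEq (f₁ := C) (by
    filter_upwards [Ioi_mem_nhds hq] with y hy using h.C_eq y (le_of_lt hy))
  rw [h2.deriv]
  simp only [Function.comp]
  ring

lemma B_eq (h : IsWarpCoeff σ τ A B C) (hq : 0 < q) :
    B q = ((1 + q)⁻¹ - σ (Real.arsinh √q) ^ 2 / q) / q := by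
  rw [← h.A_eq q hq, ← h.radial q hq.le]
  field_simp
  ring

lemma deriv_B (h : IsWarpCoeff σ τ A B C) (hσ : ContDiff ℝ ∞ σ) (hq : 0 < q) :
    deriv B q = -(1 + 2 * q) / (q * (1 + q)) ^ 2
      - σ (Real.arsinh √q) * deriv σ (Real.arsinh √q) * arsinhSqrtDeriv q / q ^ 2
      + 2 * σ (Real.arsinh √q) ^ 2 / q ^ 3 := by
  have hA : HasDerivAt A (deriv A q) q :=
    ((h.smooth_A q hq.le).differentiableAt (by simp)).hasDerivAt
  have h0 : 1 + q ≠ 0 := by positivity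
  have h1 := ((((hasDerivAt_id q).const_add 1).inv h0).sub hA).div (hasDerivAt_id q) hq.ne'
  have h2 := h1.congr_of_eventuallyEq (f₁ := B) (by
    filter_upwards [Ioi_mem_nhds hq] with y hy
    simp only [Pi.div_apply, Pi.sub_apply, Pi.inv_apply, h.A_eq y hy, h.B_eq hy, id_eq])
  rw [h2.deriv, h.deriv_A hσ hq]
  simp only [Pi.sub_apply, Pi.inv_apply, h.A_eq q hq, id_eq]
  field_simp
  ring

lemma sigma_pos (hR : 0 < R) (hp : IsInterpolatingPair R σ τ) (hq : 0 < q) :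
    0 < σ (Real.arsinh √q) := by
  have h1 : 0 < Real.arsinh √q := Real.arsinh_pos_iff.mpr (Real.sqrt_pos.mpr hq)
  exact h1.trans_le (hp.le_sigma hR h1.le)

lemma tau_pos (hR : 0 < R) (hp : IsInterpolatingPair R σ τ) : 0 < τ (Real.arsinh √q) :=
  zero_lt_one.trans_le (hp.one_le_tau hR (Real.arsinh_nonneg_iff.mpr (Real.sqrt_nonneg q)))

lemma connA_eq (h : IsWarpCoeff σ τ A B C) (hR : 0 < R) (hp : IsInterpolatingPair R σ τ)
    (hq : 0 < q) : connA A q =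
      deriv σ (Real.arsinh √q) * arsinhSqrtDeriv q / σ (Real.arsinh √q) - 1 / q := by
  have := sigma_pos hR hp hq
  rw [connA, h.deriv_A hp.smooth_sigma hq, h.A_eq q hq]
  field_simp

lemma connB_eq (h : IsWarpCoeff σ τ A B C) (hp : IsInterpolatingPair R σ τ)
    (hq : 0 < q) : connB A B q = 1 / q -
      (1 + q) * (σ (Real.arsinh √q) * deriv σ (Real.arsinh √q) * arsinhSqrtDeriv q) / q := by
  rw [connB, h.deriv_A hp.smooth_sigma hq, h.radial q hq.le, h.B_eq hq]
  field_simp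
  ring

lemma connC_eq (h : IsWarpCoeff σ τ A B C) (hR : 0 < R) (hp : IsInterpolatingPair R σ τ)
    (hq : 0 < q) : connC A B q = 1 / (q ^ 2 * (1 + q))
      + (1 + q) * (σ (Real.arsinh √q) * deriv σ (Real.arsinh √q) * arsinhSqrtDeriv q) / q ^ 2
      - 2 * deriv σ (Real.arsinh √q) * arsinhSqrtDeriv q / (σ (Real.arsinh √q) * q) := by
  have := sigma_pos hR hp hq
  rw [connC, h.deriv_A hp.smooth_sigma hq, h.deriv_B hp.smooth_sigma hq, h.radial q hq.le,
    h.B_eq hq, h.A_eq q hq]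
  field_simp
  ring

lemma connD_eq (h : IsWarpCoeff σ τ A B C) (hp : IsInterpolatingPair R σ τ) (hq : 0 < q) :
    connD A B C q =
      -((1 + q) * (τ (Real.arsinh √q) * deriv τ (Real.arsinh √q) * arsinhSqrtDeriv q)) := by
  rw [connD, h.deriv_C hp.smooth_tau hq, h.radial q hq.le]
  field_simp

lemma connE_eq (h : IsWarpCoeff σ τ A B C) (hR : 0 < R) (hp : IsInterpolatingPair R σ τ)
    (hq : 0 < q) : connE C q =
      deriv τ (Real.arsinh √q) * arsinhSqrtDeriv q / τ (Real.arsinh √q) := by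
  have := tau_pos (q := q) hR hp
  rw [connE, h.deriv_C hp.smooth_tau hq, h.C_eq q hq.le]
  field_simp

/-- The derivative of a logarithmic derivative in the variable `q`. -/
lemma deriv_logDeriv_arsinh_sqrt {f : ℝ → ℝ} (hf : ContDiff ℝ ∞ f) (hq : 0 < q)
    (h0 : f (Real.arsinh √q) ≠ 0) :
    HasDerivAt (fun q => deriv f (Real.arsinh √q) * arsinhSqrtDeriv q / f (Real.arsinh √q))
      (deriv (deriv f) (Real.arsinh √q) / f (Real.arsinh √q) * arsinhSqrtDeriv q ^ 2 / 2
        - deriv f (Real.arsinh √q) / f (Real.arsinh √q) * ((1 + 2 * q) / (2 * (q * (1 + q)))) *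
          arsinhSqrtDeriv q
        - (deriv f (Real.arsinh √q) / f (Real.arsinh √q)) ^ 2 * arsinhSqrtDeriv q ^ 2 / 2) q := by
  have h1 := (hf.differentiable (by simp) (Real.arsinh √q)).hasDerivAt.comp q
    (hasDerivAt_arsinh_sqrt hq)
  have h2 := ((contDiffAt_deriv (hf.contDiffAt (x := Real.arsinh √q))).differentiableAt
    (by simp)).hasDerivAt.comp q (hasDerivAt_arsinh_sqrt hq)
  refine ((h2.mul (hasDerivAt_arsinhSqrtDeriv hq)).div h1 h0).congr_deriv ?_
  simp only [Function.comp, Pi.mul_apply]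
  field_simp
  ring

/-- Curvatures of the coordinate planes for q > 0: `curvCoeff₁` / A is that of planes tangent to the
spheres, (1 + q)(`curvCoeff₁` + q `curvCoeff₂`) = -σ''/σ that of radial-spherical planes, and
`curvCoeff₄` / C = -σ'τ'/(στ) that of planes spanned by a spherical direction and ∂z. For the radial
direction and ∂z, A `curvCoeff₄` - q C `curvCoeff₆`, divided by C/(1 + q), gives -τ''/τ. -/
lemma curvCoeff₁_eq (h : IsWarpCoeff σ τ A B C) (hR : 0 < R) (hp : IsInterpolatingPair R σ τ)
    (hq : 0 < q) : curvCoeff₁ (connA A) (connB A B) q =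
      (1 - deriv σ (Real.arsinh √q) ^ 2) / q := by
  have := sigma_pos hR hp hq
  have hw := arsinhSqrtDeriv_sq hq
  rw [curvCoeff₁, h.connA_eq hR hp hq, h.connB_eq hp hq]
  field_simp at hw ⊢
  linear_combination (-σ (Real.arsinh √q) * deriv σ (Real.arsinh √q) ^ 2) * hw

lemma curvCoeff₂_eq (h : IsWarpCoeff σ τ A B C) (hR : 0 < R) (hp : IsInterpolatingPair R σ τ)
    (hq : 0 < q) : curvCoeff₂ (connA A) (connC A B) q =
      (deriv σ (Real.arsinh √q) ^ 2 - 1) / q ^ 2 -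
        deriv (deriv σ) (Real.arsinh √q) / (σ (Real.arsinh √q) * (q * (1 + q))) := by
  have hs := sigma_pos hR hp hq
  have hw := arsinhSqrtDeriv_sq hq
  have hd := (deriv_logDeriv_arsinh_sqrt hp.smooth_sigma hq hs.ne').sub
    ((hasDerivAt_const q 1).div (hasDerivAt_id q) hq.ne')
  have e := (hd.congr_of_eventuallyEq (f₁ := connA A) (by
    filter_upwards [Ioi_mem_nhds hq] with y hy using h.connA_eq hR hp hy)).deriv
  rw [curvCoeff₂, e, h.connA_eq hR hp hq, h.connC_eq hR hp hq, id_eq]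
  field_simp at hw ⊢
  linear_combination (σ (Real.arsinh √q) ^ 2 * deriv σ (Real.arsinh √q) ^ 2 * (1 + q) -
    q * σ (Real.arsinh √q) * deriv (deriv σ) (Real.arsinh √q)) * hw

lemma curvCoeff₄_eq (h : IsWarpCoeff σ τ A B C) (hR : 0 < R) (hp : IsInterpolatingPair R σ τ)
    (hq : 0 < q) : curvCoeff₄ (connA A) (connD A B C) q =
      -(deriv σ (Real.arsinh √q) * deriv τ (Real.arsinh √q) * τ (Real.arsinh √q)) /
        σ (Real.arsinh √q) := by
  have hs := sigma_pos hR hp hq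
  have hw := arsinhSqrtDeriv_sq hq
  rw [curvCoeff₄, h.connA_eq hR hp hq, h.connD_eq hp hq]
  field_simp at hw ⊢
  linear_combination (-τ (Real.arsinh √q) * deriv τ (Real.arsinh √q) *
    deriv σ (Real.arsinh √q)) * hw

lemma curvCoeff₆_eq (h : IsWarpCoeff σ τ A B C) (hR : 0 < R) (hp : IsInterpolatingPair R σ τ)
    (hq : 0 < q) : curvCoeff₆ (connA A) (connC A B) (connE C) q =
      deriv (deriv τ) (Real.arsinh √q) / (τ (Real.arsinh √q) * (q * (1 + q))) -
        deriv σ (Real.arsinh √q) * deriv τ (Real.arsinh √q) * σ (Real.arsinh √q) /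
          (τ (Real.arsinh √q) * q ^ 2) := by
  have hs := sigma_pos hR hp hq
  have ht := tau_pos (q := q) hR hp
  have hw := arsinhSqrtDeriv_sq hq
  have e := ((deriv_logDeriv_arsinh_sqrt hp.smooth_tau hq ht.ne').congr_of_eventuallyEq
    (f₁ := connE C) (by
      filter_upwards [Ioi_mem_nhds hq] with y hy using h.connE_eq hR hp hy)).deriv
  rw [curvCoeff₆, e, h.connA_eq hR hp hq, h.connC_eq hR hp hq, h.connE_eq hR hp hq]
  field_simp at hw ⊢
  linear_combination (q * τ (Real.arsinh √q) * deriv (deriv τ) (Real.arsinh √q) *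
    σ (Real.arsinh √q) - (1 + q) * τ (Real.arsinh √q) * deriv τ (Real.arsinh √q) *
    σ (Real.arsinh √q) ^ 2 * deriv σ (Real.arsinh √q)) * hw

/-- The signs of the curvature coefficients that determine the sign of the sectional curvature. -/
lemma curvCoeff_nonpos (h : IsWarpCoeff σ τ A B C) (hR : 0 < R) (hp : IsInterpolatingPair R σ τ)
    (hq : 0 < q) :
    curvCoeff₁ (connA A) (connB A B) q ≤ 0 ∧
    curvCoeff₁ (connA A) (connB A B) q + q * curvCoeff₂ (connA A) (connC A B) q ≤ 0 ∧
    curvCoeff₄ (connA A) (connD A B C) q ≤ 0 ∧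
    A q * curvCoeff₄ (connA A) (connD A B C) q
      - q * (C q * curvCoeff₆ (connA A) (connC A B) (connE C) q) ≤ 0 := by
  have hr : 0 ≤ Real.arsinh √q := Real.arsinh_nonneg_iff.mpr (Real.sqrt_nonneg q)
  have hs := sigma_pos hR hp hq
  have ht := tau_pos (q := q) hR hp
  have hs1 := hp.one_le_deriv_sigma _ hr
  have ht1 := hp.deriv_tau_nonneg _ hr
  have hs2 := hp.deriv_deriv_sigma_nonneg _ hr
  have ht2 := hp.deriv_deriv_tau_nonneg _ hr
  rw [h.curvCoeff₁_eq hR hp hq, h.curvCoeff₂_eq hR hp hq, h.curvCoeff₄_eq hR hp hq,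
    h.curvCoeff₆_eq hR hp hq, h.A_eq q hq, h.C_eq q hq.le]
  refine ⟨div_nonpos_of_nonpos_of_nonneg (by nlinarith) hq.le, ?_,
    div_nonpos_of_nonpos_of_nonneg (neg_nonpos.mpr (by positivity)) hs.le, ?_⟩
  -- Up to the factor 1 + q this is the radial-spherical curvature -σ''/σ; the terms with σ'²
  -- cancel.
  · have e : deriv (deriv σ) (Real.arsinh √q) / (σ (Real.arsinh √q) * (1 + q)) =
        -((1 - deriv σ (Real.arsinh √q) ^ 2) / q + q * ((deriv σ (Real.arsinh √q) ^ 2 - 1) / q ^ 2 -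
        deriv (deriv σ) (Real.arsinh √q) / (σ (Real.arsinh √q) * (q * (1 + q))))) := by
      field_simp
      ring
    rw [← neg_nonneg, ← e]
    positivity
  -- The terms with σ'τ' cancel and leave the curvature -τ''/τ of the radial-axial plane, up to a
  -- positive factor.
  · have e : deriv (deriv τ) (Real.arsinh √q) * τ (Real.arsinh √q) / (1 + q) =
        -(σ (Real.arsinh √q) ^ 2 / q * (-(deriv σ (Real.arsinh √q) * deriv τ (Real.arsinh √q) *
        τ (Real.arsinh √q)) / σ (Real.arsinh √q)) - q * (τ (Real.arsinh √q) ^ 2 *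
        (deriv (deriv τ) (Real.arsinh √q) / (τ (Real.arsinh √q) * (q * (1 + q))) -
        deriv σ (Real.arsinh √q) * deriv τ (Real.arsinh √q) * σ (Real.arsinh √q) /
          (τ (Real.arsinh √q) * q ^ 2)))) := by
      field_simp
      ring
    rw [← neg_nonneg, ← e]
    positivity

/-- For r < 1/R one has σ' = 1 and τ' = σ'' = τ'' = 0, so the explicit formulas give the vanishing
of coefficients 1, 2, 4, 6; the symmetry identities give 3, 5, 7. -/
lemma isFlatAt_of_pos (h : IsWarpCoeff σ τ A B C) (hR : 0 < R) (hp : IsInterpolatingPair R σ τ)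
    (hq : 0 < q) (hqR : Real.arsinh √q < 1 / R) : IsFlatAt A B C q := by
  have hreg := h.isRegularAt hR hp hq.le
  have hnhds : ∀ᶠ r in 𝓝 (Real.arsinh √q), r < 1 / R := Iio_mem_nhds hqR
  have hs1 : ∀ r < 1 / R, deriv σ r = 1 := fun r hr => by
    have : σ =ᶠ[𝓝 r] id := by
      filter_upwards [Iio_mem_nhds hr] with y hy using hp.sigma_of_le y (le_of_lt hy)
    rw [this.deriv_eq, deriv_id]
  have ht1 : ∀ r < 1 / R, deriv τ r = 0 := fun r hr => by
    have : τ =ᶠ[𝓝 r] fun _ => 1 := by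
      filter_upwards [Iio_mem_nhds hr] with y hy using hp.tau_of_le y (le_of_lt hy)
    rw [this.deriv_eq, deriv_const]
  have hs2 : deriv (deriv σ) (Real.arsinh √q) = 0 := by
    have : deriv σ =ᶠ[𝓝 (Real.arsinh √q)] fun _ => 1 := by
      filter_upwards [hnhds] with y hy using hs1 y hy
    rw [this.deriv_eq, deriv_const]
  have ht2 : deriv (deriv τ) (Real.arsinh √q) = 0 := by
    have : deriv τ =ᶠ[𝓝 (Real.arsinh √q)] fun _ => 0 := by
      filter_upwards [hnhds] with y hy using ht1 y hy
    rw [this.deriv_eq, deriv_const]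
  have e1 : curvCoeff₁ (connA A) (connB A B) q = 0 := by
    rw [h.curvCoeff₁_eq hR hp hq, hs1 _ hqR]; simp
  have e2 : curvCoeff₂ (connA A) (connC A B) q = 0 := by
    rw [h.curvCoeff₂_eq hR hp hq, hs1 _ hqR, hs2]; simp
  have e4 : curvCoeff₄ (connA A) (connD A B C) q = 0 := by
    rw [h.curvCoeff₄_eq hR hp hq, ht1 _ hqR]; simp
  have e6 : curvCoeff₆ (connA A) (connC A B) (connE C) q = 0 := by
    rw [h.curvCoeff₆_eq hR hp hq, ht1 _ hqR, ht2]; simp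
  refine ⟨e1, e2, ?_, e4, ?_, e6, ?_⟩
  · have := hreg.curvCoeff_symm₁
    rw [e1, e2] at this
    simpa [hreg.radial_pos.ne'] using this.symm
  · have := hreg.curvCoeff_symm₃
    rw [e4, e6] at this
    simpa [hreg.radial_pos.ne'] using this
  · have := hreg.curvCoeff_symm₂
    rw [e4] at this
    simpa [hreg.C_pos.ne'] using this

/-- The formulas in σ and τ divide by q and by σ and say nothing on the axis. Flatness passes to q =
0 by continuity from the right. -/
lemma eq_zero_of_forall_pos {f : ℝ → ℝ} (hf : ContinuousAt f 0) (hR : 0 < R)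
    (h : ∀ q, 0 < q → Real.arsinh √q < 1 / R → f q = 0) : f 0 = 0 := by
  have h1 : Filter.Tendsto f (𝓝[>] 0) (𝓝 (f 0)) := hf.tendsto.mono_left nhdsWithin_le_nhds
  refine tendsto_nhds_unique h1 (tendsto_const_nhds.congr' ?_)
  have hc : Continuous fun q => Real.arsinh √q :=
    Real.continuous_arsinh.comp Real.continuous_sqrt
  have h2 : ∀ᶠ q in 𝓝 (0 : ℝ), Real.arsinh √q < 1 / R :=
    hc.continuousAt.eventually_lt continuousAt_const (by simpa using hR)
  filter_upwards [self_mem_nhdsWithin, nhdsWithin_le_nhds h2] with q hq hq2 using (h q hq hq2).symm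

lemma isFlatAt (h : IsWarpCoeff σ τ A B C) (hR : 0 < R) (hp : IsInterpolatingPair R σ τ)
    (hq : 0 ≤ q) (hqR : Real.arsinh √q < 1 / R) : IsFlatAt A B C q := by
  rcases hq.eq_or_lt with rfl | hq
  · have hreg := h.isRegularAt hR hp le_rfl
    have ha := hreg.connA.continuousAt
    have hb := hreg.connB.continuousAt
    have hc := hreg.connC.continuousAt
    have hd := hreg.connD.continuousAt
    have he := hreg.connE.continuousAt
    have ha' := (contDiffAt_deriv hreg.connA).continuousAt
    have hb' := (contDiffAt_deriv hreg.connB).continuousAt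
    have hd' := (contDiffAt_deriv hreg.connD).continuousAt
    have he' := (contDiffAt_deriv hreg.connE).continuousAt
    have H := fun q hq hqR => h.isFlatAt_of_pos hR hp (q := q) hq hqR
    refine ⟨eq_zero_of_forall_pos ?_ hR fun q hq hqR => (H q hq hqR).coeff₁,
      eq_zero_of_forall_pos ?_ hR fun q hq hqR => (H q hq hqR).coeff₂,
      eq_zero_of_forall_pos ?_ hR fun q hq hqR => (H q hq hqR).coeff₃,
      eq_zero_of_forall_pos ?_ hR fun q hq hqR => (H q hq hqR).coeff₄,
      eq_zero_of_forall_pos ?_ hR fun q hq hqR => (H q hq hqR).coeff₅,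
      eq_zero_of_forall_pos ?_ hR fun q hq hqR => (H q hq hqR).coeff₆,
      eq_zero_of_forall_pos ?_ hR fun q hq hqR => (H q hq hqR).coeff₇⟩
    all_goals
      first
      | unfold curvCoeff₁; fun_prop
      | unfold curvCoeff₂; fun_prop
      | unfold curvCoeff₃; fun_prop
      | unfold curvCoeff₄; fun_prop
      | unfold curvCoeff₅; fun_prop
      | unfold curvCoeff₆; fun_prop
      | unfold curvCoeff₇; fun_prop
  · exact h.isFlatAt_of_pos hR hp hq hqR

end IsWarpCoeff

end HypTube

namespace HypTube

/-! ### The metric `A |dx|² + B ⟨x, dx⟩² + C dz²` on a vector space -/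

section Form

variable {V : Type*} [NormedAddCommGroup V] [InnerProductSpace ℝ V]

/-- The bilinear form `A |dx|² + B ⟨x, dx⟩² + C dz²` at the point `y = (x, z)`, where `A`, `B`, `C`
are functions of `|x|²`. -/
def warpForm (A B C : ℝ → ℝ) (y v w : V × ℝ) : ℝ :=
  A (‖y.1‖ ^ 2) * inner ℝ v.1 w.1 + B (‖y.1‖ ^ 2) * (inner ℝ y.1 v.1 * inner ℝ y.1 w.1)
    + C (‖y.1‖ ^ 2) * (v.2 * w.2)

/-- The Christoffel symbol with coefficients `a`, …, `e`. -/
def warpConn (a b c d e : ℝ → ℝ) (y v w : V × ℝ) : V × ℝ :=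
  (a (‖y.1‖ ^ 2) • (inner ℝ y.1 v.1 • w.1 + inner ℝ y.1 w.1 • v.1) +
    (b (‖y.1‖ ^ 2) * inner ℝ v.1 w.1 + c (‖y.1‖ ^ 2) * (inner ℝ y.1 v.1 * inner ℝ y.1 w.1)
      + d (‖y.1‖ ^ 2) * (v.2 * w.2)) • y.1,
   e (‖y.1‖ ^ 2) * (inner ℝ y.1 v.1 * w.2 + inner ℝ y.1 w.1 * v.2))

/-- The curvature tensor of the connection `warpConn`, as a derivative. -/
def warpCurv (a b c d e : ℝ → ℝ) (y u v w : V × ℝ) : V × ℝ :=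
  fderiv ℝ (fun y' => warpConn a b c d e y' v w) y u
    - fderiv ℝ (fun y' => warpConn a b c d e y' u w) y v
    + warpConn a b c d e y u (warpConn a b c d e y v w)
    - warpConn a b c d e y v (warpConn a b c d e y u w)

variable {A B C a b c d e : ℝ → ℝ} {y : V × ℝ}

lemma hasDerivAt_line (y u : V × ℝ) : HasDerivAt (fun t : ℝ => (y + t • u).1) u.1 0 := by
  simpa using ((hasDerivAt_id (0 : ℝ)).smul_const u.1).const_add y.1

lemma hasDerivAt_inner_line (y u : V × ℝ) (v : V) :
    HasDerivAt (fun t : ℝ => inner ℝ (y + t • u).1 v) (inner ℝ u.1 v) 0 := by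
  simpa using (hasDerivAt_line y u).inner ℝ (hasDerivAt_const (0 : ℝ) v)

lemma hasDerivAt_comp_normSq_line {f : ℝ → ℝ} (hf : DifferentiableAt ℝ f (‖y.1‖ ^ 2)) (u : V × ℝ) :
    HasDerivAt (fun t : ℝ => f (‖(y + t • u).1‖ ^ 2))
      (deriv f (‖y.1‖ ^ 2) * (2 * inner ℝ y.1 u.1)) 0 := by
  have h1 : HasDerivAt (fun t : ℝ => ‖(y + t • u).1‖ ^ 2) (2 * inner ℝ y.1 u.1) 0 := by
    simpa using (hasDerivAt_line y u).norm_sq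
  refine HasDerivAt.comp (0 : ℝ) ?_ h1
  simpa using hf.hasDerivAt

/-- Reduces the derivatives of the metric and of the Christoffel symbols to calculus in one variable
along a line. -/
lemma fderiv_eq_of_line {F : Type*} [NormedAddCommGroup F] [NormedSpace ℝ F] {f : V × ℝ → F}
    {u : V × ℝ} {f' : F} (hf : DifferentiableAt ℝ f y)
    (h : HasDerivAt (fun t : ℝ => f (y + t • u)) f' 0) : fderiv ℝ f y u = f' := by
  have h1 : HasDerivAt (fun t : ℝ => y + t • u) u 0 := by
    simpa using ((hasDerivAt_id (0 : ℝ)).smul_const u).const_add y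
  have h2 : HasFDerivAt f (fderiv ℝ f y) (y + (0 : ℝ) • u) := by simpa using hf.hasFDerivAt
  exact (h2.comp_hasDerivAt (0 : ℝ) h1).unique h

lemma contDiffAt_comp_normSq {f : ℝ → ℝ} (hf : ContDiffAt ℝ ∞ f (‖y.1‖ ^ 2)) :
    ContDiffAt ℝ ∞ (fun y : V × ℝ => f (‖y.1‖ ^ 2)) y :=
  hf.comp y (contDiffAt_fst.norm_sq ℝ)

lemma differentiableAt_comp_normSq {f : ℝ → ℝ} (hf : ContDiffAt ℝ ∞ f (‖y.1‖ ^ 2)) :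
    DifferentiableAt ℝ (fun y : V × ℝ => f (‖y.1‖ ^ 2)) y :=
  (contDiffAt_comp_normSq hf).differentiableAt (by simp)

lemma fderiv_warpForm (h : IsRegularAt A B C (‖y.1‖ ^ 2)) (u v w : V × ℝ) :
    fderiv ℝ (fun y' => warpForm A B C y' v w) y u =
      deriv A (‖y.1‖ ^ 2) * (2 * inner ℝ y.1 u.1) * inner ℝ v.1 w.1
      + deriv B (‖y.1‖ ^ 2) * (2 * inner ℝ y.1 u.1) * (inner ℝ y.1 v.1 * inner ℝ y.1 w.1)
      + B (‖y.1‖ ^ 2) * (inner ℝ u.1 v.1 * inner ℝ y.1 w.1 + inner ℝ y.1 v.1 * inner ℝ u.1 w.1)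
      + deriv C (‖y.1‖ ^ 2) * (2 * inner ℝ y.1 u.1) * (v.2 * w.2) := by
  have hA := differentiableAt_comp_normSq h.smooth_A
  have hB := differentiableAt_comp_normSq h.smooth_B
  have hC := differentiableAt_comp_normSq h.smooth_C
  have hi : ∀ v : V, DifferentiableAt ℝ (fun y : V × ℝ => inner ℝ y.1 v) y := fun v =>
    differentiableAt_fst.inner ℝ (differentiableAt_const v)
  refine fderiv_eq_of_line (((hA.mul_const _).add (hB.mul ((hi v.1).mul (hi w.1)))).add
    (hC.mul_const _)) ?_
  refine ((((hasDerivAt_comp_normSq_line (h.smooth_A.differentiableAt (by simp)) u).mul_const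
    (inner ℝ v.1 w.1)).add ((hasDerivAt_comp_normSq_line
    (h.smooth_B.differentiableAt (by simp)) u).mul ((hasDerivAt_inner_line y u v.1).mul
    (hasDerivAt_inner_line y u w.1)))).add ((hasDerivAt_comp_normSq_line
    (h.smooth_C.differentiableAt (by simp)) u).mul_const (v.2 * w.2))).congr_deriv ?_
  simp only [zero_smul, add_zero, Pi.mul_apply]
  ring

/-- The Koszul formula for the Christoffel symbol. -/
lemma warpForm_warpConn (h : IsRegularAt A B C (‖y.1‖ ^ 2)) (u v w : V × ℝ) :
    2 * warpForm A B C y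
        (warpConn (connA A) (connB A B) (connC A B) (connD A B C) (connE C) y v w) u =
      fderiv ℝ (fun y' => warpForm A B C y' w u) y v
      + fderiv ℝ (fun y' => warpForm A B C y' v u) y w
      - fderiv ℝ (fun y' => warpForm A B C y' v w) y u := by
  have hA := h.A_pos.ne'
  have hN := h.radial_pos.ne'
  have hC := h.C_pos.ne'
  rw [fderiv_warpForm h, fderiv_warpForm h, fderiv_warpForm h]
  simp only [warpForm, warpConn, connA, connB, connC, connD, connE, inner_add_left, inner_add_right,
    inner_smul_left, inner_smul_right, real_inner_self_eq_norm_sq, RCLike.conj_to_real]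
  rw [real_inner_comm u.1 v.1, real_inner_comm u.1 w.1, real_inner_comm w.1 v.1]
  generalize ‖y.1‖ ^ 2 = q at *
  obtain ⟨N, hN'⟩ : ∃ N, A q + q * B q = N := ⟨_, rfl⟩
  rw [hN'] at hN ⊢
  field_simp
  rw [show A q = N - q * B q by linarith]
  ring

/-- For B ≥ 0 the term with B can be dropped; for B ≤ 0 the Cauchy–Schwarz inequality bounds it
below by qB |v|², which leaves the radial coefficient A + qB. The uniform bound gives both
positivity and boundedness of the unit balls. -/
lemma exists_pos_le_warpForm (h : IsRegularAt A B C (‖y.1‖ ^ 2)) :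
    ∃ m, 0 < m ∧ ∀ v, m * ‖v‖ ^ 2 ≤ warpForm A B C y v v := by
  obtain ⟨k, hk, hk'⟩ : ∃ k, 0 < k ∧ ∀ v : V, k * ‖v‖ ^ 2 ≤ A (‖y.1‖ ^ 2) * ‖v‖ ^ 2 +
      B (‖y.1‖ ^ 2) * (inner ℝ y.1 v * inner ℝ y.1 v) := by
    rcases le_total 0 (B (‖y.1‖ ^ 2)) with hB | hB
    · refine ⟨_, h.A_pos, fun v => ?_⟩
      have := mul_nonneg hB (mul_self_nonneg (inner ℝ y.1 v))
      linarith
    · refine ⟨_, h.radial_pos, fun v => ?_⟩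
      have hcs := real_inner_mul_inner_self_le y.1 v
      rw [real_inner_self_eq_norm_sq, real_inner_self_eq_norm_sq] at hcs
      have := mul_le_mul_of_nonpos_left hcs hB
      linarith
  refine ⟨min k (C (‖y.1‖ ^ 2)), lt_min hk h.C_pos, fun v => ?_⟩
  -- The norm of the product is the maximum norm.
  have h1 : ‖v‖ ^ 2 ≤ ‖v.1‖ ^ 2 + v.2 ^ 2 := by
    rw [Prod.norm_def]
    rcases max_cases ‖v.1‖ ‖v.2‖ with ⟨e, -⟩ | ⟨e, -⟩
    · rw [e]
      nlinarith [sq_nonneg v.2]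
    · rw [e, Real.norm_eq_abs, sq_abs]
      nlinarith [sq_nonneg ‖v.1‖]
  simp only [warpForm, real_inner_self_eq_norm_sq]
  have h2 := mul_le_mul_of_nonneg_left h1 (lt_min hk h.C_pos).le
  have h3 := mul_le_mul_of_nonneg_right (min_le_left k (C (‖y.1‖ ^ 2))) (sq_nonneg ‖v.1‖)
  have h4 := mul_le_mul_of_nonneg_right (min_le_right k (C (‖y.1‖ ^ 2))) (sq_nonneg v.2)
  have := hk' v.1
  nlinarith

lemma warpForm_pos {v : V × ℝ} (h : IsRegularAt A B C (‖y.1‖ ^ 2)) (hv : v ≠ 0) :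
    0 < warpForm A B C y v v := by
  obtain ⟨m, hm, h⟩ := exists_pos_le_warpForm h
  have := norm_pos_iff.mpr hv
  exact lt_of_lt_of_le (by positivity) (h v)

/-- The coefficients of a connection are smooth. -/
structure IsSmoothConnAt (a b c d e : ℝ → ℝ) (q : ℝ) : Prop where
  smooth_a : ContDiffAt ℝ ∞ a q
  smooth_b : ContDiffAt ℝ ∞ b q
  smooth_c : ContDiffAt ℝ ∞ c q
  smooth_d : ContDiffAt ℝ ∞ d q
  smooth_e : ContDiffAt ℝ ∞ e q

lemma IsRegularAt.isSmoothConnAt {q : ℝ} (h : IsRegularAt A B C q) :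
    IsSmoothConnAt (HypTube.connA A) (HypTube.connB A B) (HypTube.connC A B)
      (HypTube.connD A B C) (HypTube.connE C) q :=
  ⟨h.connA, h.connB, h.connC, h.connD, h.connE⟩

lemma fderiv_warpConn (h : IsSmoothConnAt a b c d e (‖y.1‖ ^ 2)) (u v w : V × ℝ) :
    fderiv ℝ (fun y' => warpConn a b c d e y' v w) y u =
      (a (‖y.1‖ ^ 2) • (inner ℝ u.1 v.1 • w.1 + inner ℝ u.1 w.1 • v.1) +
        (deriv a (‖y.1‖ ^ 2) * (2 * inner ℝ y.1 u.1)) •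
          (inner ℝ y.1 v.1 • w.1 + inner ℝ y.1 w.1 • v.1) +
        ((b (‖y.1‖ ^ 2) * inner ℝ v.1 w.1 + c (‖y.1‖ ^ 2) * (inner ℝ y.1 v.1 * inner ℝ y.1 w.1)
          + d (‖y.1‖ ^ 2) * (v.2 * w.2)) • u.1 +
        (deriv b (‖y.1‖ ^ 2) * (2 * inner ℝ y.1 u.1) * inner ℝ v.1 w.1
          + (deriv c (‖y.1‖ ^ 2) * (2 * inner ℝ y.1 u.1) * (inner ℝ y.1 v.1 * inner ℝ y.1 w.1)
          + c (‖y.1‖ ^ 2) * (inner ℝ u.1 v.1 * inner ℝ y.1 w.1 + inner ℝ y.1 v.1 * inner ℝ u.1 w.1))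
          + deriv d (‖y.1‖ ^ 2) * (2 * inner ℝ y.1 u.1) * (v.2 * w.2)) • y.1),
      deriv e (‖y.1‖ ^ 2) * (2 * inner ℝ y.1 u.1) *
          (inner ℝ y.1 v.1 * w.2 + inner ℝ y.1 w.1 * v.2)
        + e (‖y.1‖ ^ 2) * (inner ℝ u.1 v.1 * w.2 + inner ℝ u.1 w.1 * v.2)) := by
  have hi : ∀ v : V, DifferentiableAt ℝ (fun y : V × ℝ => inner ℝ y.1 v) y := fun v =>
    differentiableAt_fst.inner ℝ (differentiableAt_const v)
  have hi' := fun v : V => hasDerivAt_inner_line y u v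
  have hd := fun {f : ℝ → ℝ} (hf : ContDiffAt ℝ ∞ f (‖y.1‖ ^ 2)) =>
    hasDerivAt_comp_normSq_line (hf.differentiableAt (by simp)) u
  refine fderiv_eq_of_line ?_ ?_
  · refine DifferentiableAt.prodMk (DifferentiableAt.add ?_ ?_) ?_
    · exact (differentiableAt_comp_normSq h.smooth_a).smul
        (((hi v.1).smul_const _).add ((hi w.1).smul_const _))
    · exact ((((differentiableAt_comp_normSq h.smooth_b).mul_const _).add
        ((differentiableAt_comp_normSq h.smooth_c).mul ((hi v.1).mul (hi w.1)))).add
        ((differentiableAt_comp_normSq h.smooth_d).mul_const _)).smul differentiableAt_fst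
    · exact (differentiableAt_comp_normSq h.smooth_e).mul
        (((hi v.1).mul_const _).add ((hi w.1).mul_const _))
  · refine (HasDerivAt.prodMk (((hd h.smooth_a).smul (((hi' v.1).smul_const w.1).add
      ((hi' w.1).smul_const v.1))).add (((((hd h.smooth_b).mul_const (inner ℝ v.1 w.1)).add
      ((hd h.smooth_c).mul ((hi' v.1).mul (hi' w.1)))).add
      ((hd h.smooth_d).mul_const (v.2 * w.2))).smul (hasDerivAt_line y u)))
      ((hd h.smooth_e).mul (((hi' v.1).mul_const w.2).add ((hi' w.1).mul_const v.2)))).congr_deriv ?_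
    simp only [zero_smul, add_zero, Pi.mul_apply, Pi.add_apply]

/-- The curvature tensor in terms of its coefficients. -/
lemma warpCurv_eq (h : IsSmoothConnAt a b c d e (‖y.1‖ ^ 2)) (u v w : V × ℝ) :
    warpCurv a b c d e y u v w =
      (curvCoeff₁ a b (‖y.1‖ ^ 2) • (inner ℝ v.1 w.1 • u.1 - inner ℝ u.1 w.1 • v.1) +
        (curvCoeff₂ a c (‖y.1‖ ^ 2) * inner ℝ y.1 w.1) •
          (inner ℝ y.1 v.1 • u.1 - inner ℝ y.1 u.1 • v.1) +
        (curvCoeff₃ b c (‖y.1‖ ^ 2) *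
            (inner ℝ y.1 u.1 * inner ℝ v.1 w.1 - inner ℝ y.1 v.1 * inner ℝ u.1 w.1) +
          curvCoeff₅ a b c d e (‖y.1‖ ^ 2) * w.2 *
            (inner ℝ y.1 u.1 * v.2 - inner ℝ y.1 v.1 * u.2)) • y.1 +
        (curvCoeff₄ a d (‖y.1‖ ^ 2) * w.2) • (v.2 • u.1 - u.2 • v.1),
      curvCoeff₆ a c e (‖y.1‖ ^ 2) * inner ℝ y.1 w.1 *
          (inner ℝ y.1 u.1 * v.2 - inner ℝ y.1 v.1 * u.2) +
        curvCoeff₇ b e (‖y.1‖ ^ 2) * (inner ℝ u.1 w.1 * v.2 - inner ℝ v.1 w.1 * u.2)) := by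
  rw [warpCurv, fderiv_warpConn h, fderiv_warpConn h]
  simp only [warpConn, curvCoeff₁, curvCoeff₂, curvCoeff₃, curvCoeff₄, curvCoeff₅, curvCoeff₆,
    curvCoeff₇, inner_add_right, inner_smul_right, real_inner_self_eq_norm_sq,
    Prod.mk_add_mk, Prod.mk_sub_mk]
  rw [real_inner_comm u.1 v.1, real_inner_comm y.1 u.1, real_inner_comm y.1 v.1]
  generalize ‖y.1‖ ^ 2 = q
  -- The terms with `deriv c` are symmetric in u and v and cancel, which is why no coefficient
  -- contains this derivative.
  refine Prod.ext ?_ ?_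
  · simp only []
    module
  · simp only []
    ring

lemma warpCurv_eq_zero (h : IsRegularAt A B C (‖y.1‖ ^ 2)) (hf : IsFlatAt A B C (‖y.1‖ ^ 2))
    (u v w : V × ℝ) :
    warpCurv (connA A) (connB A B) (connC A B) (connD A B C) (connE C) y u v w = 0 := by
  rw [warpCurv_eq h.isSmoothConnAt, hf.coeff₁, hf.coeff₂, hf.coeff₃, hf.coeff₄, hf.coeff₅,
    hf.coeff₆, hf.coeff₇]
  simp

/-- The symmetry identities eliminate coefficients 3, 5 and 7; what remains multiplies a Gram
determinant and squares. -/
lemma warpForm_warpCurv (h : IsRegularAt A B C (‖y.1‖ ^ 2)) (u v : V × ℝ) :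
    warpForm A B C y
        (warpCurv (connA A) (connB A B) (connC A B) (connD A B C) (connE C) y u v v) u =
      A (‖y.1‖ ^ 2) * curvCoeff₁ (connA A) (connB A B) (‖y.1‖ ^ 2) *
        (‖u.1‖ ^ 2 * ‖v.1‖ ^ 2 - inner ℝ u.1 v.1 ^ 2) +
      A (‖y.1‖ ^ 2) * curvCoeff₂ (connA A) (connC A B) (‖y.1‖ ^ 2) *
        ‖inner ℝ y.1 v.1 • u.1 - inner ℝ y.1 u.1 • v.1‖ ^ 2 +
      A (‖y.1‖ ^ 2) * curvCoeff₄ (connA A) (connD A B C) (‖y.1‖ ^ 2) *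
        ‖v.2 • u.1 - u.2 • v.1‖ ^ 2 -
      C (‖y.1‖ ^ 2) * curvCoeff₆ (connA A) (connC A B) (connE C) (‖y.1‖ ^ 2) *
        inner ℝ y.1 (v.2 • u.1 - u.2 • v.1) ^ 2 := by
  have h1 := h.curvCoeff_symm₁
  have h2 := h.curvCoeff_symm₂
  have h3 := h.curvCoeff_symm₃
  rw [warpCurv_eq h.isSmoothConnAt, norm_sub_sq_real, norm_sub_sq_real]
  simp only [warpForm, inner_add_left, inner_add_right, inner_sub_left, inner_sub_right,
    inner_smul_left, inner_smul_right, real_inner_self_eq_norm_sq, RCLike.conj_to_real, norm_smul,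
    mul_pow, Real.norm_eq_abs, sq_abs]
  rw [real_inner_comm u.1 v.1]
  linear_combination -(inner ℝ y.1 u.1 * (inner ℝ y.1 u.1 * ‖v.1‖ ^ 2
      - inner ℝ y.1 v.1 * inner ℝ u.1 v.1)) * h1
    + (u.2 * v.2 * inner ℝ u.1 v.1 - u.2 ^ 2 * ‖v.1‖ ^ 2) * h2
    + v.2 * inner ℝ y.1 u.1 * (inner ℝ y.1 u.1 * v.2 - inner ℝ y.1 v.1 * u.2) * h3

/-- The determinant of the Gram matrix of three vectors is nonnegative. -/
lemma gram_nonneg {x u v : V} (hx : x ≠ 0) : ‖inner ℝ x v • u - inner ℝ x u • v‖ ^ 2 ≤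
    ‖x‖ ^ 2 * (‖u‖ ^ 2 * ‖v‖ ^ 2 - inner ℝ u v ^ 2) := by
  -- Cauchy–Schwarz for |x|² times the components of u and v orthogonal to x. The difference of its
  -- two sides is |x|⁶ times the difference of the two sides of the claim.
  have hcs := real_inner_mul_inner_self_le (‖x‖ ^ 2 • u - inner ℝ x u • x)
    (‖x‖ ^ 2 • v - inner ℝ x v • x)
  rw [norm_sub_sq_real]
  simp only [inner_sub_left, inner_sub_right, inner_smul_left, inner_smul_right,
    real_inner_self_eq_norm_sq, RCLike.conj_to_real, norm_smul, mul_pow, Real.norm_eq_abs,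
    sq_abs] at hcs ⊢
  rw [real_inner_comm x u, real_inner_comm x v] at hcs
  have hq : 0 < ‖x‖ ^ 2 := by positivity
  generalize ‖x‖ ^ 2 = q at *
  have hq3 : 0 < q ^ 3 := by positivity
  refine le_of_mul_le_mul_left ?_ hq3
  nlinarith [hcs]

/-- The sectional curvature is nonpositive if the curvature coefficients have the right signs. -/
lemma warpForm_warpCurv_nonpos (h : IsRegularAt A B C (‖y.1‖ ^ 2)) (hy : y.1 ≠ 0)
    (h1 : curvCoeff₁ (connA A) (connB A B) (‖y.1‖ ^ 2) ≤ 0)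
    (h2 : curvCoeff₁ (connA A) (connB A B) (‖y.1‖ ^ 2)
      + ‖y.1‖ ^ 2 * curvCoeff₂ (connA A) (connC A B) (‖y.1‖ ^ 2) ≤ 0)
    (h3 : curvCoeff₄ (connA A) (connD A B C) (‖y.1‖ ^ 2) ≤ 0)
    (h4 : A (‖y.1‖ ^ 2) * curvCoeff₄ (connA A) (connD A B C) (‖y.1‖ ^ 2) - ‖y.1‖ ^ 2 *
      (C (‖y.1‖ ^ 2) * curvCoeff₆ (connA A) (connC A B) (connE C) (‖y.1‖ ^ 2)) ≤ 0)
    (u v : V × ℝ) : warpForm A B C y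
      (warpCurv (connA A) (connB A B) (connC A B) (connD A B C) (connE C) y u v v) u ≤ 0 := by
  have hA := h.A_pos
  have hg := gram_nonneg (u := u.1) (v := v.1) hy
  have hcs : inner ℝ y.1 (v.2 • u.1 - u.2 • v.1) ^ 2 ≤
      ‖y.1‖ ^ 2 * ‖v.2 • u.1 - u.2 • v.1‖ ^ 2 := by
    have := real_inner_mul_inner_self_le y.1 (v.2 • u.1 - u.2 • v.1)
    rw [real_inner_self_eq_norm_sq, real_inner_self_eq_norm_sq] at this
    linarith
  rw [warpForm_warpCurv h]
  have hq : 0 < ‖y.1‖ ^ 2 := by positivity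
  generalize ‖y.1‖ ^ 2 = q at *
  -- Let Γ be the Gram determinant of u.1, v.1, let p = ⟨x,v⟩u - ⟨x,u⟩v and w = v.2 u - u.2 v, with
  -- u and v standing for first components in p and w. Then q times the left side is A c₁ (qΓ -
  -- |p|²) + A (c₁ + q c₂)|p|² + A c₄ (q|w|² - ⟨x,w⟩²) + (A c₄ - q C c₆)⟨x,w⟩². Each summand is a
  -- nonpositive coefficient times a nonnegative quantity.
  refine nonpos_of_mul_nonpos_right (a := q) ?_ hq
  have i1 := mul_nonneg (mul_nonneg hA.le (neg_nonneg.mpr h1)) (sub_nonneg.mpr hg)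
  have i2 := mul_nonneg (mul_nonneg hA.le (neg_nonneg.mpr h2))
    (sq_nonneg ‖inner ℝ y.1 v.1 • u.1 - inner ℝ y.1 u.1 • v.1‖)
  have i3 := mul_nonneg (mul_nonneg hA.le (neg_nonneg.mpr h3)) (sub_nonneg.mpr hcs)
  have i4 := mul_nonneg (neg_nonneg.mpr h4) (sq_nonneg (inner ℝ y.1 (v.2 • u.1 - u.2 • v.1)))
  linarith

/-- The inner product as a continuous bilinear map. -/
def innerCLM (V : Type*) [NormedAddCommGroup V] [InnerProductSpace ℝ V] : V →L[ℝ] V →L[ℝ] ℝ :=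
  innerSL ℝ

lemma innerCLM_apply (v w : V) : innerCLM V v w = inner ℝ v w := rfl

/-- The bilinear form `α ⟨L ·, L ·⟩ + β ⟨x, L ·⟩ ⟨x, L ·⟩ + γ Z(·) Z(·)`. -/
def formCLM {E : Type*} [NormedAddCommGroup E] [NormedSpace ℝ E] (L : E →L[ℝ] V) (Z : E →L[ℝ] ℝ)
    (α β γ : ℝ) (x : V) : E →L[ℝ] E →L[ℝ] ℝ :=
  α • (innerCLM V).bilinearComp L L +
    β • ((innerCLM V x).comp L).smulRight ((innerCLM V x).comp L) + γ • Z.smulRight Z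

lemma formCLM_apply {E : Type*} [NormedAddCommGroup E] [NormedSpace ℝ E] (L : E →L[ℝ] V)
    (Z : E →L[ℝ] ℝ) (α β γ : ℝ) (x : V) (v w : E) : formCLM L Z α β γ x v w =
      α * inner ℝ (L v) (L w) + β * (inner ℝ x (L v) * inner ℝ x (L w)) + γ * (Z v * Z w) := by
  simp [formCLM, innerCLM_apply]

lemma contDiffAt_formCLM {E : Type*} [NormedAddCommGroup E] [NormedSpace ℝ E] (L : E →L[ℝ] V)
    (Z : E →L[ℝ] ℝ) {F : Type*} [NormedAddCommGroup F] [NormedSpace ℝ F] {α β γ : F → ℝ} {x : F → V}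
    {p : F} (hα : ContDiffAt ℝ ∞ α p) (hβ : ContDiffAt ℝ ∞ β p) (hγ : ContDiffAt ℝ ∞ γ p)
    (hx : ContDiffAt ℝ ∞ x p) :
    ContDiffAt ℝ ∞ (fun p => formCLM L Z (α p) (β p) (γ p) (x p)) p := by
  have hi : ContDiffAt ℝ ∞ (fun p => (innerCLM V (x p)).comp L) p :=
    ContDiffAt.clm_comp ((innerCLM V).contDiff.contDiffAt.comp p hx) contDiffAt_const
  exact ((hα.smul contDiffAt_const).add (hβ.smul (hi.smulRight hi))).add (hγ.smul contDiffAt_const)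

/-- Continuous bilinear forms. -/
abbrev BilinForms (E : Type*) [NormedAddCommGroup E] [NormedSpace ℝ E] := E →L[ℝ] E →L[ℝ] ℝ

/-- The form `warpForm` as a continuous bilinear map. -/
def warpCLM (A B C : ℝ → ℝ) (y : V × ℝ) : BilinForms (V × ℝ) :=
  formCLM (ContinuousLinearMap.fst ℝ V ℝ) (ContinuousLinearMap.snd ℝ V ℝ) (A (‖y.1‖ ^ 2))
    (B (‖y.1‖ ^ 2)) (C (‖y.1‖ ^ 2)) y.1

lemma warpCLM_apply (v w : V × ℝ) : warpCLM A B C y v w = warpForm A B C y v w :=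
  formCLM_apply _ _ _ _ _ _ _ _

lemma contDiffAt_warpCLM (h : IsRegularAt A B C (‖y.1‖ ^ 2)) :
    ContDiffAt ℝ ∞ (warpCLM (V := V) A B C) y :=
  contDiffAt_formCLM _ _ (contDiffAt_comp_normSq h.smooth_A) (contDiffAt_comp_normSq h.smooth_B)
    (contDiffAt_comp_normSq h.smooth_C) contDiffAt_fst

lemma warpForm_symm (v w : V × ℝ) : warpForm A B C y v w = warpForm A B C y w v := by
  simp only [warpForm, real_inner_comm v.1 w.1]
  ring

/-- The form `warpForm` is invariant under rotations and translations. -/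
lemma warpForm_map (f : V → V) (hf : ∀ x y : V, inner ℝ (f x) (f y) = inner ℝ x y) (s : ℝ)
    (v w : V × ℝ) : warpForm A B C (f y.1, s) (f v.1, v.2) (f w.1, w.2) =
      warpForm A B C y v w := by
  have hn : ‖f y.1‖ ^ 2 = ‖y.1‖ ^ 2 := by
    rw [← real_inner_self_eq_norm_sq, hf, real_inner_self_eq_norm_sq]
  simp only [warpForm, hf, hn]

/-- Every term contains a factor x. This is why fields with constant coordinates are parallel along
the core. -/
lemma warpConn_zero (z : ℝ) (v w : V × ℝ) : warpConn a b c d e (0, z) v w = 0 := by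
  simp [warpConn]

end Form

end HypTube

namespace HypTube

variable {n : ℕ} {ℓ : ℝ} {ρ : Matrix.specialOrthogonalGroup (Fin (2 * n)) ℝ}

/-! ### The covering of the tube in coordinates -/

/-- The rotation of `ℝ^(2n)` with orthogonal matrix `ρ`, as a continuous linear map. -/
def rotCLM (ρ : Matrix (Fin (2 * n)) (Fin (2 * n)) ℝ) :
    EuclideanSpace ℝ (Fin (2 * n)) →L[ℝ] EuclideanSpace ℝ (Fin (2 * n)) :=
  LinearMap.toContinuousLinearMap (Matrix.toEuclideanLin ρ)

lemma rotCLM_apply (ρ : Matrix (Fin (2 * n)) (Fin (2 * n)) ℝ)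
    (x : EuclideanSpace ℝ (Fin (2 * n))) : rotCLM ρ x = rot ρ x := rfl

lemma inner_rot {ρ : Matrix (Fin (2 * n)) (Fin (2 * n)) ℝ} (h : ρ.transpose * ρ = 1)
    (x y : EuclideanSpace ℝ (Fin (2 * n))) : inner ℝ (rot ρ x) (rot ρ y) = inner ℝ x y := by
  have h1 := norm_rot h (x + y)
  rw [← rotCLM_apply, map_add] at h1
  have h2 := norm_add_sq_real (rotCLM ρ x) (rotCLM ρ y)
  rw [h1, norm_add_sq_real, rotCLM_apply, rotCLM_apply, norm_rot h, norm_rot h] at h2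
  linarith

/-- The powers of the deck transformation act in the coordinates `(x, z)` by a rotation of `x`
and a translation of `z`. -/
lemma exists_coord_deck_zpow (ℓ : ℝ) (ρ : Matrix.specialOrthogonalGroup (Fin (2 * n)) ℝ) (k : ℤ) :
    ∃ f : EuclideanSpace ℝ (Fin (2 * n)) →L[ℝ] EuclideanSpace ℝ (Fin (2 * n)),
      (∀ x y, inner ℝ (f x) (f y) = inner ℝ x y) ∧
      ∀ p : Hyp n, ((deck ℓ ρ ^ k) p).coord = (f p.coord.1, p.coord.2 + k * ℓ) := by
  suffices h : ∃ f : EuclideanSpace ℝ (Fin (2 * n)) →L[ℝ] EuclideanSpace ℝ (Fin (2 * n)),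
      (∀ x y, inner ℝ (f x) (f y) = inner ℝ x y) ∧
      ∀ p : Hyp n, ((deck ℓ ρ ^ k) p).coord.1 = f p.coord.1 by
    obtain ⟨f, hf, h⟩ := h
    exact ⟨f, hf, fun p => Prod.ext (h p) (coord_deck_zpow_snd k p)⟩
  induction k using Int.induction_on with
  | zero => exact ⟨ContinuousLinearMap.id ℝ _, by simp, by simp⟩
  | succ k ih =>
    obtain ⟨f, hf, h⟩ := ih
    refine ⟨f.comp (rotCLM ρ), fun x y => ?_, fun p => ?_⟩
    · simp only [ContinuousLinearMap.comp_apply, hf, rotCLM_apply, inner_rot (so_left ρ)]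
    · rw [zpow_add, Equiv.Perm.mul_apply, h, zpow_one, coord_deck]
      rfl
  | pred k ih =>
    obtain ⟨f, hf, h⟩ := ih
    refine ⟨f.comp (rotCLM (ρ : Matrix _ _ ℝ).transpose), fun x y => ?_, fun p => ?_⟩
    · simp only [ContinuousLinearMap.comp_apply, hf, rotCLM_apply]
      exact inner_rot (by simpa using so_right ρ) x y
    · rw [zpow_sub, Equiv.Perm.mul_apply, h, zpow_one, coord_deck_inv]
      rfl

/-- The projection from the space of the coordinates `(x, z)` to the tube. -/
def cover (ℓ : ℝ) (ρ : Matrix.specialOrthogonalGroup (Fin (2 * n)) ℝ) (y : Coord n) : Tube ℓ ρ :=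
  proj ℓ ρ (Hyp.coord.symm y)

lemma cover_coord (p : Hyp n) : cover ℓ ρ p.coord = proj ℓ ρ p := by simp [cover]

lemma cover_continuous : Continuous (cover (n := n) ℓ ρ) :=
  proj_continuous.comp Hyp.coord.symm.continuous

lemma cover_rot (y : Coord n) : cover ℓ ρ (rot ρ y.1, y.2 + ℓ) = cover ℓ ρ y := by
  refine proj_eq_iff.mpr ⟨1, ?_⟩
  apply Hyp.coord.injective
  rw [zpow_one, coord_deck, Homeomorph.apply_symm_apply, Homeomorph.apply_symm_apply]

/-- The lift of a point of the tube that is used in the definition of its preferred chart, in the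
coordinates `(x, z)`. -/
def lift (c : Tube ℓ ρ) : Coord n := (Function.surjInv (proj_surjective (ℓ := ℓ) (ρ := ρ)) c).coord

lemma cover_lift (c : Tube ℓ ρ) : cover ℓ ρ (lift c) = c := by
  rw [lift, cover_coord]
  exact Function.surjInv_eq _ c

/-- The linear map `(x, z) ↦ (f x, z)`. -/
def prodId (f : EuclideanSpace ℝ (Fin (2 * n)) →L[ℝ] EuclideanSpace ℝ (Fin (2 * n))) :
    Coord n →L[ℝ] Coord n :=
  f.prodMap (ContinuousLinearMap.id ℝ ℝ)

lemma prodId_apply (f : EuclideanSpace ℝ (Fin (2 * n)) →L[ℝ] EuclideanSpace ℝ (Fin (2 * n)))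
    (v : Coord n) : prodId f v = (f v.1, v.2) := rfl

variable [Fact (0 < ℓ)]

/-- As a total function, the inverse of every preferred chart is the covering map on the whole
coordinate space, not only over the slab. Formulas in charts therefore hold at all y, without domain
conditions. -/
lemma extChartAt_symm_eq (c : Tube ℓ ρ) :
    ((extChartAt 𝓘(ℝ, Coord n) c).symm : Coord n → Tube ℓ ρ) = cover ℓ ρ := rfl

lemma extChartAt_cover (c : Tube ℓ ρ) {y : Coord n} (hy : |y.2 - (lift c).2| < ℓ / 2) :
    extChartAt 𝓘(ℝ, Coord n) c (cover ℓ ρ y) = y := by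
  have h : Hyp.coord.symm y ∈ (slabHomeo ρ (ℓ := ℓ) (lift c).2).source := by
    change |(Hyp.coord (Hyp.coord.symm y)).2 - (lift c).2| < ℓ / 2
    rwa [Homeomorph.apply_symm_apply]
  have h2 := (slabHomeo ρ (lift c).2).left_inv h
  change Hyp.coord ((slabHomeo ρ (lift c).2).symm (slabHomeo ρ (lift c).2 (Hyp.coord.symm y))) = y
  rw [h2, Homeomorph.apply_symm_apply]

lemma extChartAt_self (c : Tube ℓ ρ) : extChartAt 𝓘(ℝ, Coord n) c c = lift c := by
  have h := extChartAt_cover c (y := lift c) (by simpa using (Fact.out : 0 < ℓ))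
  rwa [cover_lift] at h

/-- In the preferred chart at `c`, the covering map is locally a rotation of `x` and
a translation of `z`. -/
lemma exists_extChartAt_cover (c : Tube ℓ ρ) {y : Coord n}
    (hy : cover ℓ ρ y ∈ (chartAt (Coord n) c).source) :
    ∃ (f : EuclideanSpace ℝ (Fin (2 * n)) →L[ℝ] EuclideanSpace ℝ (Fin (2 * n))) (s : ℝ),
      (∀ x y, inner ℝ (f x) (f y) = inner ℝ x y) ∧
      ∀ᶠ y' in 𝓝 y, extChartAt 𝓘(ℝ, Coord n) c (cover ℓ ρ y') = (f y'.1, y'.2 + s) := by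
  set p := Hyp.coord.symm (extChartAt 𝓘(ℝ, Coord n) c (cover ℓ ρ y)) with hp
  have h1 : cover ℓ ρ (extChartAt 𝓘(ℝ, Coord n) c (cover ℓ ρ y)) = cover ℓ ρ y := by
    rw [← extChartAt_symm_eq c]
    exact (extChartAt 𝓘(ℝ, Coord n) c).left_inv (by rwa [extChartAt_source])
  have h2 : |(extChartAt 𝓘(ℝ, Coord n) c (cover ℓ ρ y)).2 - (lift c).2| < ℓ / 2 := by
    have h3 : cover ℓ ρ y ∈ (slabHomeo ρ (ℓ := ℓ) (lift c).2).target := by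
      have := hy
      change cover ℓ ρ y ∈ (tubeChart ρ (lift c).2).source at this
      rw [tubeChart, OpenPartialHomeomorph.trans_source] at this
      exact this.1
    exact (slabHomeo ρ (ℓ := ℓ) (lift c).2).map_target h3
  -- y and its expression in the chart lie over the same point, so they differ by a power of the
  -- deck transformation. The slab is open, so the same power works near y.
  obtain ⟨k, hk⟩ := proj_eq_iff.mp h1
  obtain ⟨f, hf, hfk⟩ := exists_coord_deck_zpow ℓ ρ k
  have e : ∀ y' : Coord n, cover ℓ ρ (f y'.1, y'.2 + k * ℓ) = cover ℓ ρ y' := fun y' => by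
    have := hfk (Hyp.coord.symm y')
    rw [Homeomorph.apply_symm_apply] at this
    rw [← this, cover_coord]
    exact proj_eq_iff.mpr ⟨k, rfl⟩
  refine ⟨f, k * ℓ, hf, ?_⟩
  have e2 := hfk (Hyp.coord.symm y)
  rw [Homeomorph.apply_symm_apply, hk, Homeomorph.apply_symm_apply] at e2
  have h4 : Continuous fun y' : Coord n => |y'.2 + k * ℓ - (lift c).2| := by fun_prop
  have h5 : |y.2 + k * ℓ - (lift c).2| < ℓ / 2 := by
    rw [e2] at h2
    exact h2
  filter_upwards [h4.continuousAt.eventually_lt continuousAt_const h5] with y' hy'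
  rw [← e y']
  exact extChartAt_cover c hy'

lemma hasFDerivAt_of_eventually_prodId {F : Coord n → Coord n} {y : Coord n}
    {f : EuclideanSpace ℝ (Fin (2 * n)) →L[ℝ] EuclideanSpace ℝ (Fin (2 * n))} {s : ℝ}
    (h : ∀ᶠ y' in 𝓝 y, F y' = (f y'.1, y'.2 + s)) : HasFDerivAt F (prodId f) y := by
  have h1 : HasFDerivAt (fun y' : Coord n => prodId f y' + (0, s)) (prodId f) y :=
    (prodId f).hasFDerivAt.add_const _
  refine h1.congr_of_eventuallyEq ?_
  filter_upwards [h] with y' hy'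
  rw [hy', prodId_apply]
  simp

/-- The derivative of the covering map, in the preferred chart at the image point. -/
def coverDeriv (ℓ : ℝ) [Fact (0 < ℓ)] (ρ : Matrix.specialOrthogonalGroup (Fin (2 * n)) ℝ)
    (y : Coord n) : Coord n →L[ℝ] Coord n :=
  fderiv ℝ (fun y' => extChartAt 𝓘(ℝ, Coord n) (cover ℓ ρ y) (cover ℓ ρ y')) y

/-- `lift` may choose another preimage than y. The same isometry f both moves y to that preimage, up
to a translation of z, and is the derivative of the covering map in the chart; hence invariant
tensors in (x, z) descend to the tube. -/
lemma exists_coverDeriv (ℓ : ℝ) [Fact (0 < ℓ)]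
    (ρ : Matrix.specialOrthogonalGroup (Fin (2 * n)) ℝ) (y : Coord n) :
    ∃ (f : EuclideanSpace ℝ (Fin (2 * n)) →L[ℝ] EuclideanSpace ℝ (Fin (2 * n))) (s : ℝ),
      (∀ x y, inner ℝ (f x) (f y) = inner ℝ x y) ∧ lift (cover ℓ ρ y) = (f y.1, y.2 + s) ∧
      coverDeriv ℓ ρ y = prodId f ∧ HasFDerivAt
        (fun y' => extChartAt 𝓘(ℝ, Coord n) (cover ℓ ρ y) (cover ℓ ρ y')) (coverDeriv ℓ ρ y) y ∧
      ContDiffAt ℝ ∞ (fun y' => extChartAt 𝓘(ℝ, Coord n) (cover ℓ ρ y) (cover ℓ ρ y')) y := by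
  obtain ⟨f, s, hf, h⟩ := exists_extChartAt_cover (cover ℓ ρ y) (mem_chart_source _ (cover ℓ ρ y))
  have hd := hasFDerivAt_of_eventually_prodId h
  have e : coverDeriv ℓ ρ y = prodId f := hd.fderiv
  refine ⟨f, s, hf, ?_, e, e ▸ hd, ?_⟩
  · rw [← extChartAt_self]
    exact h.self_of_nhds
  · have h1 : ContDiffAt ℝ ∞ (fun y' : Coord n => (f y'.1, y'.2 + s)) y :=
      (f.contDiff.comp contDiff_fst).contDiffAt.prodMk (contDiffAt_snd.add contDiffAt_const)
    exact h1.congr_of_eventuallyEq h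

lemma hasMFDerivAt_cover (y : Coord n) :
    HasMFDerivAt 𝓘(ℝ, Coord n) 𝓘(ℝ, Coord n) (cover ℓ ρ) y (coverDeriv ℓ ρ y) := by
  obtain ⟨f, s, -, -, -, h, -⟩ := exists_coverDeriv ℓ ρ y
  refine ⟨cover_continuous.continuousAt, ?_⟩
  exact h.hasFDerivWithinAt

lemma hasMFDerivAt_proj (p : Hyp n) :
    HasMFDerivAt 𝓘(ℝ, Coord n) 𝓘(ℝ, Coord n) (proj ℓ ρ) p (coverDeriv ℓ ρ p.coord) := by
  obtain ⟨f, s, -, -, -, h, -⟩ := exists_coverDeriv ℓ ρ p.coord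
  refine ⟨proj_continuous.continuousAt, ?_⟩
  rw [cover_coord] at h
  exact h.hasFDerivWithinAt

lemma contMDiff_cover : ContMDiff 𝓘(ℝ, Coord n) 𝓘(ℝ, Coord n) ∞ (cover (n := n) ℓ ρ) := by
  intro y
  obtain ⟨f, s, -, -, -, -, h⟩ := exists_coverDeriv ℓ ρ y
  refine contMDiffAt_iff.mpr ⟨cover_continuous.continuousAt, ?_⟩
  exact h.contDiffWithinAt

/-- The derivative of the covering map at two points related by the deck transformation. -/
lemma coverDeriv_rot (y v : Coord n) :
    coverDeriv ℓ ρ y v = coverDeriv ℓ ρ (rot ρ y.1, y.2 + ℓ) (rot ρ v.1, v.2) := by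
  obtain ⟨-, -, -, -, -, h, -⟩ := exists_coverDeriv ℓ ρ (rot ρ y.1, y.2 + ℓ)
  have hd : HasFDerivAt (fun y : Coord n => (rot (ρ : Matrix _ _ ℝ) y.1, y.2 + ℓ))
      (prodId (rotCLM (ρ : Matrix _ _ ℝ))) y :=
    hasFDerivAt_of_eventually_prodId (Filter.Eventually.of_forall fun _ => rfl)
  have h2 := HasFDerivAt.comp y h hd
  have e : coverDeriv ℓ ρ y = _ := HasFDerivAt.fderiv (h2.congr_of_eventuallyEq
    (Filter.Eventually.of_forall fun y' => by
      change _ = extChartAt 𝓘(ℝ, Coord n) (cover ℓ ρ (rot ρ y.1, y.2 + ℓ))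
        (cover ℓ ρ (rot ρ y'.1, y'.2 + ℓ))
      rw [cover_rot, cover_rot]))
  rw [e]
  rfl

end HypTube

/-! ### Metrics and Christoffel symbols from their coefficients in charts -/

namespace RiemGeom
variable {E : Type*} [NormedAddCommGroup E] [NormedSpace ℝ E]
  {M : Type*} [TopologicalSpace M] [ChartedSpace E M] [IsManifold 𝓘(ℝ, E) ∞ M]

/-- A family of bilinear forms on the tangent spaces is smooth if its coefficients in the preferred
charts are smooth. -/
lemma contMDiff_of_coeff
    (g : ∀ c : M, TangentSpace 𝓘(ℝ, E) c →L[ℝ] TangentSpace 𝓘(ℝ, E) c →L[ℝ] ℝ)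
    (G : E → E →L[ℝ] E →L[ℝ] ℝ) (hG : ContDiff ℝ ∞ G)
    (h : ∀ (c₀ : M), ∀ c ∈ (chartAt E c₀).source, ∀ v w : E,
      g c (mfderiv 𝓘(ℝ, E) 𝓘(ℝ, E) (extChartAt 𝓘(ℝ, E) c₀).symm (extChartAt 𝓘(ℝ, E) c₀ c) v)
          (mfderiv 𝓘(ℝ, E) 𝓘(ℝ, E) (extChartAt 𝓘(ℝ, E) c₀).symm (extChartAt 𝓘(ℝ, E) c₀ c) w) =
        G (extChartAt 𝓘(ℝ, E) c₀ c) v w) :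
    ContMDiff 𝓘(ℝ, E) (𝓘(ℝ, E).prod 𝓘(ℝ, E →L[ℝ] E →L[ℝ] ℝ)) ∞
      (fun c ↦ Bundle.TotalSpace.mk' (E →L[ℝ] E →L[ℝ] ℝ)
        (E := fun c : M => TangentSpace 𝓘(ℝ, E) c →L[ℝ] TangentSpace 𝓘(ℝ, E) c →L[ℝ] ℝ) c (g c)) := by
  intro c₀
  -- Smoothness is tested in the trivializations at c₀. Their inverses are the derivatives of the
  -- inverse chart, so there the family becomes G composed with the chart.
  rw [contMDiffAt_hom_bundle]
  refine ⟨contMDiffAt_id, ?_⟩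
  have h1 : ContMDiffAt 𝓘(ℝ, E) 𝓘(ℝ, E →L[ℝ] E →L[ℝ] ℝ) ∞
      (fun c : M => G (extChartAt 𝓘(ℝ, E) c₀ c)) c₀ :=
    hG.contDiffAt.contMDiffAt.comp c₀ contMDiffAt_extChartAt
  refine h1.congr_of_eventuallyEq ?_
  filter_upwards [(chartAt E c₀).open_source.mem_nhds (mem_chart_source _ c₀)] with c hc
  refine ContinuousLinearMap.ext fun v => ContinuousLinearMap.ext fun w => ?_
  have hb : c ∈ (trivializationAt E (TangentSpace 𝓘(ℝ, E)) c₀).baseSet := hc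
  refine (inCoordinates_apply_eq₂ hb hb (Set.mem_univ _)).trans ?_
  have e : ∀ v : E, (trivializationAt E (TangentSpace 𝓘(ℝ, E)) c₀).symm c v =
    mfderiv 𝓘(ℝ, E) 𝓘(ℝ, E) (extChartAt 𝓘(ℝ, E) c₀).symm (extChartAt 𝓘(ℝ, E) c₀ c) v := fun v => by
    have := TangentBundle.symmL_trivializationAt (I := 𝓘(ℝ, E)) (𝕜 := ℝ) hc
    rw [modelWithCornersSelf_coe, Set.range_id, mfderivWithin_univ] at this
    rw [← this]
    exact (Bundle.Trivialization.symmL_apply _ hb _).symm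
  rw [e, e]
  refine Eq.trans ?_ (h c₀ c hc v w)
  have e3 : ∀ r : ℝ, (trivializationAt ℝ (fun _ : M => ℝ) c₀).linearMapAt ℝ c r = r := fun r => by
    simp
  exact e3 _

/-- The Christoffel symbol is determined by the Koszul formula. -/
lemma christoffel_eq {g : SmoothMetric E M} {x : M} {y v w c : E}
    (hc : ∀ u : E, 2 * coeff g x y c u =
      fderiv ℝ (fun y' => coeff g x y' w u) y v + fderiv ℝ (fun y' => coeff g x y' v u) y w
        - fderiv ℝ (fun y' => coeff g x y' v w) y u)
    (huniq : ∀ c', (∀ u, coeff g x y c' u = coeff g x y c u) → c' = c) :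
    christoffel g x y v w = c := by
  refine huniq _ fun u => ?_
  have h := Classical.epsilon_spec (p := fun c : E => ∀ u : E, 2 * coeff g x y c u =
      fderiv ℝ (fun y' => coeff g x y' w u) y v + fderiv ℝ (fun y' => coeff g x y' v u) y w
        - fderiv ℝ (fun y' => coeff g x y' v w) y u) ⟨c, hc⟩ u
  rw [← hc u] at h
  have h2 : 2 * coeff g x y (christoffel g x y v w) u = 2 * coeff g x y c u := h
  linarith

end RiemGeom

namespace HypTube

variable {n : ℕ} {ℓ : ℝ} {ρ : Matrix.specialOrthogonalGroup (Fin (2 * n)) ℝ} {A B C : ℝ → ℝ}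

/-! ### The metric on the tube -/

variable [Fact (0 < ℓ)]

/-- Invariance under the deck group: the metric at a point of the tube may be computed at any
preimage. -/
lemma warpForm_lift_cover (y v w : Coord n) :
    warpForm A B C (lift (cover ℓ ρ y)) (coverDeriv ℓ ρ y v) (coverDeriv ℓ ρ y w) =
      warpForm A B C y v w := by
  obtain ⟨f, s, hf, h1, h2, -, -⟩ := exists_coverDeriv ℓ ρ y
  rw [h1, h2, prodId_apply, prodId_apply]
  exact warpForm_map f hf _ v w

lemma isVonNBounded_warpCLM {V : Type*} [NormedAddCommGroup V] [InnerProductSpace ℝ V] {y : V × ℝ}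
    (h : IsRegularAt A B C (‖y.1‖ ^ 2)) :
    Bornology.IsVonNBounded ℝ {v : V × ℝ | warpCLM A B C y v v < 1} := by
  obtain ⟨m, hm, h⟩ := exists_pos_le_warpForm h
  refine NormedSpace.isVonNBounded_of_isBounded ℝ
    ((Metric.isBounded_closedBall (x := 0) (r := m⁻¹ + 1)).subset ?_)
  intro v hv
  have hv : warpCLM A B C y v v < 1 := hv
  rw [warpCLM_apply] at hv
  rw [Metric.mem_closedBall, dist_zero_right]
  have h1 : ‖v‖ ^ 2 ≤ m⁻¹ := by
    rw [← mul_le_mul_iff_right₀ hm, mul_inv_cancel₀ hm.ne']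
    linarith [h v]
  nlinarith [sq_nonneg (‖v‖ - 1)]

lemma warpForm_sub_left {V : Type*} [NormedAddCommGroup V] [InnerProductSpace ℝ V]
    (y v v' w : V × ℝ) :
    warpForm A B C y (v - v') w = warpForm A B C y v w - warpForm A B C y v' w := by
  simp only [warpForm, Prod.fst_sub, Prod.snd_sub, inner_sub_left, inner_sub_right]
  ring

/-- The metric on the tube that is `A |dx|² + B ⟨x, dx⟩² + C dz²` in the coordinates `(x, z)`. -/
def tubeMetric (ℓ : ℝ) [Fact (0 < ℓ)] (ρ : Matrix.specialOrthogonalGroup (Fin (2 * n)) ℝ)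
    (h : ∀ q, 0 ≤ q → IsRegularAt A B C q) : RiemGeom.SmoothMetric (Coord n) (Tube ℓ ρ) where
  -- The tangent space at c is identified with `Coord n` through the preferred chart at c, in which
  -- c has coordinates `lift c`.
  inner c := (warpCLM A B C (lift c) : BilinForms (Coord n))
  symm c v w := (warpCLM_apply v w).trans
    ((warpForm_symm v w).trans (warpCLM_apply (A := A) (B := B) (C := C) w v).symm)
  pos c v hv := lt_of_lt_of_eq (warpForm_pos (h _ (sq_nonneg _)) hv)
    (warpCLM_apply (A := A) (B := B) (C := C) v v).symm
  isVonNBounded c := isVonNBounded_warpCLM (h _ (sq_nonneg _))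
  contMDiff := by
    refine RiemGeom.contMDiff_of_coeff (M := Tube ℓ ρ) _ (warpCLM A B C)
      (contDiff_iff_contDiffAt.mpr fun y => contDiffAt_warpCLM (h _ (sq_nonneg _))) ?_
    intro c₀ c hc v w
    have e : cover ℓ ρ (extChartAt 𝓘(ℝ, Coord n) c₀ c) = c :=
      (extChartAt 𝓘(ℝ, Coord n) c₀).left_inv (by rwa [extChartAt_source])
    refine (warpCLM_apply _ _).trans (Eq.trans ?_ (warpCLM_apply v w).symm)
    rw [← warpForm_lift_cover (ℓ := ℓ) (ρ := ρ) (extChartAt 𝓘(ℝ, Coord n) c₀ c), e,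
      extChartAt_symm_eq, (hasMFDerivAt_cover _).mfderiv]
    rfl

lemma tubeMetric_inner (h : ∀ q, 0 ≤ q → IsRegularAt A B C q) (c : Tube ℓ ρ) (v w : Coord n) :
    (tubeMetric ℓ ρ h).inner c v w = warpForm A B C (lift c) v w := warpCLM_apply v w

lemma tubeMetric_inner_cover (h : ∀ q, 0 ≤ q → IsRegularAt A B C q) (y v w : Coord n) :
    (tubeMetric ℓ ρ h).inner (cover ℓ ρ y) (coverDeriv ℓ ρ y v) (coverDeriv ℓ ρ y w) =
      warpForm A B C y v w :=
  (tubeMetric_inner h _ _ _).trans (warpForm_lift_cover y v w)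

/-- Because the inverse chart is `cover` everywhere, this holds for all y and not only near the
centre of the chart. The coefficients, and then the Christoffel symbols, can thus be rewritten under
`fderiv`. -/
lemma coeff_tubeMetric (h : ∀ q, 0 ≤ q → IsRegularAt A B C q) (c : Tube ℓ ρ) (y v w : Coord n) :
    RiemGeom.coeff (tubeMetric ℓ ρ h) c y v w = warpForm A B C y v w := by
  rw [RiemGeom.coeff, extChartAt_symm_eq, (hasMFDerivAt_cover _).mfderiv]
  exact tubeMetric_inner_cover h y v w

lemma christoffel_tubeMetric (h : ∀ q, 0 ≤ q → IsRegularAt A B C q) (c : Tube ℓ ρ)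
    (y v w : Coord n) : RiemGeom.christoffel (tubeMetric ℓ ρ h) c y v w =
      warpConn (connA A) (connB A B) (connC A B) (connD A B C) (connE C) y v w := by
  have hy := h (‖y.1‖ ^ 2) (sq_nonneg _)
  refine RiemGeom.christoffel_eq ?_ ?_
  · intro u
    simp only [coeff_tubeMetric]
    exact warpForm_warpConn hy u v w
  · intro c' hc'
    simp only [coeff_tubeMetric] at hc'
    by_contra hne
    have h1 := warpForm_pos hy (sub_ne_zero.mpr hne)
    rw [warpForm_sub_left, hc', sub_self] at h1
    exact lt_irrefl _ h1

lemma curvature_tubeMetric (h : ∀ q, 0 ≤ q → IsRegularAt A B C q) (c : Tube ℓ ρ)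
    (u v w : Coord n) : RiemGeom.curvature (tubeMetric ℓ ρ h) c u v w =
      warpCurv (connA A) (connB A B) (connC A B) (connD A B C) (connE C) (lift c) u v w := by
  simp only [RiemGeom.curvature, warpCurv, extChartAt_self]
  simp only [christoffel_tubeMetric]
  rfl

end HypTube

namespace HypTube

variable {n : ℕ} {ℓ : ℝ} {ρ : Matrix.specialOrthogonalGroup (Fin (2 * n)) ℝ} {A B C : ℝ → ℝ}
  {σ τ : ℝ → ℝ} {R : ℝ}

/-! ### Neighborhoods of the core -/

lemma neg_lorentz_axis (y : Coord n) (t : ℝ) :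
    -lorentz (Hyp.coord.symm y).val (axis n t).val = √(1 + ‖y.1‖ ^ 2) * Real.cosh (y.2 - t) := by
  change -(inner ℝ y.1 (0 : EuclideanSpace ℝ (Fin (2 * n)))
    - (√(1 + ‖y.1‖ ^ 2) * Real.exp y.2 * Real.exp (-t)
      + √(1 + ‖y.1‖ ^ 2) * Real.exp (-y.2) * Real.exp t) / 2) = _
  rw [inner_zero_right, Real.cosh_eq, mul_assoc, mul_assoc, ← Real.exp_add, ← Real.exp_add,
    show -(y.2 - t) = -y.2 + t by ring, sub_eq_add_neg y.2 t]
  ring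

/-- The cosh of the distance to the axis point with parameter t is √(1 + |x|²) cosh(z - t). The
nearest axis point is the one with t = z, at distance arsinh |x|. -/
lemma exists_hypDist_axis_lt_iff (y : Coord n) (r : ℝ) :
    (∃ t, hypDist (Hyp.coord.symm y) (axis n t) < r) ↔ Real.arsinh ‖y.1‖ < r := by
  have h0 : Real.arcosh √(1 + ‖y.1‖ ^ 2) = Real.arsinh ‖y.1‖ := by
    rw [← Real.cosh_arsinh, Real.arcosh_cosh (Real.arsinh_nonneg_iff.mpr (norm_nonneg _))]
  have hpos : 0 < √(1 + ‖y.1‖ ^ 2) := by positivity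
  constructor
  · rintro ⟨t, ht⟩
    refine lt_of_le_of_lt ?_ ht
    rw [hypDist, neg_lorentz_axis, ← h0,
      Real.arcosh_le_arcosh hpos (mul_pos hpos (Real.cosh_pos _))]
    exact le_mul_of_one_le_right hpos.le (Real.one_le_cosh _)
  · intro h
    refine ⟨y.2, ?_⟩
    rwa [hypDist, neg_lorentz_axis, sub_self, Real.cosh_zero, mul_one, h0]

lemma core_eq (t : ℝ) : core ℓ ρ t = cover ℓ ρ (0, t) := by
  have : axis n t = Hyp.coord.symm (0, t) := by
    apply Subtype.ext
    change ((0 : EuclideanSpace ℝ (Fin (2 * n))), Real.exp t, Real.exp (-t)) =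
      (0, √(1 + ‖(0 : EuclideanSpace ℝ (Fin (2 * n)))‖ ^ 2) * Real.exp t,
        √(1 + ‖(0 : EuclideanSpace ℝ (Fin (2 * n)))‖ ^ 2) * Real.exp (-t))
    simp
  rw [core, this, cover]

variable [Fact (0 < ℓ)]

lemma norm_lift_cover (y : Coord n) : ‖(lift (cover ℓ ρ y)).1‖ = ‖y.1‖ := by
  obtain ⟨f, s, hf, h1, -, -, -⟩ := exists_coverDeriv ℓ ρ y
  rw [h1, norm_eq_sqrt_real_inner, hf, ← norm_eq_sqrt_real_inner]

/-- The neighborhoods of the core in terms of the coordinate `x`. -/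
lemma mem_coreNhd_iff (c : Tube ℓ ρ) (r : ℝ) :
    c ∈ coreNhd ℓ ρ r ↔ Real.arsinh ‖(lift c).1‖ < r := by
  constructor
  · rintro ⟨p, hp, rfl⟩
    have h := (exists_hypDist_axis_lt_iff p.coord r).mp (by
      rw [Homeomorph.symm_apply_apply]
      exact hp)
    rwa [← cover_coord, norm_lift_cover]
  · intro h
    exact ⟨Hyp.coord.symm (lift c), (exists_hypDist_axis_lt_iff _ r).mpr h, cover_lift c⟩

/-! ### Curvature -/

lemma flatOn_tubeMetric (h : ∀ q, 0 ≤ q → IsRegularAt A B C q) (hw : IsWarpCoeff σ τ A B C)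
    (hR : 0 < R) (hp : IsInterpolatingPair R σ τ) :
    RiemGeom.FlatOn (tubeMetric ℓ ρ h) (coreNhd ℓ ρ (1 / R)) := by
  intro c hc u v w
  refine (curvature_tubeMetric h c u v w).trans
    (warpCurv_eq_zero (h _ (sq_nonneg _)) (hw.isFlatAt hR hp (sq_nonneg _) ?_) u v w)
  rw [Real.sqrt_sq (norm_nonneg _)]
  exact (mem_coreNhd_iff c _).mp hc

lemma inner_curvature_tubeMetric_nonpos (h : ∀ q, 0 ≤ q → IsRegularAt A B C q)
    (hw : IsWarpCoeff σ τ A B C) (hR : 0 < R) (hp : IsInterpolatingPair R σ τ) (c : Tube ℓ ρ)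
    (u v : Coord n) :
    (tubeMetric ℓ ρ h).inner c (RiemGeom.curvature (tubeMetric ℓ ρ h) c u v v) u ≤ 0 := by
  refine ((tubeMetric_inner h c _ _).trans (congrArg (fun x => warpForm A B C (lift c) x u)
    (curvature_tubeMetric h c u v v))).trans_le ?_
  have hreg := h (‖(lift c).1‖ ^ 2) (sq_nonneg _)
  -- The sign argument divides by |x|²; on the axis itself the metric is flat.
  by_cases hc : (lift c).1 = 0
  · have hf : IsFlatAt A B C (‖(lift c).1‖ ^ 2) := hw.isFlatAt hR hp (sq_nonneg _) (by
      rw [hc]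
      simpa using hR)
    rw [warpCurv_eq_zero hreg hf]
    simp [warpForm]
  · obtain ⟨h1, h2, h3, h4⟩ := hw.curvCoeff_nonpos hR hp
      (q := ‖(lift c).1‖ ^ 2) (by positivity)
    exact warpForm_warpCurv_nonpos hreg hc h1 h2 h3 h4 u v

/-- Cauchy–Schwarz for the metric, which makes the denominator of the sectional curvature
nonnegative. -/
lemma warpForm_sq_le {V : Type*} [NormedAddCommGroup V] [InnerProductSpace ℝ V] {y : V × ℝ}
    (h : IsRegularAt A B C (‖y.1‖ ^ 2)) (u v : V × ℝ) :
    warpForm A B C y u v ^ 2 ≤ warpForm A B C y u u * warpForm A B C y v v := by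
  rcases eq_or_ne v 0 with rfl | hv
  · simp [warpForm]
  have hpos := warpForm_pos h hv
  set w : V × ℝ := warpForm A B C y v v • u - warpForm A B C y u v • v
  have h0 : 0 ≤ warpForm A B C y w w := by
    rcases eq_or_ne w 0 with hw | hw
    · simp [hw, warpForm]
    · exact (warpForm_pos h hw).le
  have e : warpForm A B C y w w = warpForm A B C y v v *
      (warpForm A B C y u u * warpForm A B C y v v - warpForm A B C y u v ^ 2) := by
    have hsmul : ∀ (r : ℝ) (a b : V × ℝ), warpForm A B C y (r • a) b = r * warpForm A B C y a b :=
      fun r a b => by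
        simp only [warpForm, Prod.smul_fst, Prod.smul_snd, inner_smul_left, inner_smul_right,
          smul_eq_mul, conj_trivial]
        ring
    rw [warpForm_sub_left, hsmul, hsmul, warpForm_symm u w, warpForm_symm v w, warpForm_sub_left,
      warpForm_sub_left, hsmul, hsmul, hsmul, hsmul, warpForm_symm v u]
    ring
  rw [e] at h0
  linarith [nonneg_of_mul_nonneg_right h0 hpos]

lemma nonposCurved_tubeMetric (h : ∀ q, 0 ≤ q → IsRegularAt A B C q)
    (hw : IsWarpCoeff σ τ A B C) (hR : 0 < R) (hp : IsInterpolatingPair R σ τ) :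
    RiemGeom.NonposCurved (tubeMetric ℓ ρ h) := by
  intro c u v _
  refine div_nonpos_of_nonpos_of_nonneg (inner_curvature_tubeMetric_nonpos h hw hR hp c u v) ?_
  have h1 := tubeMetric_inner h c u u
  have h2 := tubeMetric_inner h c v v
  have h3 := tubeMetric_inner h c u v
  have h4 := warpForm_sq_le (h _ (sq_nonneg ‖(lift c).1‖)) u v
  refine sub_nonneg.mpr ?_
  refine le_of_eq_of_le (congrArg (· ^ 2) h3) (h4.trans_eq ?_)
  exact (congrArg₂ (· * ·) h1 h2).symm

/-! ### The core geodesic -/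

lemma hasMFDerivAt_core (t : ℝ) : HasMFDerivAt 𝓘(ℝ, ℝ) 𝓘(ℝ, Coord n)
    (fun t => cover (n := n) ℓ ρ (0, t)) t
    ((coverDeriv ℓ ρ (0, t)).comp (ContinuousLinearMap.inr ℝ _ ℝ)) := by
  have h : HasFDerivAt (fun t : ℝ => ((0, t) : Coord n)) (ContinuousLinearMap.inr ℝ _ ℝ) t :=
    (ContinuousLinearMap.inr ℝ (EuclideanSpace ℝ (Fin (2 * n))) ℝ).hasFDerivAt
  exact (hasMFDerivAt_cover (0, t)).comp t h.hasMFDerivAt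

lemma velocity_core (t : ℝ) :
    RiemGeom.velocity (E := Coord n) (fun t => cover (n := n) ℓ ρ (0, t)) t =
      coverDeriv ℓ ρ (0, t) (0, 1) := by
  rw [RiemGeom.velocity, (hasMFDerivAt_core t).mfderiv]
  rfl

/-- The fields along the core that are constant in the coordinates `(x, z)` are parallel. -/
lemma isParallel_coverDeriv (h : ∀ q, 0 ≤ q → IsRegularAt A B C q) (e : Coord n) :
    RiemGeom.IsParallel (tubeMetric ℓ ρ h) (fun t => cover ℓ ρ (0, t))
      (fun t => coverDeriv ℓ ρ (0, t) e) := by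
  refine ⟨?_, fun t₀ => ?_⟩
  · exact contMDiff_cover.comp
      (ContinuousLinearMap.inr ℝ (EuclideanSpace ℝ (Fin (2 * n))) ℝ).contDiff.contMDiff
  · obtain ⟨f, s, hf, hev⟩ := exists_extChartAt_cover (cover ℓ ρ (0, t₀))
      (mem_chart_source (Coord n) (cover (n := n) ℓ ρ (0, t₀)))
    have hchr : RiemGeom.christoffel (tubeMetric ℓ ρ h) (cover ℓ ρ (0, t₀))
        (extChartAt 𝓘(ℝ, Coord n) (cover ℓ ρ (0, t₀)) (cover ℓ ρ (0, t₀)))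
        (RiemGeom.velocity (E := Coord n) (fun t => cover (n := n) ℓ ρ (0, t)) t₀)
        (coverDeriv ℓ ρ (0, t₀) e) = 0 := by
      refine (christoffel_tubeMetric h _ _ _ _).trans ?_
      rw [hev.self_of_nhds, map_zero]
      exact warpConn_zero _ _ _
    rw [hchr, neg_zero]
    -- In the chart at the point of parameter t₀ the field is constant near t₀: there the chart
    -- composed with `cover` is affine with linear part `prodId f`, and by the chain rule its
    -- derivative is that of the chart after `coverDeriv`.
    refine (hasDerivAt_const t₀ (prodId f e)).congr_of_eventuallyEq ?_
    have hcont : Filter.Tendsto (fun t : ℝ => ((0, t) : Coord n)) (𝓝 t₀) (𝓝 (0, t₀)) :=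
      (ContinuousLinearMap.inr ℝ (EuclideanSpace ℝ (Fin (2 * n))) ℝ).continuous.tendsto t₀
    have hsrc : ∀ᶠ y in 𝓝 ((0, t₀) : Coord n),
        cover ℓ ρ y ∈ (chartAt (Coord n) (cover ℓ ρ (0, t₀))).source :=
      cover_continuous.continuousAt.eventually
        ((chartAt (Coord n) _).open_source.mem_nhds (mem_chart_source _ _))
    filter_upwards [hcont.eventually hev.eventually_nhds, hcont.eventually hsrc] with t ht hts
    have h1 := HasMFDerivAt.comp ((0, t) : Coord n)
      (mdifferentiableAt_extChartAt (I := 𝓘(ℝ, Coord n)) hts).hasMFDerivAt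
      (hasMFDerivAt_cover ((0, t) : Coord n))
    have h2 := hasMFDerivAt_unique h1 (hasFDerivAt_of_eventually_prodId ht).hasMFDerivAt
    exact congrArg (fun L : Coord n →L[ℝ] Coord n => L e) h2

end HypTube

namespace HypTube

variable {n : ℕ} {ℓ : ℝ} {ρ : Matrix.specialOrthogonalGroup (Fin (2 * n)) ℝ} {A B C : ℝ → ℝ}
  {σ τ : ℝ → ℝ} {R : ℝ}

/-! ### The hyperbolic metric in coordinates -/

lemma fderiv_val_coord_symm (y v : Coord n) :
    fderiv ℝ (fun y : Coord n => (Hyp.coord.symm y).val) y v =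
      (v.1, (inner ℝ y.1 v.1 / √(1 + ‖y.1‖ ^ 2) + √(1 + ‖y.1‖ ^ 2) * v.2) * Real.exp y.2,
        (inner ℝ y.1 v.1 / √(1 + ‖y.1‖ ^ 2) - √(1 + ‖y.1‖ ^ 2) * v.2) * Real.exp (-y.2)) := by
  have hpos : 1 + ‖y.1‖ ^ 2 ≠ 0 := by positivity
  have e : (fun y : Coord n => (Hyp.coord.symm y).val) = fun y =>
    (y.1, √(1 + ‖y.1‖ ^ 2) * Real.exp y.2, √(1 + ‖y.1‖ ^ 2) * Real.exp (-y.2)) := rfl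
  have hn : DifferentiableAt ℝ (fun y : Coord n => √(1 + ‖y.1‖ ^ 2)) y :=
    ((differentiableAt_fst.norm_sq ℝ).const_add 1).sqrt hpos
  rw [e]
  refine fderiv_eq_of_line (differentiableAt_fst.prodMk
    ((hn.mul differentiableAt_snd.exp).prodMk (hn.mul differentiableAt_snd.neg.exp))) ?_
  have h1 : HasDerivAt (fun t : ℝ => 1 + ‖(y + t • v).1‖ ^ 2) (2 * inner ℝ y.1 v.1) 0 := by
    simpa using (hasDerivAt_line y v).norm_sq.const_add 1
  have h2 : HasDerivAt (fun t : ℝ => √(1 + ‖(y + t • v).1‖ ^ 2))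
      (inner ℝ y.1 v.1 / √(1 + ‖y.1‖ ^ 2)) 0 := by
    have := h1.sqrt (by simpa using hpos)
    simpa [mul_div_mul_left] using this
  have h3 : HasDerivAt (fun t : ℝ => (y + t • v).2) v.2 0 := by
    simpa using ((hasDerivAt_id (0 : ℝ)).mul_const v.2).const_add y.2
  refine (hasDerivAt_line y v).prodMk (HasDerivAt.prodMk ?_ ?_)
  · refine (h2.mul h3.exp).congr_deriv ?_
    simp
    ring
  · refine (h2.mul h3.neg.exp).congr_deriv ?_
    simp
    ring

lemma mfderiv_val (y : Coord n) :
    mfderiv 𝓘(ℝ, Coord n) 𝓘(ℝ, Mink n) Hyp.val (Hyp.coord.symm y) =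
      fderiv ℝ (fun y : Coord n => (Hyp.coord.symm y).val) y := by
  refine HasMFDerivAt.mfderiv ⟨(continuous_subtype_val (p := fun p : Mink n =>
    lorentz p p = -1 ∧ 0 < p.2.1)).continuousAt, ?_⟩
  have hd : DifferentiableAt ℝ (fun y : Coord n => (Hyp.coord.symm y).val) y := by
    have hpos : 1 + ‖y.1‖ ^ 2 ≠ 0 := by positivity
    have hn : DifferentiableAt ℝ (fun y : Coord n => √(1 + ‖y.1‖ ^ 2)) y :=
      ((differentiableAt_fst.norm_sq ℝ).const_add 1).sqrt hpos
    exact differentiableAt_fst.prodMk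
      ((hn.mul differentiableAt_snd.exp).prodMk (hn.mul differentiableAt_snd.neg.exp))
  have h := hd.hasFDerivAt.hasFDerivWithinAt (s := Set.range 𝓘(ℝ, Coord n))
  have e : extChartAt 𝓘(ℝ, Coord n) (Hyp.coord.symm y) (Hyp.coord.symm y) = y :=
    Hyp.coord.apply_symm_apply y
  rw [e]
  exact h

/-- This is `warpForm` with A = 1, B = -1/(1 + q), C = 1 + q, the case σ = sinh, τ = cosh. -/
lemma hypMetric_coord_symm (y v w : Coord n) :
    hypMetric (Hyp.coord.symm y) v w =
      inner ℝ v.1 w.1 - (1 + ‖y.1‖ ^ 2)⁻¹ * (inner ℝ y.1 v.1 * inner ℝ y.1 w.1)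
        + (1 + ‖y.1‖ ^ 2) * (v.2 * w.2) := by
  have hpos : 0 < 1 + ‖y.1‖ ^ 2 := by positivity
  have h1 : √(1 + ‖y.1‖ ^ 2) ^ 2 = 1 + ‖y.1‖ ^ 2 := Real.sq_sqrt hpos.le
  have h2 : Real.exp y.2 * Real.exp (-y.2) = 1 := by rw [← Real.exp_add]; simp
  have e : hypMetric (Hyp.coord.symm y) v w =
      lorentz (fderiv ℝ (fun y : Coord n => (Hyp.coord.symm y).val) y v)
        (fderiv ℝ (fun y : Coord n => (Hyp.coord.symm y).val) y w) :=
    congrArg (fun L : Coord n →L[ℝ] Mink n => lorentz (L v) (L w)) (mfderiv_val y)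
  rw [e, fderiv_val_coord_symm, fderiv_val_coord_symm, lorentz]
  dsimp only
  generalize √(1 + ‖y.1‖ ^ 2) = s at h1
  rw [← h1]
  linear_combination (-(inner ℝ y.1 v.1 * inner ℝ y.1 w.1 / s ^ 2) + s ^ 2 * v.2 * w.2) * h2

variable [Fact (0 < ℓ)]

lemma isHyperbolicAt_tubeMetric (h : ∀ q, 0 ≤ q → IsRegularAt A B C q)
    (hw : IsWarpCoeff σ τ A B C) (hR : 0 < R) (hp : IsInterpolatingPair R σ τ) {c : Tube ℓ ρ}
    (hc : c ∉ coreNhd ℓ ρ R) : IsHyperbolicAt (tubeMetric ℓ ρ h) c := by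
  rintro p rfl u v
  obtain ⟨y, rfl⟩ := Hyp.coord.symm.surjective p
  have hy : R ≤ Real.arsinh √(‖y.1‖ ^ 2) := by
    have h1 := mt (mem_coreNhd_iff _ R).mpr hc
    rw [not_lt] at h1
    change R ≤ Real.arsinh ‖(lift (cover ℓ ρ y)).1‖ at h1
    rwa [norm_lift_cover, ← Real.sqrt_sq (norm_nonneg y.1)] at h1
  have hq : 0 < ‖y.1‖ ^ 2 := by
    refine (sq_nonneg _).lt_of_ne fun h0 => ?_
    rw [← h0] at hy
    simp at hy
    linarith
  have hA : A (‖y.1‖ ^ 2) = 1 := by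
    rw [hw.A_eq _ hq, hp.sigma_of_ge _ hy, Real.sinh_arsinh, Real.sq_sqrt hq.le, div_self hq.ne']
  have hC : C (‖y.1‖ ^ 2) = 1 + ‖y.1‖ ^ 2 := by
    rw [hw.C_eq _ hq.le, hp.tau_of_ge _ hy, Real.cosh_sq, Real.sinh_arsinh, Real.sq_sqrt hq.le,
      add_comm]
  have hB : B (‖y.1‖ ^ 2) = -(1 + ‖y.1‖ ^ 2)⁻¹ := by
    have h1 := hw.radial _ hq.le
    rw [hA] at h1
    refine mul_left_cancel₀ hq.ne' ?_
    have h2 : (1 + ‖y.1‖ ^ 2) * (1 + ‖y.1‖ ^ 2)⁻¹ = 1 := mul_inv_cancel₀ (by positivity)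
    linarith
  have hd : mfderiv 𝓘(ℝ, Coord n) 𝓘(ℝ, Coord n) (proj ℓ ρ) (Hyp.coord.symm y) =
      coverDeriv ℓ ρ y := by
    rw [(hasMFDerivAt_proj (Hyp.coord.symm y)).mfderiv, Homeomorph.apply_symm_apply]
  rw [hd]
  have key : ∀ u v : Coord n, warpForm A B C y u v =
      inner ℝ u.1 v.1 - (1 + ‖y.1‖ ^ 2)⁻¹ * (inner ℝ y.1 u.1 * inner ℝ y.1 v.1)
        + (1 + ‖y.1‖ ^ 2) * (u.2 * v.2) := fun u v => by
    rw [warpForm, hA, hB, hC]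
    ring
  exact (tubeMetric_inner_cover h y u v).trans ((key u v).trans (hypMetric_coord_symm y u v).symm)

/-! ### The metric in cylindrical coordinates -/

lemma hasMFDerivAt_cyl (r z : ℝ) (θ : EuclideanSpace ℝ (Fin (2 * n))) :
    ∃ L : ℝ × EuclideanSpace ℝ (Fin (2 * n)) × ℝ →L[ℝ] Coord n,
      (∀ a w b, L (a, w, b) = (Real.sinh r • w + (Real.cosh r * a) • θ, b)) ∧
      HasMFDerivAt 𝓘(ℝ, ℝ × EuclideanSpace ℝ (Fin (2 * n)) × ℝ) 𝓘(ℝ, Coord n) (cyl ℓ ρ) (r, θ, z)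
        ((coverDeriv ℓ ρ (Real.sinh r • θ, z)).comp L) := by
  have hs : HasFDerivAt (fun q : ℝ × EuclideanSpace ℝ (Fin (2 * n)) × ℝ => Real.sinh q.1)
      (Real.cosh r • ContinuousLinearMap.fst ℝ ℝ (EuclideanSpace ℝ (Fin (2 * n)) × ℝ))
      (r, θ, z) := (hasFDerivAt_fst (p := (r, θ, z))).sinh
  have h1 := (hs.smul ((hasFDerivAt_fst (p := (θ, z))).comp (r, θ, z)
    (hasFDerivAt_snd (p := (r, θ, z))))).prodMk
      ((hasFDerivAt_snd (p := (θ, z))).comp (r, θ, z) (hasFDerivAt_snd (p := (r, θ, z))))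
  refine ⟨_, fun a w b => ?_, HasMFDerivAt.comp (g := cover ℓ ρ)
    (f := fun q : ℝ × EuclideanSpace ℝ (Fin (2 * n)) × ℝ => (Real.sinh q.1 • q.2.1, q.2.2))
    (r, θ, z) (hasMFDerivAt_cover (Real.sinh r • θ, z)) h1.hasMFDerivAt⟩
  simp

lemma isDoublyWarped_tubeMetric (h : ∀ q, 0 ≤ q → IsRegularAt A B C q)
    (hw : IsWarpCoeff σ τ A B C) (hR : 0 < R) (hp : IsInterpolatingPair R σ τ) :
    IsDoublyWarped (tubeMetric ℓ ρ h) σ τ := by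
  intro r θ z hr hθ a w b hθw
  obtain ⟨L, hL, hd⟩ := hasMFDerivAt_cyl (ℓ := ℓ) (ρ := ρ) r z θ
  rw [hd.mfderiv]
  refine (tubeMetric_inner_cover h (Real.sinh r • θ, z) (L (a, w, b)) (L (a, w, b))).trans ?_
  have hs : 0 ≤ Real.sinh r := Real.sinh_nonneg_iff.mpr hr
  have hn : ‖Real.sinh r • θ‖ ^ 2 = Real.sinh r ^ 2 := by
    rw [norm_smul, hθ, mul_one, Real.norm_eq_abs, sq_abs]
  have har : Real.arsinh √(Real.sinh r ^ 2) = r := by rw [Real.sqrt_sq hs, Real.arsinh_sinh]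
  have hC : C (Real.sinh r ^ 2) = τ r ^ 2 := by rw [hw.C_eq _ (sq_nonneg _), har]
  -- Multiplied out so as to include r = 0, where both sides vanish.
  have hA : A (Real.sinh r ^ 2) * Real.sinh r ^ 2 = σ r ^ 2 := by
    rcases hr.eq_or_lt with rfl | hr
    · rw [hp.sigma_of_le 0 (by positivity)]
      simp
    · have h0 : 0 < Real.sinh r ^ 2 := pow_pos (Real.sinh_pos_iff.mpr hr) 2
      rw [hw.A_eq _ h0, har, div_mul_cancel₀ _ h0.ne']
  -- Moving r at unit speed moves x at speed cosh r along θ; with A + qB = 1/cosh² r the radial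
  -- vector has length 1.
  have hB : Real.cosh r ^ 2 * (A (Real.sinh r ^ 2) + Real.sinh r ^ 2 * B (Real.sinh r ^ 2)) =
      1 := by
    rw [hw.radial _ (sq_nonneg _), Real.cosh_sq, add_comm 1]
    exact mul_inv_cancel₀ (by positivity)
  have hθθ : inner ℝ θ θ = (1 : ℝ) := by rw [real_inner_self_eq_norm_sq, hθ, one_pow]
  have hwθ : inner ℝ w θ = (0 : ℝ) := by rw [real_inner_comm, hθw]
  rw [hL, warpForm]
  dsimp only
  rw [hn, hC]
  simp only [inner_add_left, inner_add_right, inner_smul_left, inner_smul_right, conj_trivial, hθw,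
    hwθ, hθθ, real_inner_self_eq_norm_sq w]
  linear_combination ‖w‖ ^ 2 * hA + a ^ 2 * hB

/-! ### The core geodesic and its holonomy -/

lemma warpForm_zero_left (hw : IsWarpCoeff σ τ A B C) (hR : 0 < R)
    (hp : IsInterpolatingPair R σ τ) (z : ℝ) (v w : Coord n) :
    warpForm A B C (0, z) v w = inner ℝ v.1 w.1 + v.2 * w.2 := by
  have hC : C 0 = 1 := by
    rw [hw.C_eq 0 le_rfl, hp.tau_of_le _ (by simpa using hR.le), one_pow]
  simp [warpForm, hw.A_zero, hC]

lemma isUnitSpeedGeodesic_core (h : ∀ q, 0 ≤ q → IsRegularAt A B C q)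
    (hw : IsWarpCoeff σ τ A B C) (hR : 0 < R) (hp : IsInterpolatingPair R σ τ) :
    RiemGeom.IsUnitSpeedGeodesic (tubeMetric ℓ ρ h) (core ℓ ρ) := by
  rw [show core (n := n) ℓ ρ = fun t => cover ℓ ρ (0, t) from funext core_eq]
  have hv : RiemGeom.velocity (E := Coord n) (fun t => cover (n := n) ℓ ρ (0, t)) =
    fun t => coverDeriv ℓ ρ (0, t) (0, 1) := funext velocity_core
  refine ⟨?_, fun t => ?_⟩
  · rw [hv]
    exact isParallel_coverDeriv h (0, 1)
  · rw [velocity_core]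
    refine (tubeMetric_inner_cover h (0, t) (0, 1) (0, 1)).trans ?_
    rw [warpForm_zero_left hw hR hp]
    simp

/-- The constant field e_j is parallel along the core. By `coverDeriv_rot` its value at z = 0 is the
same tangent vector of the tube as ρ e_j at z = ℓ. Transport from time ℓ to time 0 therefore sends
e_j to ρ e_j, which fixes the direction in which the core is run through. -/
lemma hasNormalHolonomy_core (h : ∀ q, 0 ≤ q → IsRegularAt A B C q)
    (hw : IsWarpCoeff σ τ A B C) (hR : 0 < R) (hp : IsInterpolatingPair R σ τ) :
    RiemGeom.HasNormalHolonomy (tubeMetric ℓ ρ h) (core ℓ ρ) ℓ 0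
      (ρ : Matrix (Fin (2 * n)) (Fin (2 * n)) ℝ) := by
  rw [show core (n := n) ℓ ρ = fun t => cover ℓ ρ (0, t) from funext core_eq]
  have hrot : ((0, ℓ) : Coord n) = (rot ρ ((0, 0) : Coord n).1, ((0, 0) : Coord n).2 + ℓ) := by
    simp [rot]
  refine ⟨?_, by simp, fun i => coverDeriv ℓ ρ (0, ℓ) (EuclideanSpace.single i 1, 0), ?_, ?_, ?_⟩
  · change cover ℓ ρ ((0, ℓ) : Coord n) = cover ℓ ρ ((0, 0) : Coord n)
    rw [hrot, cover_rot]
  · intro i j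
    refine (tubeMetric_inner_cover h (0, ℓ) _ _).trans ?_
    rw [warpForm_zero_left hw hR hp]
    simpa using orthonormal_iff_ite.mp (EuclideanSpace.orthonormal_single (𝕜 := ℝ)) i j
  · intro i
    rw [velocity_core]
    refine (tubeMetric_inner_cover h (0, ℓ) _ (0, 1)).trans ?_
    rw [warpForm_zero_left hw hR hp]
    simp
  · intro j
    refine ⟨fun t => coverDeriv ℓ ρ (0, t) (EuclideanSpace.single j 1, 0),
      isParallel_coverDeriv h _, rfl, ?_⟩
    have e : ∀ i, (ρ : Matrix (Fin (2 * n)) (Fin (2 * n)) ℝ) i j •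
        coverDeriv ℓ ρ (0, ℓ) (EuclideanSpace.single i 1, 0) = coverDeriv ℓ ρ (0, ℓ)
          ((ρ : Matrix (Fin (2 * n)) (Fin (2 * n)) ℝ) i j • (EuclideanSpace.single i 1, 0)) :=
      fun i => (map_smul _ _ _).symm
    have hcol : ((rot ρ (EuclideanSpace.single j 1), 0) : Coord n) =
        ∑ i, (ρ : Matrix (Fin (2 * n)) (Fin (2 * n)) ℝ) i j • (EuclideanSpace.single i 1, 0) := by
      refine Prod.ext ?_ (by simp [Prod.snd_sum])
      ext i
      simp [rot, Prod.fst_sum, Matrix.mulVec_single, Pi.single_apply]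
    change coverDeriv ℓ ρ (0, 0) (EuclideanSpace.single j 1, 0) = ∑ i,
      (ρ : Matrix (Fin (2 * n)) (Fin (2 * n)) ℝ) i j •
        coverDeriv ℓ ρ (0, ℓ) (EuclideanSpace.single i 1, 0)
    rw [Finset.sum_congr rfl fun i _ => e i, ← map_sum, ← hcol, coverDeriv_rot, ← hrot]

end HypTube

end

theorem mainTheorem6 (n : ℕ) (hn : 1 ≤ n) (ℓ : ℝ) [Fact (0 < ℓ)]
    (ρ : Matrix.specialOrthogonalGroup (Fin (2 * n)) ℝ) (R : ℝ) (hR : 37 < R) :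
    ∃ (σ τ : ℝ → ℝ)
      (g : RiemGeom.SmoothMetric (HypTube.Coord n) (HypTube.Tube ℓ ρ)),
      HypTube.IsInterpolatingPair R σ τ ∧
      HypTube.IsDoublyWarped g σ τ ∧
      (∀ c : HypTube.Tube ℓ ρ, c ∉ HypTube.coreNhd ℓ ρ R → HypTube.IsHyperbolicAt g c) ∧
      RiemGeom.FlatOn g (HypTube.coreNhd ℓ ρ (1 / R)) ∧
      RiemGeom.NonposCurved g ∧
      RiemGeom.IsUnitSpeedGeodesic g (HypTube.core ℓ ρ) ∧
      RiemGeom.HasNormalHolonomy g (HypTube.core ℓ ρ) ℓ 0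
        (ρ : Matrix (Fin (2 * n)) (Fin (2 * n)) ℝ) := by
  obtain ⟨σ, τ, hp⟩ := HypTube.exists_isInterpolatingPair hR
  have hR0 : 0 < R := by linarith
  obtain ⟨A, B, C, hw⟩ := HypTube.exists_isWarpCoeff hR0 hp
  have h : ∀ q, 0 ≤ q → HypTube.IsRegularAt A B C q := fun q hq => hw.isRegularAt hR0 hp hq
  exact ⟨σ, τ, HypTube.tubeMetric ℓ ρ h, hp, HypTube.isDoublyWarped_tubeMetric h hw hR0 hp,
    fun c hc => HypTube.isHyperbolicAt_tubeMetric h hw hR0 hp hc,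
    HypTube.flatOn_tubeMetric h hw hR0 hp, HypTube.nonposCurved_tubeMetric h hw hR0 hp,
    HypTube.isUnitSpeedGeodesic_core h hw hR0 hp, HypTube.hasNormalHolonomy_core h hw hR0 hp⟩
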